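/- **Conventions.** An element $f$ of the Brown–Thompson group $F_3$ is given by its unique reduced pair $(T_+,T_-)$ of finite rooted planar ternary trees with the same number of leaves; $T_+$ is drawn with its root at the top, $T_-$ upside down below it with its root at the bottom, and the $i$-th leaf of $T_+$ is identified with the $i$-th leaf of $T_-$. Vertices have addresses in $\{0,1,2\}^*$, read from the root ($0$ = left, $1$ = middle, $2$ = right). The pair is reduced if no three consecutive leaves are the children of one vertex both in $T_+$ and in $T_-$. If $\alpha$ is the address of a leaf of $T_+$, then $f\diamond_\alpha g$ is the element obtained by attaching the pair of trees of $g$ at the leaf $\alpha$ of $T_+$ and at the corresponding leaf of $T_-$; $f\diamond_0 g$ is $f\diamond_\alpha g$ for $\alpha=0^m$ the leftmost leaf. The link $\mathcal L(f)$ has the following diagram: at every vertex of $T_\pm$ the strand from the left to the right child passes over the strand from the parent edge to the middle child, and the two roots are joined by an arc on the left. The component through the roots is the central component $\mathcal K(f)$; it is oriented clockwise, i.e. downwards at the root of $T_+$. Links are considered up to isotopy (diagrams up to planar isotopy and Reidemeister moves). For $n\ge 1$ let $H^{n}\in F_3$ be defined as follows (trees are given by the addresses of their interior vertices). $H^1$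 has upper tree $\{\emptyset,1,11\}$ and lower tree $\{\emptyset,0,01\}$. $H^{n}$ ($n\ge2$) is obtained from $H^{n-1}$ by adding vertices at the leaves $11\,2^{n-2}0$ and $11\,2^{n-1}$ of the upper tree and attaching the tree $\{\emptyset,1\}$ at the leaf $0\,2^{n-1}$ of the lower tree. $H^{-1}$ has upper tree $\{\emptyset,1,12\}$ and lower tree $\{\emptyset,2,20\}$. $H^{-n}$ ($n\ge2$) is obtained from $H^{-(n-1)}$ by adding vertices at the leaves $2\,0^{n}$ and $2\,0^{n-1}2$ of the lower tree and attaching the tree $\{\emptyset,1\}$ at the leaf $11\,0^{n-2}$ of the upper tree. Put $$l_n(f,g)=(H^n\diamond_{12}f)\diamond_0 g,\qquad l_{-n}(f,g)=(H^{-n}\diamond_{10}f)\diamond_0 g .$$ In $\mathcal L(l_{n}(f,g))$ denote by $\mathcal K(f)$ and $\mathcal K(g)$ the components through the points where $f$ and $g$ are attached (the addresses $12$ and $0$), and likewise in $\mathcal L(l_{-n}(f,g))$ (the addresses $10$ and $0$); both are oriented downwards at these points, which agrees with the orientations of the central components of $\mathcal L(f)$ and $\mathcal L(g)$. **Proposition.**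 Let $f,g\in F_3$ and let $n\ge1$ be an integer. 1. In $\mathcal L(l_n(f,g))$ the components $\mathcal K(f)$ and $\mathcal K(g)$ are distinct, and $\operatorname{lk}(\mathcal K(f),\mathcal K(g))=n$. Moreover $\mathcal L(l_n(f,g))$ is isotopic, by an isotopy respecting these two oriented components, to the link with the following twisted diagram: two strands, one belonging to $\mathcal K(f)$ and one to $\mathcal K(g)$, are twisted around each other by $n$ full twists, i.e. by the two-strand braid with $2n$ crossings in each of which the strand from the upper right to the lower left lies over; the first strand is closed up by an arc on its left and the second one by an arc on its right; and the diagrams of $f$ and $g$ (cut open at the roots) are inserted in the first and in the second strand, so that both strands are directed downwards in the twists. 2. In $\mathcal L(l_{-n}(f,g))$ the components $\mathcal K(f)$ and $\mathcal K(g)$ are distinct, and $\operatorname{lk}(\mathcal K(f),\mathcal K(g))=-n$. Moreover $\mathcal L(l_{-n}(f,g))$ is isotopic, by an isotopy respecting these two oriented components, to the link with the analogous diagram, with the same twists, in which the diagram of $g$ is inserted in the closing arc on the right (directed downwards there), so that the two strands are directed oppositely in the twists. -/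

import Mathlib

namespace ThompsonLink

/-! ### Ternary trees and the Brown–Thompson group `F₃` -/

/-- Finite rooted planar ternary trees. -/
inductive TernaryTree : Type
  | leaf : TernaryTree
  | node (l m r : TernaryTree) : TernaryTree

namespace TernaryTree

/-- The number of leaves. Leaves are numbered from left to right, starting with `0`. -/
def numLeaves : TernaryTree → ℕ
  | leaf => 1
  | node l m r => l.numLeaves + m.numLeaves + r.numLeaves

/-- The tree with exactly one interior vertex. -/
def caret : TernaryTree := node leaf leaf leaf

/-- The leaves number `i`, `i + 1`, `i + 2` are the three children of one vertex. -/
def HasCaretAt : TernaryTree → ℕ → Prop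
  | leaf, _ => False
  | node l m r, i =>
      (l = leaf ∧ m = leaf ∧ r = leaf ∧ i = 0) ∨ l.HasCaretAt i ∨
        (∃ j, i = l.numLeaves + j ∧ m.HasCaretAt j) ∨
        (∃ j, i = l.numLeaves + m.numLeaves + j ∧ r.HasCaretAt j)

/-- Replace the leaf number `i` of a tree by the tree `S` (nothing happens if there is no such
leaf). -/
def graft : TernaryTree → ℕ → TernaryTree → TernaryTree
  | leaf, i, S => if i = 0 then S else leaf
  | node l m r, i, S =>
      if i < l.numLeaves then node (l.graft i S) m r
      else if i < l.numLeaves + m.numLeaves then node l (m.graft (i - l.numLeaves) S) r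
      else node l m (r.graft (i - (l.numLeaves + m.numLeaves)) S)

/-- Addresses of vertices: words in `0` (left), `1` (straight), `2` (right), read from the root. -/
abbrev Address : Type := List (Fin 3)

/-- The number of the leaf with address `α`; it is `none` if there is no leaf at `α`. -/
def leafIndex : TernaryTree → Address → Option ℕ
  | leaf, [] => some 0
  | leaf, _ :: _ => none
  | node _ _ _, [] => none
  | node l m r, d :: α =>
      match d with
      | 0 => l.leafIndex α
      | 1 => (m.leafIndex α).map (fun j => l.numLeaves + j)
      | 2 => (r.leafIndex α).map (fun j => l.numLeaves + m.numLeaves + j)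

/-- The address of the unique leaf of the form `d d ... d`. -/
def constLeaf (d : Fin 3) : TernaryTree → Address
  | leaf => []
  | node l m r =>
      match d with
      | 0 => d :: constLeaf d l
      | 1 => d :: constLeaf d m
      | 2 => d :: constLeaf d r

theorem numLeaves_pos (T : TernaryTree) : 0 < T.numLeaves := by
  induction T with
  | leaf => simp [numLeaves]
  | node l m r hl hm hr => simp only [numLeaves]; omega

theorem eq_leaf_of_numLeaves {T : TernaryTree} (h : T.numLeaves = 1) : T = leaf := by
  cases T with
  | leaf => rfl
  | node l m r =>
      have := numLeaves_pos l; have := numLeaves_pos m; have := numLeaves_pos r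
      simp only [numLeaves] at h; omega

theorem HasCaretAt.lt {T : TernaryTree} {i : ℕ} (h : T.HasCaretAt i) : i + 2 < T.numLeaves := by
  induction T generalizing i with
  | leaf => exact h.elim
  | node l m r hl hm hr =>
      have := numLeaves_pos l; have := numLeaves_pos m; have := numLeaves_pos r
      simp only [numLeaves]
      rcases h with ⟨-, -, -, rfl⟩ | h | ⟨j, rfl, h⟩ | ⟨j, rfl, h⟩
      · omega
      · have := hl h; omega
      · have := hm h; omega
      · have := hr h; omega

theorem numLeaves_graft (T : TernaryTree) (i : ℕ) (S : TernaryTree) :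
    (T.graft i S).numLeaves =
      if i < T.numLeaves then T.numLeaves + S.numLeaves - 1 else T.numLeaves := by
  induction T generalizing i with
  | leaf =>
      by_cases h : i = 0
      · simp [graft, numLeaves, h]
      · have : ¬ i < 1 := by omega
        simp [graft, numLeaves, h]
  | node l m r hl hm hr =>
      have := numLeaves_pos l; have := numLeaves_pos m; have := numLeaves_pos r
      have := numLeaves_pos S
      simp only [graft]
      split_ifs <;> simp only [numLeaves, hl, hm, hr] at * <;> split_ifs <;> omega

theorem graft_leaf (T : TernaryTree) (i : ℕ) : T.graft i leaf = T := by
  induction T generalizing i with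
  | leaf => simp [graft]
  | node l m r hl hm hr => simp [graft, hl, hm, hr]

theorem graft_of_not_lt (T S : TernaryTree) {i : ℕ} (h : ¬ i < T.numLeaves) : T.graft i S = T := by
  induction T generalizing i with
  | leaf =>
      have : i ≠ 0 := by simp only [numLeaves] at h; omega
      simp [graft, this]
  | node l m r hl hm hr =>
      simp only [numLeaves] at h
      have h1 : ¬ i < l.numLeaves := by omega
      have h2 : ¬ i < l.numLeaves + m.numLeaves := by omega
      simp only [graft, if_neg h1, if_neg h2]
      rw [hr (by omega)]

theorem graft_ne_leaf {T : TernaryTree} {i : ℕ} {S : TernaryTree} (hS : S ≠ leaf)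
    (hi : i < T.numLeaves) : T.graft i S ≠ leaf := by
  cases T with
  | leaf =>
      have : i = 0 := by simp only [numLeaves] at hi; omega
      simpa [graft, this] using hS
  | node l m r => simp only [graft]; split_ifs <;> simp

theorem hasCaretAt_graft {T : TernaryTree} {i j : ℕ} {S : TernaryTree} (hS : S ≠ leaf)
    (hi : i < T.numLeaves) (h : (T.graft i S).HasCaretAt j) :
    (j + 2 < i ∧ T.HasCaretAt j) ∨ (∃ k, j = i + k ∧ S.HasCaretAt k) ∨
      (∃ k, i < k ∧ j + 1 = k + S.numLeaves ∧ T.HasCaretAt k) := by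
  induction T generalizing i j with
  | leaf =>
      have : i = 0 := by simp only [numLeaves] at hi; omega
      subst this
      simp only [graft, if_true] at h
      exact Or.inr (Or.inl ⟨j, by omega, h⟩)
  | node l m r hl hm hr =>
      have := numLeaves_pos l; have := numLeaves_pos m; have := numLeaves_pos r
      have := numLeaves_pos S
      simp only [numLeaves] at hi
      simp only [graft] at h
      split_ifs at h with h1 h2
      · have hn := numLeaves_graft l i S
        rw [if_pos h1] at hn
        rcases h with ⟨e, -⟩ | h | ⟨k, rfl, h⟩ | ⟨k, rfl, h⟩
        · exact absurd e (graft_ne_leaf hS h1)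
        · rcases hl h1 h with ⟨a, b⟩ | ⟨k, a, b⟩ | ⟨k, a, b, c⟩
          · exact Or.inl ⟨a, Or.inr (Or.inl b)⟩
          · exact Or.inr (Or.inl ⟨k, a, b⟩)
          · exact Or.inr (Or.inr ⟨k, a, b, Or.inr (Or.inl c)⟩)
        · exact Or.inr (Or.inr ⟨l.numLeaves + k, by omega, by omega,
            Or.inr (Or.inr (Or.inl ⟨k, rfl, h⟩))⟩)
        · exact Or.inr (Or.inr ⟨l.numLeaves + m.numLeaves + k, by omega, by omega,
            Or.inr (Or.inr (Or.inr ⟨k, rfl, h⟩))⟩)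
      · have h3 : i - l.numLeaves < m.numLeaves := by omega
        have hn := numLeaves_graft m (i - l.numLeaves) S
        rw [if_pos h3] at hn
        rcases h with ⟨-, e, -⟩ | h | ⟨k, rfl, h⟩ | ⟨k, rfl, h⟩
        · exact absurd e (graft_ne_leaf hS h3)
        · have := h.lt
          exact Or.inl ⟨by omega, Or.inr (Or.inl h)⟩
        · rcases hm h3 h with ⟨a, b⟩ | ⟨k', a, b⟩ | ⟨k', a, b, c⟩
          · exact Or.inl ⟨by omega, Or.inr (Or.inr (Or.inl ⟨k, rfl, b⟩))⟩
          · exact Or.inr (Or.inl ⟨k', by omega, b⟩)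
          · exact Or.inr (Or.inr ⟨l.numLeaves + k', by omega, by omega,
              Or.inr (Or.inr (Or.inl ⟨k', rfl, c⟩))⟩)
        · exact Or.inr (Or.inr ⟨l.numLeaves + m.numLeaves + k, by omega, by omega,
            Or.inr (Or.inr (Or.inr ⟨k, rfl, h⟩))⟩)
      · have h3 : i - (l.numLeaves + m.numLeaves) < r.numLeaves := by omega
        rcases h with ⟨-, -, e, -⟩ | h | ⟨k, rfl, h⟩ | ⟨k, rfl, h⟩
        · exact absurd e (graft_ne_leaf hS h3)
        · have := h.lt
          exact Or.inl ⟨by omega, Or.inr (Or.inl h)⟩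
        · have := h.lt
          exact Or.inl ⟨by omega, Or.inr (Or.inr (Or.inl ⟨k, rfl, h⟩))⟩
        · rcases hr h3 h with ⟨a, b⟩ | ⟨k', a, b⟩ | ⟨k', a, b, c⟩
          · exact Or.inl ⟨by omega, Or.inr (Or.inr (Or.inr ⟨k, rfl, b⟩))⟩
          · exact Or.inr (Or.inl ⟨k', by omega, b⟩)
          · exact Or.inr (Or.inr ⟨l.numLeaves + m.numLeaves + k', by omega, by omega,
              Or.inr (Or.inr (Or.inr ⟨k', rfl, c⟩))⟩)

end TernaryTree

open TernaryTree

/-- The elements of the Brown–Thompson group `F₃`, each given by its reduced pair of ternary trees: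
the upper tree (domain) and the lower tree (range) have equally many leaves, and no caret of the
upper tree faces a caret of the lower tree. -/
structure F3 : Type where
  upper : TernaryTree
  lower : TernaryTree
  numLeaves_eq : upper.numLeaves = lower.numLeaves
  reduced : ∀ i, ¬ (upper.HasCaretAt i ∧ lower.HasCaretAt i)

namespace F3

/-- The identity element: both trees are trivial. -/
def one : F3 := ⟨leaf, leaf, rfl, fun _ h => h.1⟩

/-- Attach the pair of trees of `g` at the leaf number `i` of the pair of trees of `f`, i.e. the
upper tree of `g` at that leaf of the upper tree of `f` and the lower tree of `g` at that leaf of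
the lower tree of `f`. The result is again reduced. -/
def attach (f : F3) (i : ℕ) (g : F3) : F3 where
  upper := f.upper.graft i g.upper
  lower := f.lower.graft i g.lower
  numLeaves_eq := by
    rw [numLeaves_graft, numLeaves_graft, f.numLeaves_eq, g.numLeaves_eq]
  reduced := by
    intro j hj
    have he := g.numLeaves_eq
    by_cases hg : g.upper = leaf
    · have hg' : g.lower = leaf := by
        apply eq_leaf_of_numLeaves
        rw [← he, hg]
        rfl
      rw [hg, hg', graft_leaf, graft_leaf] at hj
      exact f.reduced j hj
    have hg' : g.lower ≠ leaf := by
      intro h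
      apply hg
      apply eq_leaf_of_numLeaves
      rw [he, h]
      rfl
    by_cases hi : i < f.upper.numLeaves
    · have hi' : i < f.lower.numLeaves := f.numLeaves_eq ▸ hi
      rcases hasCaretAt_graft hg hi hj.1 with ⟨a, b⟩ | ⟨k, a, b⟩ | ⟨k, a, b, c⟩ <;>
        rcases hasCaretAt_graft hg' hi' hj.2 with ⟨a', b'⟩ | ⟨k', a', b'⟩ | ⟨k', a', b', c'⟩
      · exact f.reduced j ⟨b, b'⟩
      · omega
      · omega
      · omega
      · have : k = k' := by omega
        exact g.reduced k ⟨b, this ▸ b'⟩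
      · have := b.lt
        omega
      · omega
      · have := b'.lt
        omega
      · have : k = k' := by omega
        exact f.reduced k ⟨c, this ▸ c'⟩
    · rw [graft_of_not_lt _ _ hi, graft_of_not_lt _ _ (f.numLeaves_eq ▸ hi)] at hj
      exact f.reduced j hj

/-- `f ⋄_α g`: attach `g` at the leaf with address `α` of the upper tree of `f`. (Only meant for
addresses `α` of leaves; otherwise the value is `f`.) -/
def diamondAt (f : F3) (α : Address) (g : F3) : F3 :=
  match f.upper.leafIndex α with
  | some i => f.attach i g
  | none => f

/-- `f ⋄_d g`: attach `g` at the leaf of `f` with address `d d ... d`. -/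
def diamond (d : Fin 3) (f g : F3) : F3 :=
  f.diamondAt (constLeaf d f.upper) g

end F3

/-! ### The elements `H^n`, `H^{-n}` and the linking moves -/

/-- The subtree at the address `11` of the upper tree of `H^(k+1)`. Passing from `k` to `k + 1`
adds a caret at the addresses `2^k 0` and `2^(k+1)`. -/
def posUp : ℕ → TernaryTree
  | 0 => caret
  | k + 1 => node caret leaf (posUp k)

/-- The subtree at the address `0` of the lower tree of `H^(k+1)`. Passing from `k` to `k + 1`
replaces the leaf `2^(k+1)` by the tree `node leaf caret leaf`. -/
def posLow : ℕ → TernaryTree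
  | 0 => node leaf caret leaf
  | k + 1 => node leaf caret (posLow k)

/-- The subtree at the address `11` of the upper tree of `H^(-(k+1))`. Passing from `k` to `k + 1`
replaces the leaf `0^k` by the tree `node leaf caret leaf`. -/
def negUp : ℕ → TernaryTree
  | 0 => leaf
  | k + 1 => node (negUp k) caret leaf

/-- The subtree at the address `20` of the lower tree of `H^(-(k+1))`. Passing from `k` to `k + 1`
adds a caret at the addresses `0^(k+1)` and `0^k 2`. -/
def negLow : ℕ → TernaryTree
  | 0 => caret
  | k + 1 => node (negLow k) leaf caret

theorem numLeaves_posUp (k : ℕ) : (posUp k).numLeaves = 4 * k + 3 := by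
  induction k with
  | zero => rfl
  | succ k ih => simp only [posUp, caret, numLeaves, ih]; omega

theorem numLeaves_posLow (k : ℕ) : (posLow k).numLeaves = 4 * k + 5 := by
  induction k with
  | zero => rfl
  | succ k ih => simp only [posLow, caret, numLeaves, ih]; omega

theorem numLeaves_negUp (k : ℕ) : (negUp k).numLeaves = 4 * k + 1 := by
  induction k with
  | zero => rfl
  | succ k ih => simp only [negUp, caret, numLeaves, ih]; omega

theorem numLeaves_negLow (k : ℕ) : (negLow k).numLeaves = 4 * k + 3 := by
  induction k with
  | zero => rfl
  | succ k ih => simp only [negLow, caret, numLeaves, ih]; omega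

theorem caret_mod_posUp (k i : ℕ) (h : (posUp k).HasCaretAt i) : i % 4 = 0 := by
  induction k generalizing i with
  | zero => simp [posUp, caret, HasCaretAt] at h; omega
  | succ k ih =>
      simp only [posUp, caret, HasCaretAt, numLeaves] at h
      rcases h with ⟨h, -⟩ | h | ⟨j, -, h⟩ | ⟨j, rfl, h⟩
      · cases h
      · simp at h; omega
      · exact h.elim
      · have := ih j h; omega

theorem caret_mod_posLow (k i : ℕ) (h : (posLow k).HasCaretAt i) : i % 4 = 1 := by
  induction k generalizing i with
  | zero => simp [posLow, caret, HasCaretAt, numLeaves] at h; omega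
  | succ k ih =>
      simp only [posLow, caret, HasCaretAt, numLeaves] at h
      rcases h with ⟨-, h, -⟩ | h | ⟨j, rfl, h⟩ | ⟨j, rfl, h⟩
      · cases h
      · exact h.elim
      · simp at h; omega
      · have := ih j h; omega

theorem caret_mod_negUp (k i : ℕ) (h : (negUp k).HasCaretAt i) : i % 4 = 1 := by
  induction k generalizing i with
  | zero => exact h.elim
  | succ k ih =>
      simp only [negUp, caret, HasCaretAt, numLeaves, numLeaves_negUp] at h
      rcases h with ⟨-, h, -⟩ | h | ⟨j, rfl, h⟩ | ⟨j, rfl, h⟩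
      · cases h
      · exact ih i h
      · simp at h; omega
      · exact h.elim

theorem caret_mod_negLow (k i : ℕ) (h : (negLow k).HasCaretAt i) : i % 4 = 0 := by
  induction k generalizing i with
  | zero => simp [negLow, caret, HasCaretAt] at h; omega
  | succ k ih =>
      simp only [negLow, caret, HasCaretAt, numLeaves, numLeaves_negLow] at h
      rcases h with ⟨-, -, h, -⟩ | h | ⟨j, -, h⟩ | ⟨j, rfl, h⟩
      · cases h
      · exact ih i h
      · exact h.elim
      · simp at h; omega

/-- The element `H^n`, for `n ≥ 1`. -/
def hopfPos (n : ℕ) : F3 where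
  upper := node leaf (node leaf (posUp (n - 1)) leaf) leaf
  lower := node (posLow (n - 1)) leaf leaf
  numLeaves_eq := by
    simp only [numLeaves, numLeaves_posUp, numLeaves_posLow]; omega
  reduced := by
    rintro i ⟨hu, hl⟩
    simp only [HasCaretAt, numLeaves, and_false, exists_false, or_false, false_or] at hu hl
    rcases hl with ⟨e, -, -, -⟩ | hl
    · have := numLeaves_posLow (n - 1)
      rw [e] at this
      simp only [numLeaves] at this; omega
    have := caret_mod_posLow _ _ hl
    rcases hu with ⟨-, e, -⟩ | ⟨j, rfl, ⟨-, e, -⟩ | ⟨j', rfl, h⟩⟩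
    · cases e
    · have := numLeaves_posUp (n - 1)
      rw [e] at this
      simp only [numLeaves] at this; omega
    · have := caret_mod_posUp _ _ h
      omega

/-- The element `H^{-n}`, for `n ≥ 1`. -/
def hopfNeg (n : ℕ) : F3 where
  upper := node leaf (node leaf (negUp (n - 1)) caret) leaf
  lower := node leaf leaf (node (negLow (n - 1)) leaf leaf)
  numLeaves_eq := by
    simp only [numLeaves, caret, numLeaves_negUp, numLeaves_negLow]; omega
  reduced := by
    rintro i ⟨hu, hl⟩
    simp only [HasCaretAt, numLeaves, and_false, exists_false, or_false, false_or] at hu hl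
    have h2 : i % 4 = 2 := by
      rcases hl with ⟨-, -, e, -⟩ | ⟨j, rfl, ⟨e, -⟩ | h⟩
      · cases e
      · have := numLeaves_negLow (n - 1)
        rw [e] at this
        simp only [numLeaves] at this; omega
      · have := caret_mod_negLow _ _ h
        omega
    rcases hu with ⟨-, e, -⟩ | ⟨j, rfl, ⟨-, -, e, -⟩ | ⟨j', rfl, h⟩ | ⟨j', rfl, h⟩⟩
    · cases e
    · cases e
    · have := caret_mod_negUp _ _ h
      omega
    · simp only [caret, HasCaretAt, numLeaves, numLeaves_negUp] at h h2
      simp at h; omega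

/-- The linking move `l_n(f, g) = (H^n ⋄_{12} f) ⋄_0 g`. -/
def linkPos (n : ℕ) (f g : F3) : F3 := F3.diamond 0 ((hopfPos n).diamondAt [1, 2] f) g

/-- The linking move `l_{-n}(f, g) = (H^{-n} ⋄_{10} f) ⋄_0 g`. -/
def linkNeg (n : ℕ) (f g : F3) : F3 := F3.diamond 0 ((hopfNeg n).diamondAt [1, 0] f) g

/-! ### Link and tangle diagrams up to isotopy -/

/-- The names of the two marked components. -/
inductive Label : Type
  | Kf : Label
  | Kg : Label

/-- The elementary pieces of a planar diagram cut into horizontal slices and read from top to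
bottom; `i` is the number (from the left, starting with `0`) of the leftmost strand involved.
* `cap i`: a local maximum; two new strands `i`, `i + 1` begin.
* `cup i`: a local minimum; the strands `i`, `i + 1` are joined and end.
* `cross b i`: the strands `i`, `i + 1` cross. If `b = true`, the strand from the upper right to the
  lower left lies over the other one, if `b = false`, it lies under it.
* `mark c d i`: the strand `i` carries a point that marks its component as the one named `c` and
  orients it: downwards at that point if `d = true`, upwards if `d = false`. -/
inductive Slice : Type
  | cap (i : ℕ) : Slice
  | cup (i : ℕ) : Slice
  | cross (b : Bool) (i : ℕ) : Slice
  | mark (c : Label) (d : Bool) (i : ℕ) : Slice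

namespace Slice

/-- The number of strands that enter the piece from above. -/
def inputs : Slice → ℕ
  | cap _ => 0
  | cup _ => 2
  | cross _ _ => 2
  | mark _ _ _ => 1

/-- The number of strands that leave the piece below. -/
def outputs : Slice → ℕ
  | cap _ => 2
  | cup _ => 0
  | cross _ _ => 2
  | mark _ _ _ => 1

/-- The number of the leftmost strand involved. -/
def pos : Slice → ℕ
  | cap i => i
  | cup i => i
  | cross _ i => i
  | mark _ _ i => i

/-- The same piece, moved to the strand `i`. -/
def at' : Slice → ℕ → Slice
  | cap _, i => cap i
  | cup _, i => cup i
  | cross b _, i => cross b i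
  | mark c d _, i => mark c d i

end Slice

open Slice

/-- A sliced diagram, from top to bottom. -/
abbrev Diagram : Type := List Slice

/-- `IsTangle w k m`: the word `w` is a tangle diagram with `k` upper and `m` lower endpoints. Link
diagrams are the case `k = m = 0`. -/
inductive IsTangle : Diagram → ℕ → ℕ → Prop
  | nil (k : ℕ) : IsTangle [] k k
  | cons (s : Slice) (w : Diagram) (r m : ℕ) (hs : s.pos ≤ r)
      (hw : IsTangle w (r + s.outputs) m) : IsTangle (s :: w) (r + s.inputs) m

/-- The local moves on sliced diagrams that generate isotopy of tangles: planar isotopies, the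
Reidemeister moves, and sliding a mark along its strand. -/
inductive Move : Diagram → Diagram → Prop
  | exchange (a b : Slice) (i d : ℕ) :
      Move [b.at' (i + a.inputs + d), a.at' i] [a.at' i, b.at' (i + a.outputs + d)]
  | zigzag_left (i : ℕ) : Move [cap (i + 1), cup i] []
  | zigzag_right (i : ℕ) : Move [cap i, cup (i + 1)] []
  | cap_slide (b : Bool) (i : ℕ) : Move [cap i, cross b (i + 1)] [cap (i + 1), cross (!b) i]
  | cup_slide (b : Bool) (i : ℕ) : Move [cross b (i + 1), cup i] [cross (!b) i, cup (i + 1)]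
  | reidemeister_one_cap (b : Bool) (i : ℕ) : Move [cap i, cross b i] [cap i]
  | reidemeister_one_cup (b : Bool) (i : ℕ) : Move [cross b i, cup i] [cup i]
  | reidemeister_two (b : Bool) (i : ℕ) : Move [cross b i, cross (!b) i] []
  | reidemeister_three (b : Bool) (i : ℕ) :
      Move [cross b i, cross b (i + 1), cross b i] [cross b (i + 1), cross b i, cross b (i + 1)]
  | mark_cross_left (c : Label) (d b : Bool) (i : ℕ) :
      Move [mark c d i, cross b i] [cross b i, mark c d (i + 1)]
  | mark_cross_right (c : Label) (d b : Bool) (i : ℕ) :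
      Move [mark c d (i + 1), cross b i] [cross b i, mark c d i]
  | mark_cap (c : Label) (d : Bool) (i : ℕ) :
      Move [cap i, mark c d i] [cap i, mark c (!d) (i + 1)]
  | mark_cup (c : Label) (d : Bool) (i : ℕ) :
      Move [mark c d i, cup i] [mark c (!d) (i + 1), cup i]

/-- One local move, applied somewhere inside a tangle diagram with `k` upper and `m` lower
endpoints. -/
def Step (k m : ℕ) (w w' : Diagram) : Prop :=
  IsTangle w k m ∧ IsTangle w' k m ∧
    ∃ p a b s : Diagram, w = p ++ a ++ s ∧ w' = p ++ b ++ s ∧ Move a b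

/-- Isotopy of links with marked, oriented components, in terms of their diagrams. -/
def LinkIsotopic (w w' : Diagram) : Prop :=
  IsTangle w 0 0 ∧ IsTangle w' 0 0 ∧ Relation.EqvGen (Step 0 0) w w'

/-! ### Jones' construction -/

/-- The diagram of an upper tree whose root is the strand `i`. At every vertex, the strand from the
left to the right child (a local maximum) passes over the strand from the root to the middle child.
The edge that ends in the vertex `α` carries a mark `c`, directed downwards, if `μ α = some c`. -/
def upperDiagram : TernaryTree → (Address → Option Label) → ℕ → Diagram
  | leaf, μ, i => (μ []).toList.map (fun c => mark c true i)
  | node l m r, μ, i =>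
      (μ []).toList.map (fun c => mark c true i) ++ [cap (i + 1), cross true i] ++
        upperDiagram r (fun α => μ (2 :: α)) (i + 2) ++
        upperDiagram m (fun α => μ (1 :: α)) (i + 1) ++
        upperDiagram l (fun α => μ (0 :: α)) i

/-- The diagram of a lower tree (drawn upside down, the root at the bottom) whose root is the strand
`i`. Again the strand from the left to the right child passes over. -/
def lowerDiagram : TernaryTree → ℕ → Diagram
  | leaf, _ => []
  | node l m r, i =>
      lowerDiagram l i ++ lowerDiagram m (i + 1) ++ lowerDiagram r (i + 2) ++
        [cross false i, cup (i + 1)]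

/-- The diagram of the pair of trees of `f` before the two roots are joined, with both roots on the
strand `i`. -/
def openDiagram (f : F3) (μ : Address → Option Label) (i : ℕ) : Diagram :=
  upperDiagram f.upper μ i ++ lowerDiagram f.lower i

/-- The diagram of the link `𝓛(f)`: the two roots are joined by an arc on the left. -/
def linkDiagram (f : F3) (μ : Address → Option Label) : Diagram :=
  [cap 0] ++ openDiagram f μ 1 ++ [cup 0]

/-- The mark `c` at the root, that is on the central component `𝓚(f)`, which is oriented downwards
there (clockwise, as the roots are joined on the left). -/
def markRoot (c : Label) (α : Address) : Option Label :=
  if α = [] then some c else none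

/-- The mark `Kf` at the address `α` and the mark `Kg` at the address `β`. -/
def markAt (α β : Address) (γ : Address) : Option Label :=
  if γ = α then some Label.Kf else if γ = β then some Label.Kg else none

/-- The link diagram of `l_n(f, g)` with the component `𝓚(f)` marked where `f` is attached (address
`12`) and the component `𝓚(g)` marked where `g` is attached (address `0`), both oriented downwards
there as in the conventions for `𝓚(f)` and `𝓚(g)`. -/
def linkPosDiagram (n : ℕ) (f g : F3) : Diagram :=
  linkDiagram (linkPos n f g) (markAt [1, 2] [0])

/-- The same for `l_{-n}(f, g)`, where `f` is attached at the address `10` and `g` at `0`. -/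
def linkNegDiagram (n : ℕ) (f g : F3) : Diagram :=
  linkDiagram (linkNeg n f g) (markAt [1, 0] [0])

/-! ### Components and linking numbers -/

/-- A point of a diagram together with a direction: the strand number `strand` at the height just
above the slice number `level`, travelled downwards or upwards. -/
structure DirectedPoint : Type where
  level : ℕ
  strand : ℕ
  down : Bool

/-- Travel along the strand to the next height. -/
def next (w : Diagram) : DirectedPoint → DirectedPoint
  | ⟨t, i, true⟩ =>
      match w[t]? with
      | none => ⟨t, i, true⟩
      | some (cap j) => if i < j then ⟨t + 1, i, true⟩ else ⟨t + 1, i + 2, true⟩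
      | some (cup j) =>
          if i < j then ⟨t + 1, i, true⟩
          else if i = j then ⟨t, j + 1, false⟩
          else if i = j + 1 then ⟨t, j, false⟩
          else ⟨t + 1, i - 2, true⟩
      | some (cross _ j) =>
          if i = j then ⟨t + 1, j + 1, true⟩
          else if i = j + 1 then ⟨t + 1, j, true⟩
          else ⟨t + 1, i, true⟩
      | some (mark _ _ _) => ⟨t + 1, i, true⟩
  | ⟨0, i, false⟩ => ⟨0, i, false⟩
  | ⟨t + 1, i, false⟩ =>
      match w[t]? with
      | none => ⟨t + 1, i, false⟩
      | some (cap j) =>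
          if i < j then ⟨t, i, false⟩
          else if i = j then ⟨t + 1, j + 1, true⟩
          else if i = j + 1 then ⟨t + 1, j, true⟩
          else ⟨t, i - 2, false⟩
      | some (cup j) => if i < j then ⟨t, i, false⟩ else ⟨t, i + 2, false⟩
      | some (cross _ j) =>
          if i = j then ⟨t, j + 1, false⟩
          else if i = j + 1 then ⟨t, j, false⟩
          else ⟨t, i, false⟩
      | some (mark _ _ _) => ⟨t, i, false⟩

/-- The component of `w` marked by `c` passes through the point `p` in the given direction. -/
def OnComponent (w : Diagram) (c : Label) (p : DirectedPoint) : Prop :=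
  ∃ (t i : ℕ) (d : Bool), w[t]? = some (mark c d i) ∧ ∃ k : ℕ, (next w)^[k] ⟨t, i, d⟩ = p

/-- The components of `w` marked by `c` and `c'` both exist and are different. -/
def DistinctComponents (w : Diagram) (c c' : Label) : Prop :=
  (∃ p, OnComponent w c p) ∧ (∃ p, OnComponent w c' p) ∧
    ∀ t i d d', OnComponent w c ⟨t, i, d⟩ → ¬ OnComponent w c' ⟨t, i, d'⟩

open scoped Classical in
/-- `1` if the component marked by `c` passes downwards through the strand `i` at height `t`, `-1` if
it passes upwards, `0` if it does not pass. -/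
noncomputable def direction (w : Diagram) (c : Label) (t i : ℕ) : ℤ :=
  (if OnComponent w c ⟨t, i, true⟩ then 1 else 0) -
    (if OnComponent w c ⟨t, i, false⟩ then 1 else 0)

/-- The sum of the signs of those crossings in the slice number `t` at which the components marked by
`c` and `c'` meet. If both strands are directed downwards, a crossing is positive exactly if the
strand from the upper right to the lower left lies over; reversing one of them changes the sign. -/
noncomputable def crossingSign (w : Diagram) (c c' : Label) (t : ℕ) : ℤ :=
  match w[t]? with
  | some (cross b i) =>
      (if b then 1 else -1) *
        (direction w c t i * direction w c' t (i + 1) +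
          direction w c' t i * direction w c t (i + 1))
  | _ => 0

/-- The linking number of the components marked by `c` and `c'`: half the sum of the signs of the
crossings between them. -/
noncomputable def linkingNumber (w : Diagram) (c c' : Label) : ℚ :=
  ((∑ t ∈ Finset.range w.length, crossingSign w c c' t : ℤ) : ℚ) / 2

/-! ### The twisted diagrams -/

/-- The standard twisted diagram: the central component of `𝓛(f)` runs down the strand `1`; the
central component of `𝓛(g)` is a loop through the strands `2` and `3`; the strands `1` and `2` are
twisted around each other by `n` full twists, that is by `2 * n` crossings, all alike. The diagram of
`f` sits on the strand `1`, and the diagram of `g` on the strand `j`, which is `2` or `3`. -/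
def twistedDiagram (j n : ℕ) (f g : F3) : Diagram :=
  [cap 0] ++ openDiagram f (markRoot Label.Kf) 1 ++ [cap 2] ++
    openDiagram g (markRoot Label.Kg) j ++ List.replicate (2 * n) (cross true 1) ++ [cup 2, cup 0]

end ThompsonLink

open ThompsonLink

namespace ThompsonLink
open TernaryTree Slice

/-! ### Tangle diagrams -/

/-! The two halves of the statement, isotopy and linking number, are proved independently. In
particular the linking number is computed on the diagram of the linking move itself, so its
invariance under the moves is never needed.

Isotopy. Link isotopy is the case of zero endpoints of `TangleIsotopic`, which is a congruence for
stacking, translating and adding strands. Two general facts come from the generating moves: tangles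
side by side slide past each other (`TangleIsotopic.interchange`), and a strand slides over or under
any tangle (`TangleIsotopic.pass`). Hence the inserted diagrams of `f` and `g`, with their marks,
can be treated as beads on a strand, and a twist region as a single piece. Concrete isotopies are
then finite derivations in an alphabet with such pieces; `Word.derive` executes a derivation,
`Word.isotopic_of_derive` proves it sound, and the kernel evaluates it. The tangle made of the trees
specific to `H^n` is brought to a normal form by induction on `n`: the vertices added at each stage
contribute one full twist (`isotopic_posUp_posLow`, `isotopic_negUp_negLow`). One last derivation
for the entire link, `straighten_pos` or `straighten_neg`, gives the twisted diagram.

Linking number. A flow assigns a signed strength to every strand, constant along it. Components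
yield unit flows, and half the crossing form of the flows of two components is their linking number
(`linkingNumber_eq_flowForm`). On a tree the left and right branches at a vertex form one arc, so
their downward strengths are opposite, and the strength at the root is the sum over the leaves.
Flows on the link of an element are therefore given by leaf strengths that are `Balanced` for both
trees, and the crossing form is the difference of two bilinear forms `treeForm`. For a linking move,
a balanced assignment restricts to one on `f` and one on `g`, and everything else is forced by the
strengths `F`, `G` at their roots (`admissible_linkPos`, `admissible_linkNeg`). Conversely, any
choice on `f` and `g` extends. Extending the central component of `f` by zero on `g` gives a flow of
strength 1 on `𝓚(f)` and 0 on `𝓚(g)`: the components are distinct, and `𝓚(f)` misses the leaves of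
`g`; symmetrically for `𝓚(g)`. Consequently the forms of `f` and `g` contribute nothing, and of the
remaining quadratic expression only the coefficient `±2n` of `F * G' + F' * G` survives. -/

theorem isTangle_nil_iff {k m : ℕ} : IsTangle [] k m ↔ k = m :=
  ⟨fun h => by cases h; rfl, fun h => h ▸ .nil k⟩

/-- Inversion with truncated subtraction: widths become computable from the top, and the side
conditions become linear arithmetic. -/
theorem isTangle_cons_iff {s : Slice} {w : Diagram} {k m : ℕ} :
    IsTangle (s :: w) k m ↔
      s.pos + s.inputs ≤ k ∧ IsTangle w (k - s.inputs + s.outputs) m := by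
  constructor
  · rintro ⟨⟩
    rename_i r hs hw
    exact ⟨by omega, by simpa using hw⟩
  · rintro ⟨h, hw⟩
    have := IsTangle.cons s w (k - s.inputs) m (by omega) hw
    rwa [Nat.sub_add_cancel (by omega)] at this

theorem IsTangle.cast {w : Diagram} {k m k' m' : ℕ} (h : IsTangle w k m) (hk : k = k')
    (hm : m = m') : IsTangle w k' m' := hk ▸ hm ▸ h

theorem IsTangle.append {a b : Diagram} {k l m : ℕ} (ha : IsTangle a k l) (hb : IsTangle b l m) :
    IsTangle (a ++ b) k m := by
  induction ha with
  | nil => exact hb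
  | cons s w r m hs _ ih => exact .cons s _ r _ hs (ih hb)

theorem isTangle_append_iff {a b : Diagram} {k m : ℕ} :
    IsTangle (a ++ b) k m ↔ ∃ l, IsTangle a k l ∧ IsTangle b l m := by
  constructor
  · intro h
    induction a generalizing k with
    | nil => exact ⟨k, .nil k, h⟩
    | cons s a ih =>
        rw [List.cons_append, isTangle_cons_iff] at h
        obtain ⟨l, h₁, h₂⟩ := ih h.2
        exact ⟨l, isTangle_cons_iff.2 ⟨h.1, h₁⟩, h₂⟩
  · rintro ⟨l, h₁, h₂⟩
    exact h₁.append h₂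

theorem IsTangle.unique {w : Diagram} {k m m' : ℕ} (h : IsTangle w k m) (h' : IsTangle w k m') :
    m = m' := by
  induction w generalizing k with
  | nil => rw [isTangle_nil_iff] at h h'; omega
  | cons s w ih => rw [isTangle_cons_iff] at h h'; exact ih h.2 h'.2

theorem IsTangle.widen {w : Diagram} {k m : ℕ} (h : IsTangle w k m) (c : ℕ) :
    IsTangle w (k + c) (m + c) := by
  induction h with
  | nil k => exact .nil _
  | cons s w r m hs _ ih =>
      have := IsTangle.cons s w (r + c) (m + c) (by omega) (by convert ih using 1; omega)
      convert this using 1; omega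

/-- A slice moved to the right by `c` strands. -/
def Slice.shift (c : ℕ) (s : Slice) : Slice := s.at' (s.pos + c)

/-- A diagram moved to the right by `c` strands. -/
def shift (c : ℕ) (w : Diagram) : Diagram := w.map (Slice.shift c)

@[simp] theorem Slice.inputs_at' (s : Slice) (i : ℕ) : (s.at' i).inputs = s.inputs := by
  cases s <;> rfl
@[simp] theorem Slice.outputs_at' (s : Slice) (i : ℕ) : (s.at' i).outputs = s.outputs := by
  cases s <;> rfl
@[simp] theorem Slice.pos_at' (s : Slice) (i : ℕ) : (s.at' i).pos = i := by cases s <;> rfl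
@[simp] theorem Slice.at'_at' (s : Slice) (i j : ℕ) : (s.at' i).at' j = s.at' j := by
  cases s <;> rfl
@[simp] theorem Slice.at'_pos (s : Slice) : s.at' s.pos = s := by cases s <;> rfl
@[simp] theorem Slice.inputs_shift (s : Slice) (i : ℕ) : (s.shift i).inputs = s.inputs := by
  simp [Slice.shift]
@[simp] theorem Slice.outputs_shift (s : Slice) (i : ℕ) : (s.shift i).outputs = s.outputs := by
  simp [Slice.shift]
@[simp] theorem Slice.pos_shift (s : Slice) (i : ℕ) : (s.shift i).pos = s.pos + i := by
  simp [Slice.shift]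
@[simp] theorem Slice.shift_at' (s : Slice) (c i : ℕ) : (s.at' i).shift c = s.at' (i + c) := by
  simp [Slice.shift]
@[simp] theorem Slice.shift_cap (c i : ℕ) : (cap i).shift c = cap (i + c) := rfl
@[simp] theorem Slice.shift_cup (c i : ℕ) : (cup i).shift c = cup (i + c) := rfl
@[simp] theorem Slice.shift_cross (c : ℕ) (b : Bool) (i : ℕ) :
    (cross b i).shift c = cross b (i + c) := rfl
@[simp] theorem Slice.shift_mark (c : ℕ) (l : Label) (d : Bool) (i : ℕ) :
    (mark l d i).shift c = mark l d (i + c) := rfl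

@[simp] theorem shift_nil (c : ℕ) : shift c [] = [] := rfl
@[simp] theorem shift_cons (c : ℕ) (s : Slice) (w : Diagram) :
    shift c (s :: w) = s.shift c :: shift c w := rfl
@[simp] theorem shift_append (c : ℕ) (w w' : Diagram) :
    shift c (w ++ w') = shift c w ++ shift c w' := List.map_append

theorem shift_shift (c d : ℕ) (w : Diagram) : shift c (shift d w) = shift (d + c) w := by
  simp [shift, Slice.shift, Nat.add_assoc]

theorem shift_zero (w : Diagram) : shift 0 w = w := by
  have : Slice.shift 0 = id := by funext s; simp [Slice.shift]
  simp [shift, this]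

theorem IsTangle.shift {w : Diagram} {k m : ℕ} (h : IsTangle w k m) (c : ℕ) :
    IsTangle (shift c w) (k + c) (m + c) := by
  induction h with
  | nil k => exact .nil _
  | cons s w r m hs _ ih =>
      have := IsTangle.cons (s.shift c) (ThompsonLink.shift c w) (r + c) (m + c) (by simpa using hs)
        (by convert ih using 1; simp; omega)
      rw [Slice.inputs_shift] at this
      exact this.cast (by omega) rfl

/-! ### Isotopy of tangles -/

/-- Isotopy of tangle diagrams with `k` upper and `m` lower endpoints. -/
def TangleIsotopic (k m : ℕ) (w w' : Diagram) : Prop :=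
  IsTangle w k m ∧ IsTangle w' k m ∧ Relation.EqvGen (Step k m) w w'

namespace TangleIsotopic

theorem refl {k m : ℕ} {w : Diagram} (h : IsTangle w k m) : TangleIsotopic k m w w :=
  ⟨h, h, .refl _⟩

theorem cast {k m k' m' : ℕ} {w w' : Diagram} (h : TangleIsotopic k m w w') (hk : k = k')
    (hm : m = m') : TangleIsotopic k' m' w w' := hk ▸ hm ▸ h

theorem symm {k m : ℕ} {w w' : Diagram} (h : TangleIsotopic k m w w') : TangleIsotopic k m w' w :=
  ⟨h.2.1, h.1, h.2.2.symm⟩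

theorem trans {k m : ℕ} {w w' w'' : Diagram} (h : TangleIsotopic k m w w')
    (h' : TangleIsotopic k m w' w'') : TangleIsotopic k m w w'' :=
  ⟨h.1, h'.2.1, h.2.2.trans _ _ _ h'.2.2⟩

theorem of_move {k m : ℕ} {a b : Diagram} (h : Move a b) (ha : IsTangle a k m)
    (hb : IsTangle b k m) : TangleIsotopic k m a b :=
  ⟨ha, hb, .rel _ _ ⟨ha, hb, [], a, b, [], by simp, by simp, h⟩⟩

/-- A map of diagrams that is compatible with single moves is compatible with isotopies. -/
theorem map {k m k' m' : ℕ} {a b : Diagram} (h : TangleIsotopic k m a b) (φ : Diagram → Diagram)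
    (hφ : ∀ w w', Step k m w w' → Step k' m' (φ w) (φ w')) (ht : ∀ w, IsTangle w k m →
      IsTangle (φ w) k' m') : TangleIsotopic k' m' (φ a) (φ b) := by
  refine ⟨ht _ h.1, ht _ h.2.1, ?_⟩
  have h' := h.2.2
  clear ht h
  induction h' with
  | rel x y h => exact .rel _ _ (hφ _ _ h)
  | refl x => exact .refl _
  | symm x y _ ih => exact ih.symm
  | trans x y z _ _ ih₁ ih₂ => exact ih₁.trans _ _ _ ih₂

theorem append_left {k l m : ℕ} {a b p : Diagram} (hp : IsTangle p k l)
    (h : TangleIsotopic l m a b) : TangleIsotopic k m (p ++ a) (p ++ b) := by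
  refine h.map (p ++ ·) ?_ fun w hw => hp.append hw
  rintro w w' ⟨hw, hw', q, a, b, s, rfl, rfl, hm⟩
  exact ⟨hp.append hw, hp.append hw', p ++ q, a, b, s, by simp, by simp, hm⟩

theorem append_right {k l m : ℕ} {a b s : Diagram} (h : TangleIsotopic k l a b)
    (hs : IsTangle s l m) : TangleIsotopic k m (a ++ s) (b ++ s) := by
  refine h.map (· ++ s) ?_ fun w hw => hw.append hs
  rintro w w' ⟨hw, hw', q, a, b, s', rfl, rfl, hm⟩
  exact ⟨hw.append hs, hw'.append hs, q, a, b, s' ++ s, by simp, by simp, hm⟩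

theorem append {k l m : ℕ} {a b c d : Diagram} (h : TangleIsotopic k l a b)
    (h' : TangleIsotopic l m c d) : TangleIsotopic k m (a ++ c) (b ++ d) :=
  (h.append_right h'.1).trans (h'.append_left h.2.1)

theorem widen {k m : ℕ} {a b : Diagram} (h : TangleIsotopic k m a b) (c : ℕ) :
    TangleIsotopic (k + c) (m + c) a b := by
  refine h.map id ?_ fun w hw => hw.widen c
  rintro w w' ⟨hw, hw', h⟩
  exact ⟨hw.widen c, hw'.widen c, h⟩

end TangleIsotopic

/-! ### Translation invariance of isotopy -/

theorem Move.shift {a b : Diagram} (h : Move a b) (c : ℕ) :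
    Move (shift c a) (shift c b) := by
  cases h with
  | exchange a b i d =>
      have := Move.exchange a b (i + c) d
      simp only [shift_cons, Slice.shift_at', shift_nil]
      rwa [show i + a.inputs + d + c = i + c + a.inputs + d by omega,
        show i + a.outputs + d + c = i + c + a.outputs + d by omega]
  | zigzag_left i =>
      have := Move.zigzag_left (i + c)
      simpa [Nat.add_right_comm] using this
  | zigzag_right i =>
      have := Move.zigzag_right (i + c)
      simpa [Nat.add_right_comm] using this
  | cap_slide b i =>
      have := Move.cap_slide b (i + c)
      simpa [Nat.add_right_comm] using this
  | cup_slide b i =>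
      have := Move.cup_slide b (i + c)
      simpa [Nat.add_right_comm] using this
  | reidemeister_one_cap b i => exact Move.reidemeister_one_cap b (i + c)
  | reidemeister_one_cup b i => exact Move.reidemeister_one_cup b (i + c)
  | reidemeister_two b i => exact Move.reidemeister_two b (i + c)
  | reidemeister_three b i =>
      have := Move.reidemeister_three b (i + c)
      simpa [Nat.add_right_comm] using this
  | mark_cross_left l d b i =>
      have := Move.mark_cross_left l d b (i + c)
      simpa [Nat.add_right_comm] using this
  | mark_cross_right l d b i =>
      have := Move.mark_cross_right l d b (i + c)
      simpa [Nat.add_right_comm] using this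
  | mark_cap l d i =>
      have := Move.mark_cap l d (i + c)
      simpa [Nat.add_right_comm] using this
  | mark_cup l d i =>
      have := Move.mark_cup l d (i + c)
      simpa [Nat.add_right_comm] using this

theorem TangleIsotopic.shift {k m : ℕ} {a b : Diagram} (h : TangleIsotopic k m a b) (c : ℕ) :
    TangleIsotopic (k + c) (m + c) (shift c a) (shift c b) := by
  refine h.map (ThompsonLink.shift c) ?_ fun w hw => hw.shift c
  rintro w w' ⟨hw, hw', p, a, b, s, rfl, rfl, hm⟩
  exact ⟨hw.shift c, hw'.shift c, ThompsonLink.shift c p, _, _, ThompsonLink.shift c s, by simp,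
    by simp, hm.shift c⟩

/-! ### Tangles side by side -/

theorem TangleIsotopic.exchange_slice {s s' : Slice} {k m : ℕ} (h : s.pos + s.inputs ≤ k)
    (h' : s'.pos + s'.inputs ≤ m) :
    TangleIsotopic (k + m) (k - s.inputs + s.outputs + (m - s'.inputs + s'.outputs))
      [s, s'.shift (k - s.inputs + s.outputs)] [s'.shift k, s] := by
  -- The gap between the two slices consists of the strands of the left block to the right of `s`
  -- and the strands of the right block to the left of `s'`.
  have hm := Move.exchange s s' s.pos (k - s.inputs - s.pos + s'.pos)
  rw [Slice.at'_pos, show s.pos + s.inputs + (k - s.inputs - s.pos + s'.pos) = s'.pos + k by omega,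
    show s.pos + s.outputs + (k - s.inputs - s.pos + s'.pos) =
      s'.pos + (k - s.inputs + s.outputs) by omega] at hm
  refine (of_move hm ?_ ?_).symm
  · simp only [isTangle_cons_iff, isTangle_nil_iff, Slice.inputs_at', Slice.outputs_at',
      Slice.pos_at']
    omega
  · simp only [isTangle_cons_iff, isTangle_nil_iff, Slice.inputs_at', Slice.outputs_at',
      Slice.pos_at']
    omega

theorem TangleIsotopic.exchange_slice_left {s : Slice} {k m m' : ℕ} {w : Diagram}
    (h : s.pos + s.inputs ≤ k) (hw : IsTangle w m m') :
    TangleIsotopic (k + m) (k - s.inputs + s.outputs + m')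
      ([s] ++ ThompsonLink.shift (k - s.inputs + s.outputs) w)
      (ThompsonLink.shift k w ++ [s]) := by
  have key : ∀ n, IsTangle [s] (k + n) (k - s.inputs + s.outputs + n) := fun n => by
    simp only [isTangle_cons_iff, isTangle_nil_iff]; omega
  induction w generalizing m with
  | nil =>
      rw [isTangle_nil_iff] at hw
      subst hw
      exact refl (key m)
  | cons s' w ih =>
      rw [isTangle_cons_iff] at hw
      have h₁ := exchange_slice h hw.1
      have h₂ := ih hw.2
      have h₃ : IsTangle [s'.shift k] (k + m) (k + (m - s'.inputs + s'.outputs)) := by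
        simp only [isTangle_cons_iff, isTangle_nil_iff, Slice.inputs_shift, Slice.outputs_shift,
          Slice.pos_shift]
        omega
      have h₄ : IsTangle (ThompsonLink.shift (k - s.inputs + s.outputs) w)
          (k - s.inputs + s.outputs + (m - s'.inputs + s'.outputs))
          (k - s.inputs + s.outputs + m') := by
        have := hw.2.shift (k - s.inputs + s.outputs)
        convert this using 1 <;> omega
      exact (h₁.append_right h₄).trans (h₂.append_left h₃)

/-- Two tangles that lie side by side can be moved past each other. -/
theorem TangleIsotopic.interchange {k k' m m' : ℕ} {a b : Diagram} (ha : IsTangle a k k')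
    (hb : IsTangle b m m') :
    TangleIsotopic (k + m) (k' + m') (a ++ ThompsonLink.shift k' b)
      (ThompsonLink.shift k b ++ a) := by
  induction a generalizing k with
  | nil =>
      rw [isTangle_nil_iff] at ha
      subst ha
      rw [List.append_nil, List.nil_append]
      refine refl ?_
      have := hb.shift k
      convert this using 1 <;> omega
  | cons s a ih =>
      rw [isTangle_cons_iff] at ha
      have h₁ := ih ha.2
      have h₂ := exchange_slice_left ha.1 hb
      have h₃ : IsTangle [s] (k + m) (k - s.inputs + s.outputs + m) := by
        simp only [isTangle_cons_iff, isTangle_nil_iff]; omega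
      have := (h₁.append_left h₃).trans
        (by simpa using h₂.append_right (ha.2.widen m'))
      simpa using this

/-! ### A strand passing over or under a tangle -/

/-- The strand number `m` moves to the far left, crossing the strands `m - 1, ..., 0`. -/
def passLeft (b : Bool) : ℕ → Diagram
  | 0 => []
  | m + 1 => cross b m :: passLeft b m

theorem isTangle_passLeft (b : Bool) (m : ℕ) : IsTangle (passLeft b m) (m + 1) (m + 1) := by
  induction m with
  | zero => exact .nil _
  | succ m ih => exact .cons (cross b m) _ m _ le_rfl (ih.widen 1)

theorem passLeft_add (b : Bool) (c q : ℕ) :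
    passLeft b (c + q) = shift c (passLeft b q) ++ passLeft b c := by
  induction q with
  | zero => rfl
  | succ q ih => simp [passLeft, ih, Nat.add_comm]

/-- The number of lower endpoints of a diagram with `k` upper endpoints, if it is a tangle. -/
def width : Diagram → ℕ → Option ℕ
  | [], k => some k
  | s :: w, k => if s.pos + s.inputs ≤ k then width w (k - s.inputs + s.outputs) else none

/-- Reduces well-formedness of a concrete diagram to evaluation, so that `rfl` proves it. -/
theorem isTangle_iff_width {w : Diagram} {k m : ℕ} : IsTangle w k m ↔ width w k = some m := by
  induction w generalizing k with
  | nil => simp [width, isTangle_nil_iff]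
  | cons s w ih => rw [isTangle_cons_iff, ih, width]; split_ifs <;> simp [*]

theorem IsTangle.of_width {w : Diagram} {k m : ℕ} (h : width w k = some m) : IsTangle w k m :=
  isTangle_iff_width.2 h

open TangleIsotopic in
/-- A strand passes a cap. -/
theorem TangleIsotopic.pass_cap (b : Bool) :
    TangleIsotopic 1 3 [cap 0, cross b 1, cross b 0] [cap 1] := by
  have h₁ := (of_move (.cap_slide b 0) (.of_width (k := 1) rfl) (.of_width rfl)).append_right
    (s := [cross b 0]) (.of_width rfl)
  have h₂ := (of_move (.reidemeister_two (!b) 0) (.of_width (k := 3) rfl)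
    (.of_width rfl)).append_left (p := [cap 1]) (k := 1) (.of_width rfl)
  rw [Bool.not_not] at h₂
  exact h₁.trans h₂

open TangleIsotopic in
/-- A strand passes a cup. -/
theorem TangleIsotopic.pass_cup (b : Bool) :
    TangleIsotopic 3 1 [cup 0] [cross b 1, cross b 0, cup 1] := by
  have h₁ := (of_move (.cup_slide (!b) 0) (.of_width (k := 3) rfl) (.of_width rfl)).append_left
    (p := [cross b 1]) (k := 3) (.of_width rfl)
  have h₂ := (of_move (.reidemeister_two b 1) (.of_width (k := 3) rfl)
    (.of_width rfl)).append_right (s := [cup 0]) (m := 1) (.of_width rfl)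
  rw [Bool.not_not] at h₁
  exact h₂.symm.trans h₁

open TangleIsotopic in
/-- A strand passes over or under an arbitrary crossing. -/
theorem TangleIsotopic.pass_cross (b c : Bool) :
    TangleIsotopic 3 3 [cross c 0, cross b 1, cross b 0] [cross b 1, cross b 0, cross c 1] := by
  have main : ∀ b, TangleIsotopic 3 3 [cross b 0, cross b 1, cross b 0]
      [cross b 1, cross b 0, cross b 1] := fun b =>
    of_move (.reidemeister_three b 0) (.of_width rfl) (.of_width rfl)
  by_cases h : c = b
  · subst h; exact main c
  obtain rfl : c = !b := by cases b <;> cases c <;> simp_all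
  have r₀ : ∀ b, TangleIsotopic 3 3 [cross b 0, cross (!b) 0] [] := fun b =>
    of_move (.reidemeister_two b 0) (.of_width rfl) (.of_width rfl)
  have r₁ : TangleIsotopic 3 3 [cross b 1, cross (!b) 1] [] :=
    of_move (.reidemeister_two b 1) (.of_width rfl) (.of_width rfl)
  have r₀' := r₀ (!b)
  rw [Bool.not_not] at r₀'
  -- The third Reidemeister move is given only for three equal crossing types. A cancelling pair
  -- added at the bottom creates such a triple; after the move, the crossing of the other type
  -- cancels at the top.
  have e₁ := r₁.symm.append_left (p := [cross (!b) 0, cross b 1, cross b 0]) (k := 3)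
    (.of_width rfl)
  have e₂ := ((main b).symm.append_left (p := [cross (!b) 0]) (k := 3) (.of_width rfl)).append_right
    (s := [cross (!b) 1]) (m := 3) (.of_width rfl)
  have e₃ := r₀'.append_right (s := [cross b 1, cross b 0, cross (!b) 1]) (m := 3) (.of_width rfl)
  exact e₁.trans (e₂.trans e₃)

/-- The generating case of `TangleIsotopic.pass`: a strand meets a single elementary piece. Marks
are no obstacle, because they slide along their strand through the crossing. -/
theorem TangleIsotopic.pass_slice (b : Bool) (s : Slice) :
    TangleIsotopic (s.inputs + 1) (s.outputs + 1) ([s.at' 0] ++ passLeft b s.outputs)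
      (passLeft b s.inputs ++ [s.at' 1]) := by
  cases s with
  | cap i => exact pass_cap b
  | cup i => exact pass_cup b
  | cross c i => exact pass_cross b c
  | mark l d i => exact of_move (.mark_cross_left l d b 0) (.of_width rfl) (.of_width rfl)

/-- A strand to the right of a tangle can be moved over or under the tangle to the left. -/
theorem TangleIsotopic.pass (b : Bool) {w : Diagram} {k m : ℕ} (h : IsTangle w k m) :
    TangleIsotopic (k + 1) (m + 1) (w ++ passLeft b m) (passLeft b k ++ ThompsonLink.shift 1 w) := by
  induction h with
  | nil k => simpa using refl (isTangle_passLeft b k)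
  | cons s w r m hs hw ih =>
      -- Here `q` counts the strands to the right of the slice. The moving strand passes these
      -- first, then the strands of the slice, then the `s.pos` strands on its left. Only the middle
      -- group needs a genuine move, the other two are interchanges.
      obtain ⟨q, rfl⟩ := Nat.exists_eq_add_of_le hs
      have hs₁ : IsTangle [s] (s.pos + s.inputs) (s.pos + s.outputs) :=
        .cons s [] s.pos _ le_rfl (.nil _)
      have h₁ := ih.append_left (p := [s]) (k := s.pos + q + s.inputs + 1)
        (by simp only [isTangle_cons_iff, isTangle_nil_iff]; omega)
      have h₂ := interchange hs₁ (isTangle_passLeft b q)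
      have h₃ := ((pass_slice b s).shift s.pos).append_right
        (s := passLeft b s.pos) (m := s.pos + s.outputs + 1)
        (by convert (isTangle_passLeft b s.pos).widen s.outputs using 1 <;> omega)
      have h₄ := (interchange (isTangle_passLeft b s.pos)
        (show IsTangle [s.at' 0] s.inputs s.outputs by
          simp only [isTangle_cons_iff, isTangle_nil_iff]; simp)).symm
      have e₁ : passLeft b (s.pos + q + s.outputs) = ThompsonLink.shift (s.pos + s.outputs)
          (passLeft b q) ++ (ThompsonLink.shift s.pos (passLeft b s.outputs) ++
            passLeft b s.pos) := by
        rw [← passLeft_add, ← passLeft_add]; congr 1; omega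
      have e₂ : passLeft b (s.pos + q + s.inputs) = ThompsonLink.shift (s.pos + s.inputs)
          (passLeft b q) ++ (ThompsonLink.shift s.pos (passLeft b s.inputs) ++
            passLeft b s.pos) := by
        rw [← passLeft_add, ← passLeft_add]; congr 1; omega
      simp only [shift_append, shift_cons, shift_nil, Slice.shift_at', Nat.zero_add, at'_pos]
        at h₃ h₄
      rw [show s.at' (1 + s.pos) = s.shift 1 by rw [Slice.shift, Nat.add_comm]] at h₃
      rw [show s.at' (s.pos + 1) = s.shift 1 from rfl] at h₄
      have hq : IsTangle (ThompsonLink.shift (s.pos + s.inputs) (passLeft b q))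
          (s.pos + q + s.inputs + 1) (s.pos + q + s.inputs + 1) :=
        ((isTangle_passLeft b q).shift (s.pos + s.inputs)).cast (by omega) (by omega)
      have hp : IsTangle (ThompsonLink.shift s.pos (passLeft b s.inputs)) (s.inputs + 1 + s.pos)
          (s.pos + 1 + s.inputs) :=
        ((isTangle_passLeft b s.inputs).shift s.pos).cast (by omega) (by omega)
      have ht : IsTangle (ThompsonLink.shift s.pos (passLeft b s.outputs) ++ passLeft b s.pos)
          (s.pos + s.outputs + (q + 1)) (s.pos + q + s.outputs + 1) := by
        rw [← passLeft_add]
        exact ((isTangle_passLeft b _).widen q).cast (by omega) (by omega)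
      have h₅ := ((h₃.cast (m' := s.pos + 1 + s.outputs) rfl (by omega)).trans (by
        simpa using h₄.append_left hp)).widen q
      have h₆ := (h₅.cast (m' := s.pos + q + s.outputs + 1) (by omega) (by omega)).append_left hq
      have h₇ := (h₂.append_right ht).cast (k' := s.pos + q + s.inputs + 1) (by omega) rfl
      have h₈ := (h₇.trans (by simpa using h₆)).append_right ((hw.shift 1).cast (by omega) rfl)
      rw [e₁] at h₁
      rw [e₂]
      refine h₁.trans ?_
      simpa using h₈

/-! ### Derived moves -/

theorem IsTangle.place {w : Diagram} {a b : ℕ} (h : IsTangle w a b) {i k : ℕ} (hk : i + a ≤ k) :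
    IsTangle (ThompsonLink.shift i w) k (k - a + b) :=
  ((h.shift i).widen (k - a - i)).cast (by omega) (by omega)

theorem TangleIsotopic.place {w w' : Diagram} {a b : ℕ} (h : TangleIsotopic a b w w') {i k : ℕ}
    (hk : i + a ≤ k) :
    TangleIsotopic k (k - a + b) (ThompsonLink.shift i w) (ThompsonLink.shift i w') :=
  ((h.shift i).widen (k - a - i)).cast (by omega) (by omega)

namespace TangleIsotopic

theorem cancel (b : Bool) {i k : ℕ} (h : i + 2 ≤ k) :
    TangleIsotopic k k [cross b i, cross (!b) i] [] :=
  of_move (.reidemeister_two b i)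
    (by simp only [isTangle_cons_iff, isTangle_nil_iff, Slice.pos, Slice.inputs, Slice.outputs]
        omega)
    (.nil k)

theorem cancel' (b : Bool) {i k : ℕ} (h : i + 2 ≤ k) :
    TangleIsotopic k k [cross (!b) i, cross b i] [] := by
  simpa using cancel (!b) h

theorem pass_cap_left (b : Bool) :
    TangleIsotopic 1 3 [cap 1, cross b 0, cross b 1] [cap 0] := by
  have h₁ := (of_move (.cap_slide (!b) 0) (.of_width (k := 1) rfl)
    (.of_width rfl)).symm.append_right (s := [cross b 1]) (.of_width rfl)
  have h₂ := (cancel' b (i := 1) (k := 3) le_rfl).append_left (p := [cap 0]) (k := 1)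
    (.of_width rfl)
  rw [Bool.not_not] at h₁
  exact h₁.trans h₂

theorem pass_cup_left (b : Bool) :
    TangleIsotopic 3 1 [cross b 0, cross b 1, cup 0] [cup 1] := by
  have h₁ := (of_move (.cup_slide b 0) (.of_width (k := 3) rfl) (.of_width rfl)).append_left
    (p := [cross b 0]) (k := 3) (.of_width rfl)
  have h₂ := (cancel b (i := 0) (k := 3) (by omega)).append_right (s := [cup 1]) (m := 1)
    (.of_width rfl)
  exact h₁.trans h₂

/-- A tangle with one upper and one lower endpoint slides through a crossing to the right. -/
theorem slide_right (b : Bool) {w : Diagram} (h : IsTangle w 1 1) :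
    TangleIsotopic 2 2 (w ++ [cross b 0]) ([cross b 0] ++ ThompsonLink.shift 1 w) :=
  pass b h

/-- A tangle with one upper and one lower endpoint slides through a crossing to the left. -/
theorem slide_left (b : Bool) {w : Diagram} (h : IsTangle w 1 1) :
    TangleIsotopic 2 2 (ThompsonLink.shift 1 w ++ [cross b 0]) ([cross b 0] ++ w) := by
  have hc : ∀ b, IsTangle [cross b 0] 2 2 := fun b => .of_width rfl
  -- Conjugation: a cancelling pair is created above, the tangle is pulled through its lower
  -- crossing by `slide_right (!b)` read backwards, and that crossing then cancels with the original
  -- one.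
  have h₁ := (cancel b (i := 0) (k := 2) le_rfl).symm.append_right
    ((h.shift 1).append (hc b))
  have h₂ := ((slide_right (!b) h).symm.append_left (hc b)).append_right (hc b)
  have h₃ := (cancel' b (i := 0) (k := 2) le_rfl).append_left ((hc b).append (h.widen 1))
  simp only [List.append_assoc, List.cons_append, List.nil_append, List.append_nil] at *
  exact h₁.trans (h₂.trans h₃)

/-- A strand passes a two-strand tangle to the right. -/
theorem pass_right (b : Bool) {w : Diagram} (h : IsTangle w 2 2) :
    TangleIsotopic 3 3 ([cross b 0, cross b 1] ++ w)
      (ThompsonLink.shift 1 w ++ [cross b 0, cross b 1]) := by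
  have hc : IsTangle [cross b 0, cross b 1] 3 3 := .of_width rfl
  have hc' : IsTangle [cross (!b) 1, cross (!b) 0] 3 3 := .of_width rfl
  have e₁ : TangleIsotopic 3 3 ([cross b 0, cross b 1] ++ [cross (!b) 1, cross (!b) 0]) [] :=
    (((cancel b (i := 1) (k := 3) le_rfl).append_left (p := [cross b 0]) (k := 3)
      (.of_width rfl)).append_right (s := [cross (!b) 0]) (m := 3) (.of_width rfl)).trans
      (cancel b (by omega))
  have e₂ : TangleIsotopic 3 3 ([cross (!b) 1, cross (!b) 0] ++ [cross b 0, cross b 1]) [] :=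
    (((cancel' b (i := 0) (k := 3) (by omega)).append_left (p := [cross (!b) 1]) (k := 3)
      (.of_width rfl)).append_right (s := [cross b 1]) (m := 3) (.of_width rfl)).trans
      (cancel' b le_rfl)
  -- Again conjugation: the two crossings form an invertible braid, and `pass` for its inverse is
  -- sandwiched between the braid and itself.
  have h₁ := e₂.symm.append_left (hc.append (h.widen 1))
  have h₂ := ((pass (!b) h).append_left hc).append_right hc
  have h₃ := e₁.append_right ((h.shift 1).append hc)
  simp only [List.append_assoc, List.append_nil, List.nil_append, passLeft] at *
  exact h₁.trans (h₂.trans h₃)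

/-- Crossings of the same two strands commute. -/
theorem cross_comm (b c : Bool) {i k : ℕ} (h : i + 2 ≤ k) :
    TangleIsotopic k k [cross b i, cross c i] [cross c i, cross b i] := by
  by_cases hbc : b = c
  · subst hbc
    exact refl (.of_width (by simp [width, Slice.pos, Slice.inputs, Slice.outputs]; omega))
  · obtain rfl : c = !b := by cases b <;> cases c <;> simp_all
    exact (cancel b h).trans (cancel' b h).symm

/-- Two nested arcs are parallel, so a crossing of their right legs slides over the top to their
left legs. Each of the two cap slides switches the crossing type, so the type is unchanged in the
end. -/
theorem nested_caps (b : Bool) :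
    TangleIsotopic 0 4 [cap 0, cap 1, cross b 2] [cap 0, cap 1, cross b 0] := by
  have h₁ := (of_move (.cap_slide b 1) (.of_width (k := 2) rfl) (.of_width rfl)).append_left
    (p := [cap 0]) (k := 0) (.of_width rfl)
  have h₂ := (of_move (.exchange (cap 0) (cap 0) 0 0) (.of_width (k := 0) rfl)
    (.of_width rfl)).symm.append_right (s := [cross (!b) 1]) (m := 4) (.of_width rfl)
  have h₃ := (of_move (.cap_slide (!b) 0) (.of_width (k := 2) rfl) (.of_width rfl)).append_left
    (p := [cap 0]) (k := 0) (.of_width rfl)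
  rw [Bool.not_not] at h₃
  exact h₁.trans (h₂.trans h₃)

theorem nested_cups (b : Bool) :
    TangleIsotopic 4 0 [cross b 0, cup 1, cup 0] [cross b 2, cup 1, cup 0] := by
  have h₁ := (of_move (.cup_slide (!b) 0) (.of_width (k := 4) rfl)
    (.of_width rfl)).symm.append_right (s := [cup 0]) (m := 0) (.of_width rfl)
  have h₂ := (of_move (.exchange (cup 0) (cup 0) 0 0) (.of_width (k := 4) rfl)
    (.of_width rfl)).symm.append_left (p := [cross (!b) 1]) (k := 4) (.of_width rfl)
  have h₃ := (of_move (.cup_slide b 1) (.of_width (k := 4) rfl)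
    (.of_width rfl)).symm.append_right (s := [cup 0]) (m := 0) (.of_width rfl)
  rw [Bool.not_not] at h₁
  exact h₁.trans (h₂.trans h₃)

end TangleIsotopic

/-! ### Twists -/

/-- The two-strand braid with `m` equal crossings. -/
def twist (m : ℕ) : Diagram := List.replicate m (cross true 0)

theorem twist_succ (m : ℕ) : twist (m + 1) = [cross true 0] ++ twist m := rfl

theorem twist_succ' (m : ℕ) : twist (m + 1) = twist m ++ [cross true 0] :=
  List.replicate_succ'

theorem shift_twist (i m : ℕ) : shift i (twist m) = List.replicate m (cross true i) := by
  simp [twist, shift]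

theorem isTangle_twist (m : ℕ) : IsTangle (twist m) 2 2 := by
  induction m with
  | zero => exact .nil 2
  | succ m ih => exact .cons (cross true 0) _ 0 2 le_rfl ih

namespace TangleIsotopic

theorem cross_twist_comm (b : Bool) (m : ℕ) :
    TangleIsotopic 2 2 ([cross b 0] ++ twist m) (twist m ++ [cross b 0]) := by
  have hc : ∀ b, IsTangle [cross b 0] 2 2 := fun b => .of_width rfl
  induction m with
  | zero => exact refl (hc b)
  | succ m ih =>
      have h₁ := (cross_comm b true (i := 0) (k := 2) le_rfl).append_right (isTangle_twist m)
      have h₂ := ih.append_left (hc true)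
      exact h₁.trans h₂

theorem nested_caps_twist (m : ℕ) :
    TangleIsotopic 0 4 ([cap 0, cap 1] ++ ThompsonLink.shift 2 (twist m))
      ([cap 0, cap 1] ++ twist m) := by
  induction m with
  | zero => exact refl (.of_width rfl)
  | succ m ih =>
      have h₁ := (nested_caps true).append_right (((isTangle_twist m).shift 2))
      have h₂ := (interchange (isTangle_twist 1) (isTangle_twist m)).append_left
        (p := [cap 0, cap 1]) (k := 0) (.of_width rfl)
      have h₃ := ih.append_right ((isTangle_twist 1).widen 2)
      rw [List.append_assoc, List.append_assoc, show twist m ++ twist 1 = twist (m + 1) from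
        (twist_succ' m).symm] at h₃
      exact h₁.trans (h₂.trans h₃)

theorem nested_cups_twist (m : ℕ) :
    TangleIsotopic 4 0 (twist m ++ [cup 1, cup 0])
      (ThompsonLink.shift 2 (twist m) ++ [cup 1, cup 0]) := by
  induction m with
  | zero => exact refl (.of_width rfl)
  | succ m ih =>
      have h₁ := (nested_cups true).append_left ((isTangle_twist m).widen 2)
      have h₂ := (interchange (isTangle_twist m) (isTangle_twist 1)).append_right
        (s := [cup 1, cup 0]) (m := 0) (.of_width rfl)
      have h₃ := ih.append_left ((isTangle_twist 1).shift 2)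
      conv_lhs => rw [twist_succ', List.append_assoc]
      rw [List.append_assoc, List.append_assoc] at h₂
      exact h₁.trans (h₂.trans h₃)

/-- A tangle with one upper and one lower endpoint slides through a full number of twists. -/
theorem slide_twist {w : Diagram} (h : IsTangle w 1 1) (m : ℕ) :
    TangleIsotopic 2 2 (w ++ twist (2 * m)) (twist (2 * m) ++ w) := by
  induction m with
  | zero => simpa [twist] using refl (h.widen 1)
  | succ m ih =>
      have hc : IsTangle [cross true 0] 2 2 := .of_width rfl
      -- One crossing takes the tangle to the right strand and the next brings it back, so it
      -- returns to its strand only after an even number of crossings.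
      have h₁ := (slide_right true h).append_right (hc.append (isTangle_twist (2 * m)))
      have h₂ := ((slide_left true h).append_left hc).append_right (isTangle_twist (2 * m))
      have h₃ := ih.append_left (hc.append hc)
      rw [show 2 * (m + 1) = 2 * m + 1 + 1 by ring, twist_succ, twist_succ]
      simp only [List.append_assoc] at h₁ h₂ h₃ ⊢
      exact h₁.trans (h₂.trans h₃)

end TangleIsotopic

/-! ### Words in a larger alphabet

Twist regions and inserted tangles are treated as single letters. A derivation is a list of moves on
such words, and its correctness is decidable. -/

/-- The letters, without their positions: the elementary pieces other than marks, a twist region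
(`coil`), and two inserted tangles with one upper and one lower endpoint each (`box`). -/
inductive Atom : Type
  | cap : Atom
  | cup : Atom
  | cross (b : Bool) : Atom
  | coil : Atom
  | box (g : Bool) : Atom
  deriving DecidableEq

namespace Atom

def inputs : Atom → ℕ
  | cap => 0
  | cup => 2
  | cross _ => 2
  | coil => 2
  | box _ => 1

def outputs : Atom → ℕ
  | cap => 2
  | cup => 0
  | cross _ => 2
  | coil => 2
  | box _ => 1

/-- The diagram of a letter; a twist region has `n` full twists, and `B` gives the inserted
tangles. -/
def diagram (n : ℕ) (B : Bool → Diagram) : Atom → Diagram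
  | cap => [Slice.cap 0]
  | cup => [Slice.cup 0]
  | cross b => [Slice.cross b 0]
  | coil => twist (2 * n)
  | box g => B g

theorem isTangle_diagram {n : ℕ} {B : Bool → Diagram} (hB : ∀ g, IsTangle (B g) 1 1) (a : Atom) :
    IsTangle (a.diagram n B) a.inputs a.outputs := by
  cases a with
  | cap => exact .of_width rfl
  | cup => exact .of_width rfl
  | cross b => exact .of_width rfl
  | coil => exact isTangle_twist _
  | box g => exact hB g

end Atom

/-- A word of letters with their positions. -/
abbrev Word : Type := List (Atom × ℕ)

namespace Word

/-- The diagram of a word. -/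
def diagram (n : ℕ) (B : Bool → Diagram) (w : Word) : Diagram :=
  w.flatMap fun x => shift x.2 (x.1.diagram n B)

/-- The number of lower endpoints of a word with `k` upper endpoints. -/
def width : Word → ℕ → Option ℕ
  | [], k => some k
  | (a, i) :: w, k => if i + a.inputs ≤ k then width w (k - a.inputs + a.outputs) else none

variable {n : ℕ} {B : Bool → Diagram}

theorem diagram_append (w w' : Word) :
    (w ++ w').diagram n B = w.diagram n B ++ w'.diagram n B := List.flatMap_append

theorem isTangle_diagram (hB : ∀ g, IsTangle (B g) 1 1) {w : Word} {k m : ℕ}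
    (h : w.width k = some m) : IsTangle (w.diagram n B) k m := by
  induction w generalizing k with
  | nil => simp only [width, Option.some.injEq] at h; subst h; exact .nil k
  | cons x w ih =>
      obtain ⟨a, i⟩ := x
      rw [width] at h
      split_ifs at h with hi
      exact ((a.isTangle_diagram hB).place hi).append (ih h)

/-- Moves on words. -/
inductive Rule : Type
  | zigzagLeft (i : ℕ)
  | zigzagRight (i : ℕ)
  | capSlide (b : Bool) (i : ℕ)
  | cupSlide (b : Bool) (i : ℕ)
  | kinkCap (b : Bool) (i : ℕ)
  | kinkCup (b : Bool) (i : ℕ)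
  | cancel (b : Bool) (i : ℕ)
  | passCapLeft (b : Bool) (i : ℕ)
  | passCapRight (b : Bool) (i : ℕ)
  | passCupRight (b : Bool) (i : ℕ)
  | passLeft (b c : Bool) (i : ℕ)
  | passRight (b c : Bool) (i : ℕ)
  | coilPassLeft (b : Bool) (i : ℕ)
  | coilPassRight (b : Bool) (i : ℕ)
  | coilCross (b : Bool) (i : ℕ)
  | nestedCaps (b : Bool) (i : ℕ)
  | nestedCups (b : Bool) (i : ℕ)
  | coilNestedCaps (i : ℕ)
  | coilNestedCups (i : ℕ)
  | boxRight (g b : Bool) (i : ℕ)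
  | boxLeft (g b : Bool) (i : ℕ)
  | boxCoil (g : Bool) (i : ℕ)

namespace Rule

open Atom in
/-- The two sides of a move, at the position `0`, and the position of the move. -/
def sides : Rule → Word × Word × ℕ
  | zigzagLeft i => ([(cap, 1), (cup, 0)], [], i)
  | zigzagRight i => ([(cap, 0), (cup, 1)], [], i)
  | capSlide b i => ([(cap, 0), (cross b, 1)], [(cap, 1), (cross (!b), 0)], i)
  | cupSlide b i => ([(cross b, 1), (cup, 0)], [(cross (!b), 0), (cup, 1)], i)
  | kinkCap b i => ([(cap, 0), (cross b, 0)], [(cap, 0)], i)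
  | kinkCup b i => ([(cross b, 0), (cup, 0)], [(cup, 0)], i)
  | cancel b i => ([(cross b, 0), (cross (!b), 0)], [], i)
  | passCapLeft b i => ([(cap, 0), (cross b, 1), (cross b, 0)], [(cap, 1)], i)
  | passCapRight b i => ([(cap, 1), (cross b, 0), (cross b, 1)], [(cap, 0)], i)
  | passCupRight b i => ([(cross b, 0), (cross b, 1), (cup, 0)], [(cup, 1)], i)
  | passLeft b c i => ([(cross b, 1), (cross b, 0), (cross c, 1)],
      [(cross c, 0), (cross b, 1), (cross b, 0)], i)
  | passRight b c i => ([(cross b, 0), (cross b, 1), (cross c, 0)],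
      [(cross c, 1), (cross b, 0), (cross b, 1)], i)
  | coilPassLeft b i => ([(cross b, 1), (cross b, 0), (coil, 1)],
      [(coil, 0), (cross b, 1), (cross b, 0)], i)
  | coilPassRight b i => ([(cross b, 0), (cross b, 1), (coil, 0)],
      [(coil, 1), (cross b, 0), (cross b, 1)], i)
  | coilCross b i => ([(cross b, 0), (coil, 0)], [(coil, 0), (cross b, 0)], i)
  | nestedCaps b i => ([(cap, 0), (cap, 1), (cross b, 2)], [(cap, 0), (cap, 1), (cross b, 0)], i)
  | nestedCups b i => ([(cross b, 0), (cup, 1), (cup, 0)], [(cross b, 2), (cup, 1), (cup, 0)], i)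
  | coilNestedCaps i => ([(cap, 0), (cap, 1), (coil, 2)], [(cap, 0), (cap, 1), (coil, 0)], i)
  | coilNestedCups i => ([(coil, 0), (cup, 1), (cup, 0)], [(coil, 2), (cup, 1), (cup, 0)], i)
  | boxRight g b i => ([(box g, 0), (cross b, 0)], [(cross b, 0), (box g, 1)], i)
  | boxLeft g b i => ([(box g, 1), (cross b, 0)], [(cross b, 0), (box g, 0)], i)
  | boxCoil g i => ([(box g, 0), (coil, 0)], [(coil, 0), (box g, 0)], i)

/-- The numbers of endpoints of the two sides at the position `0`. -/
def arity : Rule → ℕ × ℕ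
  | zigzagLeft _ | zigzagRight _ => (1, 1)
  | capSlide _ _ | passCapLeft _ _ | passCapRight _ _ => (1, 3)
  | cupSlide _ _ | passCupRight _ _ => (3, 1)
  | kinkCap _ _ => (0, 2)
  | kinkCup _ _ => (2, 0)
  | cancel _ _ | coilCross _ _ | boxRight _ _ _ | boxLeft _ _ _ | boxCoil _ _ => (2, 2)
  | passLeft _ _ _ | passRight _ _ _ | coilPassLeft _ _ | coilPassRight _ _ => (3, 3)
  | nestedCaps _ _ | coilNestedCaps _ => (0, 4)
  | nestedCups _ _ | coilNestedCups _ => (4, 0)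

/-- Both sides of a move are isotopic. -/
theorem isotopic (hB : ∀ g, IsTangle (B g) 1 1) (r : Rule) :
    TangleIsotopic r.arity.1 r.arity.2 (r.sides.1.diagram n B) (r.sides.2.1.diagram n B) := by
  cases r <;> simp only [sides, arity, diagram, List.flatMap_cons, List.flatMap_nil, Atom.diagram,
    shift_cons, shift_nil, Slice.shift_cap, Slice.shift_cup, Slice.shift_cross, List.append_nil,
    List.cons_append, List.nil_append, Nat.zero_add, Nat.add_zero, shift_zero]
  case zigzagLeft => exact .of_move (.zigzag_left 0) (.of_width rfl) (.of_width rfl)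
  case zigzagRight => exact .of_move (.zigzag_right 0) (.of_width rfl) (.of_width rfl)
  case capSlide b _ => exact .of_move (.cap_slide b 0) (.of_width rfl) (.of_width rfl)
  case cupSlide b _ => exact .of_move (.cup_slide b 0) (.of_width rfl) (.of_width rfl)
  case kinkCap b _ => exact .of_move (.reidemeister_one_cap b 0) (.of_width rfl) (.of_width rfl)
  case kinkCup b _ => exact .of_move (.reidemeister_one_cup b 0) (.of_width rfl) (.of_width rfl)
  case cancel b _ => exact .cancel b le_rfl
  case passCapLeft b _ => exact .pass_cap b
  case passCapRight b _ => exact .pass_cap_left b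
  case passCupRight b _ => exact .pass_cup_left b
  case passLeft b c _ => exact (TangleIsotopic.pass_cross b c).symm
  case passRight b c _ => exact .pass_right b (w := [Slice.cross c 0]) (.of_width rfl)
  case coilPassLeft b _ => exact (TangleIsotopic.pass b (isTangle_twist _)).symm
  case coilPassRight b _ => exact .pass_right b (isTangle_twist _)
  case coilCross b _ => exact .cross_twist_comm b _
  case nestedCaps b _ => exact .nested_caps b
  case nestedCups b _ => exact .nested_cups b
  case coilNestedCaps => exact .nested_caps_twist _
  case coilNestedCups => exact .nested_cups_twist _
  case boxRight g b _ => exact .slide_right b (hB g)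
  case boxLeft g b _ => exact .slide_left b (hB g)
  case boxCoil g _ => exact .slide_twist (hB g) n

end Rule

/-- A word moved to the right. -/
def shift (c : ℕ) (w : Word) : Word := w.map fun x => (x.1, x.2 + c)

theorem diagram_shift (c : ℕ) (w : Word) :
    (w.shift c).diagram n B = ThompsonLink.shift c (w.diagram n B) := by
  induction w with
  | nil => rfl
  | cons x w ih =>
      change ThompsonLink.shift (x.2 + c) _ ++ diagram n B (shift c w) =
        ThompsonLink.shift c (ThompsonLink.shift x.2 _ ++ _)
      rw [ih, shift_append, shift_shift]
      rfl

/-- One step of a derivation, performed at the letter number `p`: the exchange of two letters that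
lie side by side (the second one lies to the left for `exchangeLeft` and to the right for
`exchangeRight`), or a move in either direction. -/
inductive Deduction : Type
  | exchangeLeft (p : ℕ)
  | exchangeRight (p : ℕ)
  | forward (p : ℕ) (r : Rule)
  | backward (p : ℕ) (r : Rule)

/-- Replace the subword `u` in front of `w` by `v`, if `w` begins with `u` and both words fit on `k`
strands. -/
def rewriteHead (r : Rule) (u v : Word) (k : ℕ) (w : Word) : Option Word :=
  if r.sides.2.2 + r.arity.1 ≤ k ∧ w.take u.length = u then some (v ++ w.drop u.length) else none

/-- Perform a step at the beginning of a word. -/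
def Deduction.applyHead (k : ℕ) (w : Word) : Deduction → Option Word
  | exchangeLeft _ =>
      match w with
      | (a, i) :: (b, j) :: w =>
          if j + b.inputs ≤ i ∧ i + a.inputs ≤ k then
            some ((b, j) :: (a, i - b.inputs + b.outputs) :: w) else none
      | _ => none
  | exchangeRight _ =>
      match w with
      | (a, i) :: (b, j) :: w =>
          if i + a.outputs ≤ j ∧ i + a.inputs ≤ k ∧ j + b.inputs ≤ k - a.inputs + a.outputs then
            some ((b, j - a.outputs + a.inputs) :: (a, i) :: w) else none
      | _ => none
  | forward _ r => rewriteHead r (r.sides.1.shift r.sides.2.2) (r.sides.2.1.shift r.sides.2.2) k w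
  | backward _ r => rewriteHead r (r.sides.2.1.shift r.sides.2.2) (r.sides.1.shift r.sides.2.2) k w

/-- The place where a step is performed. -/
def Deduction.place : Deduction → ℕ
  | exchangeLeft p | exchangeRight p | forward p _ | backward p _ => p

/-- Perform a step. -/
def Deduction.apply (k : ℕ) (w : Word) (d : Deduction) : Option Word :=
  (width (w.take d.place) k).bind fun l =>
    (d.applyHead l (w.drop d.place)).map fun v => w.take d.place ++ v

/-- An instance of `TangleIsotopic.interchange`: the strands are cut just to the right of those that
`b` uses, and `a` lies in the right block. -/
theorem isotopic_swap (hB : ∀ g, IsTangle (B g) 1 1) {a b : Atom} {i j k : ℕ}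
    (h : j + b.inputs ≤ i) (h' : i + a.inputs ≤ k) :
    TangleIsotopic k (k - a.inputs + a.outputs - b.inputs + b.outputs)
      (diagram n B [(a, i), (b, j)])
      (diagram n B [(b, j), (a, i - b.inputs + b.outputs)]) := by
  have hb : IsTangle (ThompsonLink.shift j (b.diagram n B)) (j + b.inputs) (j + b.outputs) :=
    ((b.isTangle_diagram hB).shift j).cast (by omega) (by omega)
  have ha : IsTangle (ThompsonLink.shift (i - (j + b.inputs)) (a.diagram n B))
      (k - (j + b.inputs)) _ := (a.isTangle_diagram hB).place (by omega)
  have := (TangleIsotopic.interchange hb ha).symm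
  rw [shift_shift, shift_shift, show i - (j + b.inputs) + (j + b.inputs) = i by omega,
    show i - (j + b.inputs) + (j + b.outputs) = i - b.inputs + b.outputs by omega] at this
  simp only [diagram, List.flatMap_cons, List.flatMap_nil, List.append_nil]
  exact this.cast (by omega) (by omega)

theorem isotopic_rewriteHead {r : Rule} {u v w w' : Word} {k m : ℕ}
    (hr : TangleIsotopic r.arity.1 r.arity.2 (u.diagram n B) (v.diagram n B))
    (h : rewriteHead r (u.shift r.sides.2.2) (v.shift r.sides.2.2) k w = some w')
    (hw : IsTangle (w.diagram n B) k m) :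
    TangleIsotopic k m (w.diagram n B) (w'.diagram n B) := by
  rw [rewriteHead] at h
  split_ifs at h with hc
  obtain ⟨hk, hu⟩ := hc
  rw [Option.some.injEq] at h
  subst h
  have e : w = u.shift r.sides.2.2 ++ w.drop (u.shift r.sides.2.2).length := by
    conv_lhs => rw [← List.take_append_drop (u.shift r.sides.2.2).length w, hu]
  generalize w.drop (u.shift r.sides.2.2).length = s at e ⊢
  subst e
  have h₁ := hr.place hk
  rw [diagram_append, diagram_shift] at hw ⊢
  rw [diagram_append, diagram_shift]
  obtain ⟨l, hl, hs⟩ := isTangle_append_iff.1 hw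
  obtain rfl := hl.unique h₁.1
  exact h₁.append_right hs

theorem Deduction.isotopic_applyHead (hB : ∀ g, IsTangle (B g) 1 1) {d : Deduction} {w w' : Word}
    {k m : ℕ} (h : d.applyHead k w = some w') (hw : IsTangle (w.diagram n B) k m) :
    TangleIsotopic k m (w.diagram n B) (w'.diagram n B) := by
  have key : ∀ {x y : Word} {l : ℕ} {s : Word}, TangleIsotopic k l (x.diagram n B) (y.diagram n B) →
      IsTangle ((x ++ s).diagram n B) k m →
      TangleIsotopic k m ((x ++ s).diagram n B) ((y ++ s).diagram n B) := by
    intro x y l s h hw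
    rw [diagram_append] at hw ⊢
    rw [diagram_append]
    obtain ⟨l', hl, hs⟩ := isTangle_append_iff.1 hw
    obtain rfl := hl.unique h.1
    exact h.append_right hs
  cases d with
  | exchangeLeft p =>
      rcases w with _ | ⟨⟨a, i⟩, _ | ⟨⟨b, j⟩, w⟩⟩ <;> simp only [applyHead, reduceCtorEq] at h
      split_ifs at h with hc
      cases h
      exact key (isotopic_swap hB hc.1 hc.2) hw
  | exchangeRight p =>
      rcases w with _ | ⟨⟨a, i⟩, _ | ⟨⟨b, j⟩, w⟩⟩ <;> simp only [applyHead, reduceCtorEq] at h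
      split_ifs at h with hc
      cases h
      have := isotopic_swap (n := n) hB (a := b) (b := a) (i := j - a.outputs + a.inputs) (j := i)
        (k := k) (by omega) (by omega)
      rw [show j - a.outputs + a.inputs - a.inputs + a.outputs = j by omega] at this
      exact key this.symm hw
  | forward p r => exact isotopic_rewriteHead (r.isotopic hB) h hw
  | backward p r => exact isotopic_rewriteHead (r.isotopic hB).symm h hw

theorem Deduction.isotopic_apply (hB : ∀ g, IsTangle (B g) 1 1) {d : Deduction} {w w' : Word}
    {k m : ℕ} (h : d.apply k w = some w') (hw : IsTangle (w.diagram n B) k m) :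
    TangleIsotopic k m (w.diagram n B) (w'.diagram n B) := by
  simp only [apply, Option.bind_eq_some_iff, Option.map_eq_some_iff] at h
  obtain ⟨l, hl, v, hv, rfl⟩ := h
  have hp := isTangle_diagram (n := n) hB hl
  conv_lhs => rw [← List.take_append_drop d.place w]
  rw [← List.take_append_drop d.place w, diagram_append] at hw
  obtain ⟨l', hl', hs⟩ := isTangle_append_iff.1 hw
  obtain rfl := hl'.unique hp
  rw [diagram_append, diagram_append]
  exact (isotopic_applyHead hB hv hs).append_left hp

/-- Perform the steps of a derivation one after the other. -/
def derive (k : ℕ) : Word → List Deduction → Option Word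
  | w, [] => some w
  | w, d :: ds => (d.apply k w).bind fun v => derive k v ds

/-- A derivation leads to an isotopic diagram. -/
theorem isotopic_of_derive (hB : ∀ g, IsTangle (B g) 1 1) {w w' : Word} {k m : ℕ}
    (ds : List Deduction) (h : derive k w ds = some w') (hw : w.width k = some m) :
    TangleIsotopic k m (w.diagram n B) (w'.diagram n B) := by
  have ht := isTangle_diagram (n := n) hB hw
  clear hw
  induction ds generalizing w with
  | nil => simp only [derive, Option.some.injEq] at h; subst h; exact .refl ht
  | cons d ds ih =>
      simp only [derive, Option.bind_eq_some_iff] at h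
      obtain ⟨v, hv, h⟩ := h
      have h₁ := d.isotopic_apply hB hv ht
      exact h₁.trans (ih h h₁.2.1)

end Word

/-! ### The isotopies that remove and collect twists -/

open Atom in
-- First half of the inductive step for `H^n`: the letters at positions 4 and 5 in the middle are
-- the normal form of the previous stage, enclosed by the newly added vertices. The coil escapes
-- through the crossings beside it, which then cancel or form a kink, and is carried over two nested
-- arcs.
theorem TangleIsotopic.unwind_pos {n : ℕ} {B : Bool → Diagram} (hB : ∀ g, IsTangle (B g) 1 1) :
    TangleIsotopic 3 1
      (Word.diagram n B
        [(cap, 3), (cross true, 2), (cap, 3), (cross true, 2), (cross false, 4), (coil, 5),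
         (cross true, 4), (cup, 5), (cross false, 1), (cup, 2), (cross false, 0), (cup, 1)])
      (Word.diagram n B
        [(cap, 3), (coil, 2), (cross true, 2), (cross false, 1), (cup, 2), (cross false, 0),
         (cup, 1)]) :=
  Word.isotopic_of_derive hB
    -- The list is a certificate. The first `decide` runs it and compares the result with the target
    -- word, the second one checks the widths of the initial word.
    [.backward 0 (.capSlide false 2), .exchangeLeft 1, .exchangeLeft 2,
     .forward 3 (.coilPassLeft false 4), .forward 5 (.cancel false 4),
     .forward 4 (.kinkCup false 5), .exchangeRight 2, .forward 0 (.coilNestedCaps 2),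
     .exchangeRight 3, .exchangeRight 2, .exchangeRight 1, .forward 0 (.zigzagRight 2)]
    (by decide +kernel) (by decide +kernel)

open Atom in
-- Second half of the inductive step: two crossings join the coil on its own two strands, which is
-- the additional full twist. With an empty coil it is also the base case.
theorem TangleIsotopic.wind_pos {n : ℕ} {B : Bool → Diagram} (hB : ∀ g, IsTangle (B g) 1 1) :
    TangleIsotopic 3 1
      (Word.diagram n B
        [(cap, 3), (coil, 2), (cross true, 2), (cross false, 1), (cup, 2), (cross false, 0),
         (cup, 1)])
      (Word.diagram n B
        [(cross false, 0), (coil, 1), (cross true, 1), (cross true, 1), (cross true, 0), (cup, 1)]) :=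
  Word.isotopic_of_derive hB
    [.backward 3 (.cupSlide true 1), .backward 4 (.passCupRight false 0), .exchangeRight 6,
     .exchangeRight 7, .exchangeLeft 3, .backward 4 (.passRight false true 1), .exchangeLeft 2,
     .exchangeLeft 1, .backward 3 (.passRight false true 1), .backward 2 (.coilPassRight false 1),
     .exchangeRight 6, .exchangeRight 5, .exchangeRight 4, .exchangeLeft 0, .exchangeLeft 1,
     .backward 2 (.capSlide true 2), .forward 3 (.kinkCup true 3), .forward 2 (.zigzagRight 2),
     .forward 1 (.coilCross false 1), .forward 2 (.cancel false 1), .backward 3 (.cancel true 1),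
     .forward 4 (.cupSlide false 0)]
    (by decide +kernel) (by decide +kernel)

open Atom in
-- The whole positive link after the core is in normal form. `box false` stands for the diagram of
-- `f` and `box true` for that of `g`; the latter ends on the strand 2, next to the one carrying
-- `f`.
theorem TangleIsotopic.straighten_pos {n : ℕ} {B : Bool → Diagram} (hB : ∀ g, IsTangle (B g) 1 1) :
    TangleIsotopic 0 0
      (Word.diagram n B
        [(cap, 0), (cap, 2), (cross true, 1), (cap, 3), (cross true, 2), (box true, 1),
         (cross false, 1), (coil, 2), (cross true, 1), (cup, 2), (box false, 2), (cross false, 1),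
         (cup, 2), (cup, 0)])
      (Word.diagram n B
        [(cap, 0), (box false, 1), (cap, 2), (box true, 2), (coil, 1), (cup, 2), (cup, 0)]) :=
  Word.isotopic_of_derive hB
    [.exchangeLeft 4, .exchangeLeft 3, .backward 2 (.boxLeft true true 1),
     .forward 10 (.boxLeft false false 1), .backward 4 (.capSlide false 2),
     .backward 8 (.cupSlide false 1), .exchangeRight 9, .backward 8 (.cancel true 1),
     .forward 8 (.cancel true 1), .exchangeLeft 5, .backward 4 (.capSlide true 1), .exchangeLeft 3,
     .forward 4 (.passLeft true false 2), .forward 3 (.capSlide false 1),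
     .forward 6 (.coilCross true 2), .forward 7 (.cancel true 2), .backward 5 (.cancel false 2),
     .forward 6 (.coilPassRight true 2), .forward 8 (.cancel true 3), .forward 7 (.cupSlide true 1),
     .exchangeLeft 6, .backward 4 (.passLeft false true 1), .forward 3 (.kinkCap false 2),
     .backward 3 (.capSlide true 1), .exchangeLeft 2, .exchangeLeft 3, .exchangeLeft 4,
     .exchangeLeft 1, .exchangeLeft 2, .exchangeLeft 3, .forward 0 (.nestedCaps true 0),
     .exchangeRight 2, .forward 0 (.nestedCaps true 0), .exchangeRight 3, .exchangeRight 2,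
     .exchangeRight 4, .exchangeRight 3, .exchangeRight 5, .exchangeRight 4, .exchangeRight 6,
     .exchangeRight 5, .backward 7 (.boxRight false true 0), .backward 6 (.boxLeft false true 0),
     .exchangeLeft 9, .forward 8 (.kinkCup true 0), .forward 7 (.kinkCup true 0), .exchangeRight 7,
     .exchangeRight 1, .exchangeRight 2, .exchangeRight 3, .forward 4 (.zigzagRight 1),
     .backward 3 (.boxCoil false 1), .exchangeLeft 2, .exchangeLeft 1]
    (by decide +kernel) (by decide +kernel)

open Atom in
-- The inductive step for `H^{-n}`: the coil followed by one crossing becomes the coil followed by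
-- three, that is, one more full twist in the same shape.
theorem TangleIsotopic.wind_neg {n : ℕ} {B : Bool → Diagram} (hB : ∀ g, IsTangle (B g) 1 1) :
    TangleIsotopic 3 1
      (Word.diagram n B
        [(cap, 1), (cross true, 0), (cap, 2), (cross true, 1), (coil, 1), (cross true, 1), (cup, 0),
         (cross false, 2), (cup, 3), (cross false, 0), (cup, 1)])
      (Word.diagram n B
        [(coil, 1), (cross true, 1), (cross true, 1), (cross true, 1), (cup, 0)]) :=
  Word.isotopic_of_derive hB
    [.forward 3 (.coilCross true 1), .backward 0 (.capSlide false 0),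
     .backward 2 (.passCapRight false 2), .exchangeRight 1, .exchangeLeft 4,
     .forward 2 (.coilPassRight false 1), .exchangeLeft 5, .exchangeLeft 6,
     .forward 3 (.passRight false true 1), .forward 4 (.passRight false true 1), .exchangeRight 0,
     .exchangeRight 1, .exchangeRight 2, .exchangeRight 3, .forward 4 (.capSlide false 0),
     .exchangeLeft 7, .exchangeLeft 6, .forward 5 (.kinkCup true 0), .forward 4 (.zigzagLeft 0),
     .backward 8 (.cupSlide true 0), .exchangeLeft 7, .forward 5 (.passRight false true 1),
     .forward 3 (.cancel true 0), .exchangeRight 2, .exchangeRight 1, .forward 0 (.capSlide true 1),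
     .backward 5 (.cupSlide true 2), .exchangeRight 4, .backward 5 (.cupSlide true 1),
     .exchangeRight 3, .exchangeRight 4, .exchangeRight 2, .exchangeRight 3,
     .forward 5 (.nestedCups true 0), .exchangeRight 4, .forward 5 (.coilNestedCups 0),
     .forward 4 (.coilCross true 2), .backward 4 (.coilCross true 2), .exchangeRight 1,
     .forward 0 (.capSlide true 2), .forward 1 (.passLeft false true 1), .exchangeLeft 0,
     .forward 2 (.passLeft false true 1), .exchangeLeft 1, .forward 3 (.coilPassLeft false 1),
     .exchangeLeft 2, .forward 1 (.coilCross true 1), .forward 0 (.coilCross true 1),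
     .forward 5 (.kinkCup false 1), .backward 3 (.capSlide true 2), .exchangeLeft 4,
     .forward 3 (.zigzagLeft 1)]
    (by decide +kernel) (by decide +kernel)

open Atom in
-- The whole negative link. Now `box true` ends on the strand 3, the right side of its loop, so that
-- its downward direction there makes the two strands antiparallel in the coil.
theorem TangleIsotopic.straighten_neg {n : ℕ} {B : Bool → Diagram} (hB : ∀ g, IsTangle (B g) 1 1) :
    TangleIsotopic 0 0
      (Word.diagram n B
        [(cap, 0), (cap, 2), (cross true, 1), (cap, 3), (cross true, 2), (box true, 1),
         (box false, 2), (cap, 5), (coil, 4), (cup, 3), (cross false, 3), (cup, 4),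
         (cross false, 1), (cup, 2), (cup, 0)])
      (Word.diagram n B
        [(cap, 0), (box false, 1), (cap, 2), (box true, 3), (coil, 1), (cup, 2), (cup, 0)]) :=
  Word.isotopic_of_derive hB
    [.exchangeLeft 4, .exchangeLeft 3, .exchangeRight 6, .exchangeRight 7, .exchangeRight 8,
     .exchangeRight 9, .exchangeRight 10, .backward 4 (.capSlide false 2), .exchangeRight 5,
     .backward 5 (.passCapLeft false 4), .forward 7 (.coilPassLeft false 3), .exchangeLeft 6,
     .forward 9 (.kinkCup false 3), .backward 5 (.kinkCap false 4), .exchangeRight 4,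
     .backward 5 (.passCapRight false 2), .forward 7 (.coilPassRight false 3), .exchangeRight 6,
     .forward 4 (.coilNestedCaps 2), .backward 9 (.passLeft false false 4), .exchangeRight 8,
     .exchangeRight 7, .exchangeLeft 11, .forward 9 (.passCupRight false 3), .exchangeRight 6,
     .exchangeRight 5, .exchangeRight 8, .exchangeRight 7, .forward 6 (.zigzagRight 3),
     .forward 4 (.capSlide false 2), .forward 5 (.coilCross true 2), .forward 6 (.cancel true 2),
     .forward 9 (.boxLeft false false 1), .backward 2 (.boxLeft true true 1), .exchangeLeft 8,
     .exchangeLeft 7, .exchangeLeft 6, .exchangeRight 3, .backward 4 (.cancel false 2),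
     .forward 5 (.coilPassLeft true 1), .forward 7 (.cancel true 1), .exchangeRight 2,
     .forward 3 (.boxRight true false 2), .backward 1 (.nestedCaps false 2), .exchangeLeft 3,
     .exchangeLeft 4, .exchangeLeft 5, .exchangeLeft 9, .exchangeLeft 8, .exchangeLeft 7,
     .exchangeLeft 6, .exchangeLeft 5, .backward 9 (.cupSlide true 3),
     .forward 7 (.passLeft false true 3), .forward 9 (.kinkCup false 3),
     .backward 8 (.nestedCups false 2), .forward 6 (.passRight true false 2),
     .forward 8 (.kinkCup true 3), .forward 7 (.nestedCups true 2), .forward 7 (.cupSlide true 3),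
     .exchangeRight 5, .exchangeRight 4, .exchangeRight 6, .exchangeRight 5,
     .forward 3 (.boxRight true false 3), .forward 4 (.boxLeft true false 3),
     .forward 2 (.kinkCap false 3), .forward 2 (.kinkCap false 3), .exchangeRight 5,
     .exchangeRight 4, .exchangeRight 3, .forward 2 (.zigzagRight 3),
     .backward 3 (.boxCoil false 1), .exchangeLeft 2, .exchangeLeft 1]
    (by decide +kernel) (by decide +kernel)

/-! ### The diagrams of trees -/

theorem shift_upperDiagram (T : TernaryTree) (μ : Address → Option Label) (i c : ℕ) :
    shift c (upperDiagram T μ i) = upperDiagram T μ (i + c) := by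
  induction T generalizing μ i with
  | leaf => cases h : μ [] <;> simp [upperDiagram, h]
  | node l m r hl hm hr =>
      cases h : μ [] <;> simp [upperDiagram, h, hl, hm, hr, Nat.add_right_comm]

theorem shift_lowerDiagram (T : TernaryTree) (i c : ℕ) :
    shift c (lowerDiagram T i) = lowerDiagram T (i + c) := by
  induction T generalizing i with
  | leaf => rfl
  | node l m r hl hm hr => simp [lowerDiagram, hl, hm, hr, Nat.add_right_comm]

theorem shift_openDiagram (f : F3) (μ : Address → Option Label) (i c : ℕ) :
    shift c (openDiagram f μ i) = openDiagram f μ (i + c) := by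
  simp [openDiagram, shift_upperDiagram, shift_lowerDiagram]

/-- Upper subtrees are drawn from right to left, so the roots of those still to be drawn keep their
positions; the extra `c` strands on the right absorb the leaves already present. -/
theorem isTangle_upperDiagram (T : TernaryTree) (μ : Address → Option Label) (i c : ℕ) :
    IsTangle (upperDiagram T μ i) (i + 1 + c) (i + T.numLeaves + c) := by
  have hm : ∀ (μ : Address → Option Label) (i c : ℕ),
      IsTangle ((μ []).toList.map fun c => mark c true i) (i + 1 + c) (i + 1 + c) := by
    intro μ i c
    cases μ [] with
    | none => exact .nil _
    | some c' =>
        simp only [Option.toList_some, List.map_cons, List.map_nil, isTangle_cons_iff,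
          isTangle_nil_iff, Slice.pos, Slice.inputs, Slice.outputs]
        omega
  induction T generalizing μ i c with
  | leaf => exact hm μ i c
  | node l m r ihl ihm ihr =>
      refine ((((hm μ i c).append ?_).append (ihr _ (i + 2) c)).append
        ((ihm _ (i + 1) (r.numLeaves + c)).cast (by omega) rfl)).append
        ((ihl _ i (m.numLeaves + r.numLeaves + c)).cast (by omega) (by
          simp only [numLeaves]; omega))
      simp only [isTangle_cons_iff, isTangle_nil_iff, Slice.pos, Slice.inputs, Slice.outputs]
      omega

theorem isTangle_lowerDiagram (T : TernaryTree) (i c : ℕ) :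
    IsTangle (lowerDiagram T i) (i + T.numLeaves + c) (i + 1 + c) := by
  induction T generalizing i c with
  | leaf => exact .nil _
  | node l m r ihl ihm ihr =>
      refine ((((ihl i (m.numLeaves + r.numLeaves + c)).cast (by
        simp only [numLeaves]; omega) rfl).append
        ((ihm (i + 1) (r.numLeaves + c)).cast (by omega) rfl)).append
        ((ihr (i + 2) c).cast (by omega) rfl)).append ?_
      simp only [isTangle_cons_iff, isTangle_nil_iff, Slice.pos, Slice.inputs, Slice.outputs]
      omega

theorem isTangle_openDiagram (f : F3) (μ : Address → Option Label) :
    IsTangle (openDiagram f μ 0) 1 1 :=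
  (isTangle_upperDiagram f.upper μ 0 0).append
    ((isTangle_lowerDiagram f.lower 0 0).cast (by rw [f.numLeaves_eq]) rfl)

theorem isTangle_linkDiagram (f : F3) (μ : Address → Option Label) :
    IsTangle (linkDiagram f μ) 0 0 := by
  have h := ((isTangle_openDiagram f μ).shift 1)
  rw [shift_openDiagram] at h
  exact (IsTangle.append (.of_width (k := 0) rfl) h).append (.of_width rfl)

/-! ### The pairs of trees of the linking moves -/

theorem graft_zero_node (l m r S : TernaryTree) :
    (node l m r).graft 0 S = node (l.graft 0 S) m r := by
  simp [graft, numLeaves_pos]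

theorem upper_linkPos (n : ℕ) (f g : F3) :
    (linkPos n f g).upper = node g.upper (node leaf (posUp (n - 1)) f.upper) leaf := by
  simp [linkPos, F3.diamond, F3.diamondAt, hopfPos, leafIndex, F3.attach, graft, numLeaves,
    constLeaf, numLeaves_posUp]

theorem lower_linkPos (n : ℕ) (f g : F3) :
    (linkPos n f g).lower = node ((posLow (n - 1)).graft 0 g.lower) f.lower leaf := by
  -- The leaf at the address `12` of the upper tree comes right after as many leaves as `posLow (n -
  -- 1)` has. In the lower tree it is therefore the middle child of the root.
  have h : ¬ 1 + (1 + (4 * (n - 1) + 3)) < 4 * (n - 1) + 5 := by omega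
  have h' : 1 + (1 + (4 * (n - 1) + 3)) < 4 * (n - 1) + 5 + 1 := by omega
  have h'' : 1 + (1 + (4 * (n - 1) + 3)) - (4 * (n - 1) + 5) = 0 := by omega
  simp [linkPos, F3.diamond, F3.diamondAt, hopfPos, leafIndex, F3.attach, graft, numLeaves,
    constLeaf, numLeaves_posUp, numLeaves_posLow, h, h', h'']

theorem upper_linkNeg (n : ℕ) (f g : F3) :
    (linkNeg n f g).upper = node g.upper (node f.upper (negUp (n - 1)) caret) leaf := by
  simp [linkNeg, F3.diamond, F3.diamondAt, hopfNeg, leafIndex, F3.attach, graft, numLeaves,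
    constLeaf]

theorem lower_linkNeg (n : ℕ) (f g : F3) :
    (linkNeg n f g).lower = node g.lower f.lower (node (negLow (n - 1)) leaf leaf) := by
  simp [linkNeg, F3.diamond, F3.diamondAt, hopfNeg, leafIndex, F3.attach, graft, numLeaves,
    constLeaf]

/-! ### The twists in the linking moves -/

theorem twist_two_mul_succ (n : ℕ) :
    twist (2 * (n + 1)) = twist (2 * n) ++ [cross true 0, cross true 0] := by
  rw [show 2 * (n + 1) = 2 * n + 1 + 1 by ring, twist_succ', twist_succ', List.append_assoc]
  rfl

/-- Normal form of the part of the link specific to `H^(k+1)`: `k + 1` full twists conjugated by a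
crossing and closed by a minimum. The roots 2 above and 0 below reflect that the first two leaves of
`posLow k` come from outside `posUp k`. The inserted tangles play no role here. -/
theorem isotopic_posUp_posLow (k : ℕ) (B : Bool → Diagram) (hB : ∀ g, IsTangle (B g) 1 1) :
    TangleIsotopic 3 1 (upperDiagram (posUp k) (fun _ => none) 2 ++ lowerDiagram (posLow k) 0)
      (Word.diagram (k + 1) B
        [(.cross false, 0), (.coil, 1), (.cross true, 0), (.cup, 1)]) := by
  have hw : ∀ k, Word.diagram k B [(.cross false, 0), (.coil, 1), (.cross true, 1), (.cross true, 1),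
      (.cross true, 0), (.cup, 1)] = Word.diagram (k + 1) B
        [(.cross false, 0), (.coil, 1), (.cross true, 0), (.cup, 1)] := by
    intro k
    simp [Word.diagram, Atom.diagram, twist_two_mul_succ]
  induction k with
  | zero =>
      rw [← hw]
      exact TangleIsotopic.wind_pos (n := 0) hB
  | succ k ih =>
      rw [← hw]
      refine TangleIsotopic.trans ?_
        ((TangleIsotopic.unwind_pos hB).trans (TangleIsotopic.wind_pos hB))
      have hU := isTangle_upperDiagram (posUp k) (fun _ => none) 1 0
      have hL := isTangle_lowerDiagram (posLow k) 0 0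
      -- The carets added at the last stage separate the inner upper tree from the inner lower one.
      -- The upper caret is moved above the inner upper tree and the lower caret below the inner
      -- lower tree, which makes the induction hypothesis applicable at the position 4.
      have h₁ := (TangleIsotopic.interchange (a := [cap 3, cross true 2]) (k := 3) (k' := 5)
        (.of_width rfl) hU).symm
      have h₂ := TangleIsotopic.interchange (a := [cross false 1, cup 2]) (k := 4) (k' := 2)
        (.of_width rfl) hL
      have h₃ := ih.shift 4
      simp only [shift_upperDiagram, shift_lowerDiagram, shift_append, Nat.zero_add] at h₁ h₂ h₃
      rw [numLeaves_posUp] at h₁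
      rw [numLeaves_posLow] at h₂
      have h₄ := ((h₁.append (h₂.cast (by omega) rfl)).append_left (p := [cap 3, cross true 2])
        (k := 3) (.of_width rfl)).append_right (s := [cross false 0, cup 1]) (m := 1)
        (.of_width rfl)
      have h₅ := (h₃.append_left (p := [cap 3, cross true 2, cap 3, cross true 2])
        (k := 3) (.of_width rfl)).append_right (s := [cross false 1, cup 2, cross false 0, cup 1])
        (m := 1) (.of_width rfl)
      simp only [posUp, posLow, caret, upperDiagram, lowerDiagram, Word.diagram, Atom.diagram,
        List.flatMap_cons, List.flatMap_nil, List.append_assoc, List.cons_append, List.nil_append,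
        Option.toList_none, List.map_nil, shift_cons, shift_nil, Slice.shift_cap, Slice.shift_cup,
        Slice.shift_cross, Nat.zero_add, Nat.reduceAdd, shift_append, shift_shift,
        List.append_nil] at h₄ h₅ ⊢
      exact h₄.trans h₅

/-- Normal form of the core of `H^(-(k+1))`, with `2 * k + 1` crossings; the missing one is the
crossing of the caret that hangs to the right of `negUp k` in `hopfNeg`. The inner trees already
face each other, so no interchange is needed. -/
theorem isotopic_negUp_negLow (k : ℕ) (B : Bool → Diagram) (hB : ∀ g, IsTangle (B g) 1 1) :
    TangleIsotopic 3 1 (upperDiagram (negUp k) (fun _ => none) 0 ++ lowerDiagram (negLow k) 0)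
      (Word.diagram k B [(.coil, 1), (.cross true, 1), (.cup, 0)]) := by
  induction k with
  | zero =>
      exact (TangleIsotopic.of_move (.cup_slide true 0) (.of_width rfl) (.of_width rfl)).symm
  | succ k ih =>
      have h₁ := ((ih.widen 4).append_left (p := [cap 1, cross true 0, cap 2, cross true 1])
        (k := 3) (.of_width rfl)).append_right (s := [cross false 2, cup 3, cross false 0, cup 1])
        (m := 1) (.of_width rfl)
      have h₂ := TangleIsotopic.wind_neg (n := k) hB
      simp only [negUp, negLow, caret, upperDiagram, lowerDiagram, Word.diagram, Atom.diagram,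
        List.flatMap_cons, List.flatMap_nil, List.append_assoc, List.cons_append, List.nil_append,
        Option.toList_none, List.map_nil, shift_cons, shift_nil, Slice.shift_cap, Slice.shift_cup,
        Slice.shift_cross, Nat.zero_add, Nat.reduceAdd, shift_append,
        List.append_nil, twist_two_mul_succ] at h₁ h₂ ⊢
      exact h₁.trans h₂

/-! ### The isotopies of the main result -/

/-- Lower trees are drawn from left to right and upper trees from right to left. The trees of `g`,
sitting at the leftmost leaf, thus meet directly and form `openDiagram g`. -/
theorem lowerDiagram_graft_posLow (k : ℕ) (S : TernaryTree) (i : ℕ) :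
    lowerDiagram ((posLow k).graft 0 S) i = lowerDiagram S i ++ lowerDiagram (posLow k) i := by
  cases k <;> simp [posLow, graft, graft_zero_node, lowerDiagram]

theorem markAt_pos_f : (fun α => markAt [1, 2] [0] (1 :: 2 :: α)) = markRoot Label.Kf := by
  funext α; simp [markAt, markRoot]

theorem markAt_neg_f : (fun α => markAt [1, 0] [0] (1 :: 0 :: α)) = markRoot Label.Kf := by
  funext α; simp [markAt, markRoot]

theorem markAt_g (i : Fin 3) : (fun α => markAt [1, i] [0] (0 :: α)) = markRoot Label.Kg := by
  funext α; simp [markAt, markRoot]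

/-- The inserted diagrams of `f` and `g`. -/
def boxes (f g : F3) (b : Bool) : Diagram :=
  if b then openDiagram g (markRoot Label.Kg) 0 else openDiagram f (markRoot Label.Kf) 0

theorem isTangle_boxes (f g : F3) (b : Bool) : IsTangle (boxes f g b) 1 1 := by
  cases b <;> exact isTangle_openDiagram _ _

theorem linkPosDiagram_eq (n : ℕ) (f g : F3) :
    linkPosDiagram n f g = [cap 0, cap 2, cross true 1, cap 3, cross true 2] ++
      upperDiagram f.upper (markRoot Label.Kf) 4 ++ upperDiagram (posUp (n - 1)) (fun _ => none) 3 ++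
      openDiagram g (markRoot Label.Kg) 1 ++ lowerDiagram (posLow (n - 1)) 1 ++
      lowerDiagram f.lower 2 ++ [cross false 1, cup 2, cup 0] := by
  have h : (fun α => markAt [1, 2] [0] (1 :: 1 :: α)) = fun _ => none := by
    funext α; simp [markAt]
  simp only [linkPosDiagram, linkDiagram, openDiagram, upper_linkPos, lower_linkPos, upperDiagram,
    lowerDiagram, lowerDiagram_graft_posLow, markAt_pos_f, markAt_g, h]
  simp [markAt]

theorem linkNegDiagram_eq (n : ℕ) (f g : F3) :
    linkNegDiagram n f g = [cap 0, cap 2, cross true 1, cap 3, cross true 2, cap 5, cross true 4] ++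
      upperDiagram (negUp (n - 1)) (fun _ => none) 3 ++
      upperDiagram f.upper (markRoot Label.Kf) 2 ++ openDiagram g (markRoot Label.Kg) 1 ++
      lowerDiagram f.lower 2 ++ lowerDiagram (negLow (n - 1)) 3 ++
      [cross false 3, cup 4, cross false 1, cup 2, cup 0] := by
  have h : (fun α => markAt [1, 0] [0] (1 :: 1 :: α)) = fun _ => none := by
    funext α; simp [markAt]
  simp only [linkNegDiagram, linkDiagram, openDiagram, upper_linkNeg, lower_linkNeg, upperDiagram,
    lowerDiagram, markAt_neg_f, markAt_g, h, caret]
  simp [markAt]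

theorem linkIsotopic_pos (n : ℕ) (hn : 1 ≤ n) (f g : F3) :
    LinkIsotopic (linkPosDiagram n f g) (twistedDiagram 2 n f g) := by
  obtain ⟨k, rfl⟩ : ∃ k, n = k + 1 := ⟨n - 1, by omega⟩
  have hB := isTangle_boxes f g
  have hQ := isotopic_posUp_posLow k _ hB
  have hU := isTangle_upperDiagram (posUp k) (fun _ => none) 3 0
  have hU' := isTangle_upperDiagram (posUp k) (fun _ => none) 1 0
  have hL := isTangle_lowerDiagram (posLow k) 1 0
  have hG : ∀ c, IsTangle (openDiagram g (markRoot Label.Kg) 1) (2 + c) (2 + c) := by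
    intro c
    have := ((isTangle_openDiagram g (markRoot Label.Kg)).shift 1).widen c
    rwa [shift_openDiagram] at this
  have hf := isTangle_upperDiagram f.upper (markRoot Label.Kf) 0 1
  have hf' := isTangle_lowerDiagram f.lower 2 1
  rw [numLeaves_posUp] at hU hU'
  rw [numLeaves_posLow] at hL
  rw [← f.numLeaves_eq] at hf'
  -- The upper tree of `f` is lowered past everything to its left until it meets the lower tree of
  -- `f`.
  have h₁ := (TangleIsotopic.interchange ((hU.append ((hG (4 * k + 4)).cast (by omega) rfl)).append
    -- Then the diagram of `g` is raised above `posUp k`, so that `posUp k` faces `posLow k` and the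
    -- normal form `hQ` applies.
    (hL.cast (by omega) rfl)) hf).symm
  have h₂ := (TangleIsotopic.interchange (hG 0) hU').symm.append_right
    (hL.cast (k' := 2 + 0 + (1 + (4 * k + 3) + 0)) (by omega) rfl)
  have h₃ := (hQ.shift 1).append_left (hG 2)
  simp only [shift_upperDiagram, shift_lowerDiagram, shift_append, Nat.zero_add, Nat.reduceAdd,
    List.append_assoc] at h₁ h₂ h₃
  have h₄ := (h₂.trans h₃).widen 2
  have h₅ := h₁.trans (by
    simpa using h₄.append_right (s := upperDiagram f.upper (markRoot Label.Kf) 2)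
      (m := 2 + (f.upper.numLeaves + 1))
      ((isTangle_upperDiagram f.upper _ 2 1).cast rfl (by omega)))
  have h₆ := ((h₅.append_right (hf'.cast (by omega) rfl)).append_left (k := 0)
    (p := [cap 0, cap 2, cross true 1, cap 3, cross true 2]) (.of_width rfl)).append_right
    (s := [cross false 1, cup 2, cup 0]) (m := 0) (.of_width rfl)
  have h₇ := TangleIsotopic.straighten_pos (n := k + 1) hB
  rw [linkPosDiagram_eq]
  simp only [Nat.add_sub_cancel, twistedDiagram, openDiagram, boxes, Word.diagram, Atom.diagram,
    List.flatMap_cons, List.flatMap_nil, List.append_assoc, List.cons_append, List.nil_append,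
    shift_cons, shift_nil, Slice.shift_cap, Slice.shift_cup, Slice.shift_cross, Nat.zero_add,
    Nat.reduceAdd, shift_append, shift_shift, shift_upperDiagram, shift_lowerDiagram, ← shift_twist,
    List.append_nil, if_true, if_false, Bool.false_eq_true] at h₆ h₇ ⊢
  exact h₆.trans h₇

theorem linkIsotopic_neg (n : ℕ) (hn : 1 ≤ n) (f g : F3) :
    LinkIsotopic (linkNegDiagram n f g) (twistedDiagram 3 n f g) := by
  obtain ⟨k, rfl⟩ : ∃ k, n = k + 1 := ⟨n - 1, by omega⟩
  have hB := isTangle_boxes f g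
  have hR := isotopic_negUp_negLow k _ hB
  have hU := isTangle_upperDiagram (negUp k) (fun _ => none) 0 4
  have hV := isTangle_lowerDiagram (negLow k) 3 2
  have hG : IsTangle (openDiagram g (markRoot Label.Kg) 1) 2 2 := by
    have := (isTangle_openDiagram g (markRoot Label.Kg)).shift 1
    rwa [shift_openDiagram] at this
  have hF : IsTangle (openDiagram f (markRoot Label.Kf) 2) 3 3 := by
    have := (isTangle_openDiagram f (markRoot Label.Kf)).shift 2
    rwa [shift_openDiagram] at this
  have hf := isTangle_upperDiagram f.upper (markRoot Label.Kf) 0 0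
  have hf' := isTangle_lowerDiagram f.lower 2 0
  rw [numLeaves_negUp] at hU
  rw [numLeaves_negLow] at hV
  rw [← f.numLeaves_eq] at hf'
  -- The diagram of `g` is raised past the upper tree of `f`, which then meets the lower one.
  have h₁ := (TangleIsotopic.interchange hG hf).symm.append_right (hf'.cast (by omega) rfl)
  have h₂ := h₁.widen (4 * k + 5)
  have hX : IsTangle ([cap 2, cross true 1] ++ upperDiagram (negUp k) (fun _ => none) 0) 3
    (4 * k + 5) := IsTangle.append (.of_width rfl) (hU.cast rfl (by omega))
  -- Both inserted diagrams are raised above the part belonging to `negUp k`, which thereby faces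
  -- `negLow k`.
  have h₃ := (TangleIsotopic.interchange ((hG.widen 1).append hF) hX).symm
  have h₄ := ((hR.widen 2).shift 3).append_left (p := openDiagram g (markRoot Label.Kg) 1 ++
    (openDiagram f (markRoot Label.Kf) 2 ++ [cap 5, cross true 4])) (k := 6)
    ((hG.widen 4).append ((hF.widen 3).append (.of_width rfl)))
  have h₅ := h₂.append_left (p := [cap 5, cross true 4] ++
    upperDiagram (negUp k) (fun _ => none) 3) (k := 6) (by
      have := (hX.shift 3).cast (m' := 2 + (0 + 1 + 0) + (4 * k + 5)) rfl (by omega)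
      simpa [shift_upperDiagram] using this)
  simp only [openDiagram, Word.diagram, Atom.diagram,
    List.flatMap_cons, List.flatMap_nil, List.append_assoc, List.cons_append, List.nil_append,
    shift_cons, shift_nil, Slice.shift_cap, Slice.shift_cup, Slice.shift_cross, Nat.zero_add,
    Nat.reduceAdd, shift_append, shift_shift, shift_upperDiagram, shift_lowerDiagram,
    List.append_nil] at h₃ h₄ h₅
  have h₆ := h₅.append_right (hV.cast (by omega) rfl)
  have h₇ := h₃.append_right (hV.cast (by omega) rfl)
  simp only [List.append_assoc, List.cons_append] at h₆ h₇
  have h₈ := ((h₆.trans (h₇.trans h₄)).append_left (k := 0)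
    (p := [cap 0, cap 2, cross true 1, cap 3, cross true 2]) (.of_width rfl)).append_right
    (s := [cross false 3, cup 4, cross false 1, cup 2, cup 0]) (m := 0) (.of_width rfl)
  have h₉ := TangleIsotopic.straighten_neg (n := k + 1) hB
  -- The first crossing belongs to the remaining upper caret, the other `2 * k + 1` to the normal
  -- form.
  have e : twist (2 * (k + 1)) = [cross true 0] ++ (twist (2 * k) ++ [cross true 0]) := by
    rw [← twist_succ', ← twist_succ]; rfl
  rw [linkNegDiagram_eq]
  simp only [Nat.add_sub_cancel, twistedDiagram, openDiagram, boxes, Word.diagram, Atom.diagram,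
    List.flatMap_cons, List.flatMap_nil, List.append_assoc, List.cons_append, List.nil_append,
    shift_cons, shift_nil, Slice.shift_cap, Slice.shift_cup, Slice.shift_cross, Nat.zero_add,
    shift_append, shift_upperDiagram, shift_lowerDiagram, List.append_nil, if_true, if_false, Bool.false_eq_true, ← shift_twist, e] at h₈ h₉ ⊢
  exact h₈.trans h₉

/-! ### Travelling along the components of a link diagram -/

/-- The number of strands of a diagram with `k` upper endpoints just above the slice number `t`. -/
def strands : Diagram → ℕ → ℕ → ℕ
  | _, k, 0 => k
  | [], k, _ + 1 => k
  | s :: w, k, t + 1 => strands w (k - s.inputs + s.outputs) t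

@[simp] theorem strands_zero (w : Diagram) (k : ℕ) : strands w k 0 = k := by
  cases w <;> rfl

theorem strands_of_getElem? {w : Diagram} {k m t : ℕ} {s : Slice} (h : IsTangle w k m)
    (hs : w[t]? = some s) : s.pos + s.inputs ≤ strands w k t ∧
      strands w k (t + 1) = strands w k t - s.inputs + s.outputs := by
  induction w generalizing k t with
  | nil => simp at hs
  | cons s' w ih =>
      rw [isTangle_cons_iff] at h
      cases t with
      | zero =>
          simp only [List.getElem?_cons_zero, Option.some.injEq] at hs
          subst hs
          simp [strands, h.1]
      | succ t => exact ih h.2 (by simpa using hs)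

theorem strands_of_le {w : Diagram} {k m t : ℕ} (h : IsTangle w k m) (ht : w.length ≤ t) :
    strands w k t = m := by
  induction w generalizing k t with
  | nil => cases t <;> exact isTangle_nil_iff.1 h
  | cons s w ih =>
      cases t with
      | zero => simp at ht
      | succ t => exact ih (isTangle_cons_iff.1 h).2 (by simpa using ht)

/-- The point lies on a strand of the link diagram `w`. -/
def Inside (w : Diagram) (p : DirectedPoint) : Prop := p.strand < strands w 0 p.level

/-- The same point with the opposite direction. -/
def DirectedPoint.rev (p : DirectedPoint) : DirectedPoint := ⟨p.level, p.strand, !p.down⟩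

theorem DirectedPoint.rev_rev (p : DirectedPoint) : p.rev.rev = p := by simp [rev]

theorem DirectedPoint.rev_ne (p : DirectedPoint) : p.rev ≠ p := by
  obtain ⟨t, i, d⟩ := p
  simp [rev]

theorem Inside.exists_below {w : Diagram} (h : IsTangle w 0 0) {t i : ℕ} {d : Bool}
    (hp : Inside w ⟨t, i, d⟩) : ∃ s, w[t]? = some s := by
  by_contra hs
  have : w[t]? = none := by
    cases h : w[t]? with
    | none => rfl
    | some s => exact absurd ⟨s, h⟩ hs
  have := strands_of_le h (List.getElem?_eq_none_iff.1 this)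
  simp only [Inside] at hp
  omega

theorem Inside.exists_above {w : Diagram} (h : IsTangle w 0 0) {t i : ℕ} {d : Bool}
    (hp : Inside w ⟨t, i, d⟩) : ∃ t' s, t = t' + 1 ∧ w[t']? = some s := by
  cases t with
  | zero => simp [Inside] at hp
  | succ t =>
      obtain ⟨s, hs⟩ := hp.exists_below h
      have ht : t < w.length := by
        have := (List.getElem?_eq_some_iff.1 hs).1
        omega
      exact ⟨t, w[t], rfl, List.getElem?_eq_getElem ht⟩

/-- Travel is reversible, and a turn at an extremum changes the strand, so it never just reverses a
point. The global facts about components below follow formally from this. -/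
theorem next_spec {w : Diagram} (h : IsTangle w 0 0) {p : DirectedPoint} (hp : Inside w p) :
    Inside w (next w p) ∧ next w (next w p).rev = p.rev ∧ next w p ≠ p.rev := by
  obtain ⟨t, i, d⟩ := p
  cases d with
  | true =>
      obtain ⟨s, hs⟩ := hp.exists_below h
      obtain ⟨h₁, h₂⟩ := strands_of_getElem? h hs
      simp only [Inside] at hp
      cases s <;> simp only [Slice.pos, Slice.inputs, Slice.outputs] at h₁ h₂ <;>
        simp only [next, hs] <;> (try split_ifs) <;>
        simp [Inside, DirectedPoint.rev, hs, h₂] <;> grind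
  | false =>
      obtain ⟨t, s, rfl, hs⟩ := hp.exists_above h
      obtain ⟨h₁, h₂⟩ := strands_of_getElem? h hs
      simp only [Inside] at hp
      cases s <;> simp only [Slice.pos, Slice.inputs, Slice.outputs] at h₁ h₂ <;>
        simp only [next, hs] <;> (try split_ifs) <;>
        simp [Inside, DirectedPoint.rev, hs, h₂] <;> grind

theorem next_injOn {w : Diagram} (h : IsTangle w 0 0) {p q : DirectedPoint} (hp : Inside w p)
    (hq : Inside w q) (e : next w p = next w q) : p = q := by
  rw [← p.rev_rev, ← (next_spec h hp).2.1, e, (next_spec h hq).2.1, q.rev_rev]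

theorem inside_iterate {w : Diagram} (h : IsTangle w 0 0) {p : DirectedPoint} (hp : Inside w p)
    (k : ℕ) : Inside w ((next w)^[k] p) := by
  induction k with
  | zero => exact hp
  | succ k ih => rw [Function.iterate_succ_apply']; exact (next_spec h ih).1

theorem iterate_injOn {w : Diagram} (h : IsTangle w 0 0) {p q : DirectedPoint} (hp : Inside w p)
    (hq : Inside w q) (k : ℕ) (e : (next w)^[k] p = (next w)^[k] q) : p = q := by
  induction k with
  | zero => exact e
  | succ k ih =>
      rw [Function.iterate_succ_apply', Function.iterate_succ_apply'] at e
      exact ih (next_injOn h (inside_iterate h hp k) (inside_iterate h hq k) e)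

theorem inside_rev {w : Diagram} {p : DirectedPoint} : Inside w p.rev ↔ Inside w p := Iff.rfl

theorem iterate_rev {w : Diagram} (h : IsTangle w 0 0) {p : DirectedPoint} (hp : Inside w p)
    (k : ℕ) : (next w)^[k] ((next w)^[k] p).rev = p.rev := by
  induction k generalizing p with
  | zero => rfl
  | succ k ih =>
      rw [Function.iterate_succ_apply, Function.iterate_succ_apply',
        ← Function.iterate_succ_apply' (next w) k p, Function.iterate_succ_apply,
        ← Function.iterate_succ_apply, Function.iterate_succ_apply', ih (next_spec h hp).1,
        (next_spec h hp).2.1]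

theorem finite_inside {w : Diagram} (h : IsTangle w 0 0) : {p | Inside w p}.Finite := by
  let M := (Finset.range w.length).sup (strands w 0)
  refine ((((Set.finite_Iio w.length).prod (Set.finite_Iio M)).prod
    (Set.finite_univ (α := Bool))).image fun x => ⟨x.1.1, x.1.2, x.2⟩).subset ?_
  rintro ⟨t, i, d⟩ hp
  have ht : t < w.length := by
    obtain ⟨s, hs⟩ := Inside.exists_below h hp
    exact (List.getElem?_eq_some_iff.1 hs).1
  refine ⟨⟨⟨t, i⟩, d⟩, ⟨⟨ht, Set.mem_Iio.2 (lt_of_lt_of_le hp ?_)⟩, trivial⟩, rfl⟩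
  exact Finset.le_sup (f := strands w 0) (Finset.mem_range.2 ht)

/-- An injective self-map of a finite set has only periodic points. -/
theorem exists_period {w : Diagram} (h : IsTangle w 0 0) {p : DirectedPoint} (hp : Inside w p) :
    ∃ k, (next w)^[k + 1] p = p := by
  have := (finite_inside h).to_subtype
  obtain ⟨a, b, hab, e⟩ := Finite.exists_ne_map_eq_of_infinite
    fun k : ℕ => (⟨(next w)^[k] p, inside_iterate h hp k⟩ : {p | Inside w p})
  have key : ∀ a b : ℕ, a < b → (next w)^[a] p = (next w)^[b] p → ∃ k, (next w)^[k + 1] p = p := by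
    intro a b hab e
    obtain ⟨c, rfl⟩ := Nat.exists_eq_add_of_lt hab
    refine ⟨c, (iterate_injOn h hp (inside_iterate h hp _) a ?_).symm⟩
    rw [e, ← Function.iterate_add_apply, Nat.add_assoc]
  rcases lt_or_gt_of_ne hab with hab | hab
  · exact key a b hab (congrArg Subtype.val e)
  · exact key b a hab (congrArg Subtype.val e).symm

/-- A path from `p` to its reversal would be its own reversal. At its middle there would be either a
point equal to its reversal or a step that reverses a point, and neither exists. -/
theorem iterate_ne_rev {w : Diagram} (h : IsTangle w 0 0) {p : DirectedPoint} (hp : Inside w p)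
    (k : ℕ) : (next w)^[k] p ≠ p.rev := by
  intro e
  obtain ⟨j, rfl | rfl⟩ := Nat.even_or_odd' k
  · rw [two_mul, Function.iterate_add_apply, ← iterate_rev h hp j] at e
    have hj := inside_iterate h hp j
    exact DirectedPoint.rev_ne _ (iterate_injOn h hj (inside_rev.2 hj) j e).symm
  · rw [show 2 * j + 1 = j + (1 + j) by ring, Function.iterate_add_apply,
      Function.iterate_add_apply, Function.iterate_one, ← iterate_rev h hp j] at e
    have hj := inside_iterate h hp j
    exact (next_spec h hj).2.2 (iterate_injOn h (next_spec h hj).1 (inside_rev.2 hj) j e)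

/-- A set of directed points that is a union of components of the link diagram `w`. -/
structure IsClosedUnion (w : Diagram) (O : DirectedPoint → Prop) : Prop where
  inside : ∀ p, O p → Inside w p
  next_iff : ∀ p, Inside w p → (O (next w p) ↔ O p)

theorem isClosedUnion_orbit {w : Diagram} (h : IsTangle w 0 0) {p₀ : DirectedPoint}
    (hp₀ : Inside w p₀) : IsClosedUnion w fun p => ∃ k, (next w)^[k] p₀ = p where
  inside := by
    rintro _ ⟨k, rfl⟩
    exact inside_iterate h hp₀ k
  next_iff p hp := by
    constructor
    · rintro ⟨k, hk⟩
      -- Membership passes backwards because going once around the component returns from `next w p`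
      -- to `p`.
      obtain ⟨N, hN⟩ := exists_period h hp
      refine ⟨N + k, ?_⟩
      rw [Function.iterate_add_apply, hk, ← Function.iterate_succ_apply, hN]
    · rintro ⟨k, rfl⟩
      exact ⟨k + 1, Function.iterate_succ_apply' _ _ _⟩

theorem inside_of_mark {w : Diagram} (h : IsTangle w 0 0) {t i : ℕ} {d d' : Bool} {c : Label}
    (ht : w[t]? = some (mark c d i)) : Inside w ⟨t, i, d'⟩ :=
  (strands_of_getElem? h ht).1

theorem isClosedUnion_onComponent {w : Diagram} (h : IsTangle w 0 0) (c : Label) :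
    IsClosedUnion w (OnComponent w c) where
  inside := by
    rintro p ⟨t, i, d, ht, hk⟩
    exact (isClosedUnion_orbit h (inside_of_mark h ht)).inside p hk
  next_iff p hp := by
    constructor
    · rintro ⟨t, i, d, ht, hk⟩
      exact ⟨t, i, d, ht, ((isClosedUnion_orbit h (inside_of_mark h ht)).next_iff p hp).1 hk⟩
    · rintro ⟨t, i, d, ht, hk⟩
      exact ⟨t, i, d, ht, ((isClosedUnion_orbit h (inside_of_mark h ht)).next_iff p hp).2 hk⟩

/-! ### Flows -/

/-- Signed strengths of the strands above and below a slice that are constant along the strands: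
`v i` is the strength with which the strand `i` is directed downwards. -/
def SliceFlow : Slice → (ℕ → ℤ) → (ℕ → ℤ) → Prop
  | cap j, v, u => (∀ i < j, u i = v i) ∧ u j + u (j + 1) = 0 ∧ ∀ i, j ≤ i → u (i + 2) = v i
  | cup j, v, u => (∀ i < j, u i = v i) ∧ v j + v (j + 1) = 0 ∧ ∀ i, j ≤ i → u i = v (i + 2)
  | cross _ j, v, u => u j = v (j + 1) ∧ u (j + 1) = v j ∧ ∀ i, i ≠ j → i ≠ j + 1 → u i = v i
  | mark _ _ _, v, u => u = v

/-- A flow on a diagram: `φ t i` is the strength of the strand `i` just above the slice `t`. -/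
def IsFlow (w : Diagram) (φ : ℕ → ℕ → ℤ) : Prop :=
  ∀ t s, w[t]? = some s → SliceFlow s (φ t) (φ (t + 1))

/-- The strength of a flow in the given direction. -/
def strength (φ : ℕ → ℕ → ℤ) (p : DirectedPoint) : ℤ :=
  (if p.down then 1 else -1) * φ p.level p.strand

theorem IsFlow.strength_next {w : Diagram} (h : IsTangle w 0 0) {φ : ℕ → ℕ → ℤ} (hφ : IsFlow w φ)
    {p : DirectedPoint} (hp : Inside w p) : strength φ (next w p) = strength φ p := by
  obtain ⟨t, i, d⟩ := p
  cases d with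
  | true =>
      obtain ⟨s, hs⟩ := hp.exists_below h
      have hf := hφ t s hs
      cases s <;> simp only [SliceFlow] at hf <;> simp only [next, hs] <;> (try split_ifs) <;>
        simp [strength] <;> grind
  | false =>
      obtain ⟨t, s, rfl, hs⟩ := hp.exists_above h
      have hf := hφ t s hs
      cases s <;> simp only [SliceFlow] at hf <;> simp only [next, hs] <;> (try split_ifs) <;>
        simp [strength] <;> grind

theorem IsFlow.strength_iterate {w : Diagram} (h : IsTangle w 0 0) {φ : ℕ → ℕ → ℤ}
    (hφ : IsFlow w φ) {p : DirectedPoint} (hp : Inside w p) (k : ℕ) :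
    strength φ ((next w)^[k] p) = strength φ p := by
  induction k with
  | zero => rfl
  | succ k ih =>
      rw [Function.iterate_succ_apply', hφ.strength_next h (inside_iterate h hp k), ih]

open scoped Classical in
/-- The flow of strength `1` along a union of components. -/
noncomputable def unitFlow (O : DirectedPoint → Prop) (t i : ℕ) : ℤ :=
  (if O ⟨t, i, true⟩ then 1 else 0) - (if O ⟨t, i, false⟩ then 1 else 0)

theorem direction_eq_unitFlow (w : Diagram) (c : Label) :
    direction w c = unitFlow (OnComponent w c) := rfl

theorem isFlow_unitFlow {w : Diagram} (h : IsTangle w 0 0) {O : DirectedPoint → Prop}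
    (hO : IsClosedUnion w O) : IsFlow w (unitFlow O) := by
  -- `SliceFlow` constrains all indices, including those that belong to no strand.
  have zero : ∀ t i, strands w 0 t ≤ i → unitFlow O t i = 0 := by
    intro t i hi
    have : ∀ d, ¬ O ⟨t, i, d⟩ := fun d ho => by
      have := hO.inside _ ho
      simp only [Inside] at this
      omega
    simp [unitFlow, this]
  have thru : ∀ t t' i i', i < strands w 0 t → i' < strands w 0 t' →
      next w ⟨t, i, true⟩ = ⟨t', i', true⟩ → next w ⟨t', i', false⟩ = ⟨t, i, false⟩ →
      unitFlow O t' i' = unitFlow O t i := by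
    intro t t' i i' hi hi' e e'
    have h₁ := hO.next_iff ⟨t, i, true⟩ hi
    have h₂ := hO.next_iff ⟨t', i', false⟩ hi'
    rw [e] at h₁
    rw [e'] at h₂
    rw [unitFlow, unitFlow, propext h₁, propext h₂]
  have turn : ∀ t i i' d, i < strands w 0 t → i' < strands w 0 t →
      next w ⟨t, i, d⟩ = ⟨t, i', !d⟩ → next w ⟨t, i', d⟩ = ⟨t, i, !d⟩ →
      unitFlow O t i + unitFlow O t i' = 0 := by
    intro t i i' d hi hi' e e'
    have h₁ := hO.next_iff ⟨t, i, d⟩ hi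
    have h₂ := hO.next_iff ⟨t, i', d⟩ hi'
    rw [e] at h₁
    rw [e'] at h₂
    cases d <;> simp only [Bool.not_true, Bool.not_false] at h₁ h₂ <;>
      rw [unitFlow, unitFlow, propext h₁, propext h₂] <;> ring
  intro t s hs
  obtain ⟨h₁, h₂⟩ := strands_of_getElem? h hs
  cases s with
  | cap j =>
      simp only [Slice.pos, Slice.inputs, Slice.outputs] at h₁ h₂
      refine ⟨fun i hi => ?_, ?_, fun i hi => ?_⟩
      · exact thru _ _ _ _ (by omega) (by omega) (by simp [next, hs, hi]) (by simp [next, hs, hi])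
      · exact turn _ _ _ false (by omega) (by omega) (by simp [next, hs]) (by simp [next, hs])
      · by_cases hi' : i < strands w 0 t
        · exact thru _ _ _ _ hi' (by omega) (by simp [next, hs]; omega)
            (by simp only [next, hs]; split_ifs <;> first | omega | simp)
        · rw [zero _ _ (by omega), zero _ _ (by omega)]
  | cup j =>
      simp only [Slice.pos, Slice.inputs, Slice.outputs] at h₁ h₂
      refine ⟨fun i hi => ?_, ?_, fun i hi => ?_⟩
      · exact thru _ _ _ _ (by omega) (by omega) (by simp [next, hs, hi]) (by simp [next, hs, hi])
      · exact turn _ _ _ true (by omega) (by omega) (by simp [next, hs]) (by simp [next, hs])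
      · by_cases hi' : i < strands w 0 (t + 1)
        · exact thru _ _ _ _ (by omega) hi'
            (by simp only [next, hs]; split_ifs <;> first | omega | simp)
            (by simp [next, hs]; omega)
        · rw [zero _ _ (by omega), zero _ _ (by omega)]
  | cross b j =>
      simp only [Slice.pos, Slice.inputs, Slice.outputs] at h₁ h₂
      refine ⟨?_, ?_, fun i hi hi' => ?_⟩
      · exact thru _ _ _ _ (by omega) (by omega) (by simp [next, hs]) (by simp [next, hs])
      · exact thru _ _ _ _ (by omega) (by omega) (by simp [next, hs]) (by simp [next, hs])
      · by_cases hi'' : i < strands w 0 t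
        · exact thru _ _ _ _ (by omega) (by omega) (by simp [next, hs, hi, hi'])
            (by simp [next, hs, hi, hi'])
        · rw [zero _ _ (by omega), zero _ _ (by omega)]
  | mark c d j =>
      simp only [Slice.pos, Slice.inputs, Slice.outputs] at h₁ h₂
      funext i
      by_cases hi : i < strands w 0 t
      · exact thru _ _ _ _ hi (by omega) (by simp [next, hs]) (by simp [next, hs])
      · rw [zero _ _ (by omega), zero _ _ (by omega)]

/-- The strength of a flow at the marks `c` is `z`. -/
def HasMarkStrength (w : Diagram) (φ : ℕ → ℕ → ℤ) (c : Label) (z : ℤ) : Prop :=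
  ∀ t d i, w[t]? = some (mark c d i) → strength φ ⟨t, i, d⟩ = z

/-! ### Separating marked components by flows -/

theorem IsFlow.strength_onComponent {w : Diagram} (h : IsTangle w 0 0) {φ : ℕ → ℕ → ℤ}
    (hφ : IsFlow w φ) {c : Label} {z : ℤ} (hz : HasMarkStrength w φ c z) {p : DirectedPoint}
    (hp : OnComponent w c p) : strength φ p = z := by
  obtain ⟨t, i, d, ht, k, rfl⟩ := hp
  rw [hφ.strength_iterate h (inside_of_mark h ht), hz t d i ht]

/-- A common strand would have strength `1` or `-1` by one component and `0` by the other. -/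
theorem IsFlow.distinct {w : Diagram} (h : IsTangle w 0 0) {φ : ℕ → ℕ → ℤ} (hφ : IsFlow w φ)
    {c c' : Label} (hc : HasMarkStrength w φ c 1) (hc' : HasMarkStrength w φ c' 0) (t i : ℕ)
    (d d' : Bool) (h₁ : OnComponent w c ⟨t, i, d⟩) : ¬ OnComponent w c' ⟨t, i, d'⟩ := by
  intro h₂
  have e₁ := hφ.strength_onComponent h hc h₁
  have e₂ := hφ.strength_onComponent h hc' h₂
  cases d <;> cases d' <;> simp [strength] at e₁ e₂ <;> omega

/-- A component of strength 1 cannot use a strand of strength 0. This is how an auxiliary flow,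
which need not be the component itself, confines the component. -/
theorem IsFlow.direction_eq_zero {w : Diagram} (h : IsTangle w 0 0) {φ : ℕ → ℕ → ℤ}
    (hφ : IsFlow w φ) {c : Label} (hc : HasMarkStrength w φ c 1) {t i : ℕ} (hz : φ t i = 0) :
    direction w c t i = 0 := by
  have : ∀ d, ¬ OnComponent w c ⟨t, i, d⟩ := fun d hd => by
    have := hφ.strength_onComponent h hc hd
    simp [strength, hz] at this
  simp [direction, this]

theorem IsFlow.hasMarkStrength_direction {w : Diagram} (h : IsTangle w 0 0) {φ : ℕ → ℕ → ℤ}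
    (hφ : IsFlow w φ) {c : Label} (hc : HasMarkStrength w φ c 1) :
    HasMarkStrength w (direction w c) c 1 := by
  intro t d i ht
  have h₁ : OnComponent w c ⟨t, i, d⟩ := ⟨t, i, d, ht, 0, rfl⟩
  -- Passing through the mark in both directions would give the strand strengths of both signs.
  have h₂ : ¬ OnComponent w c ⟨t, i, !d⟩ := fun h' => by
    have e₁ := hφ.strength_onComponent h hc h₁
    have e₂ := hφ.strength_onComponent h hc h'
    cases d <;> simp [strength] at e₁ e₂ <;> omega
  cases d <;> simp_all [strength, direction]

theorem IsFlow.hasMarkStrength_direction_zero {w : Diagram} (h : IsTangle w 0 0)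
    {φ : ℕ → ℕ → ℤ} (hφ : IsFlow w φ) {c c' : Label} (hc : HasMarkStrength w φ c 1)
    (hc' : HasMarkStrength w φ c' 0) : HasMarkStrength w (direction w c) c' 0 := by
  intro t d i ht
  have h₁ : OnComponent w c' ⟨t, i, d⟩ := ⟨t, i, d, ht, 0, rfl⟩
  have := hφ.strength_onComponent h hc' h₁
  have h₂ : direction w c t i = 0 := hφ.direction_eq_zero h hc (by
    cases d <;> simpa [strength] using this)
  simp [strength, h₂]

/-! ### Composition of flows -/

/-- Forget the first `a` entries of a sequence. -/
def dropFirst {α : Type*} (a : ℕ) (x : ℕ → α) (j : ℕ) : α := x (j + a)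

@[simp] theorem dropFirst_dropFirst {α : Type*} (a b : ℕ) (x : ℕ → α) :
    dropFirst a (dropFirst b x) = dropFirst (b + a) x := by
  funext j
  simp only [dropFirst]
  congr 1
  omega

@[simp] theorem dropFirst_zero {α : Type*} (x : ℕ → α) : dropFirst 0 x = x := rfl

/-- `φ` is a flow on `w` with the strengths `v` at the top and `u` at the bottom. -/
structure FlowBetween (w : Diagram) (φ : ℕ → ℕ → ℤ) (v u : ℕ → ℤ) : Prop where
  isFlow : IsFlow w φ
  top : φ 0 = v
  bottom : φ w.length = u

theorem IsFlow.flowBetween {w : Diagram} {φ : ℕ → ℕ → ℤ} (h : IsFlow w φ) :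
    FlowBetween w φ (φ 0) (φ w.length) := ⟨h, rfl, rfl⟩

theorem getElem?_append_cases (a b : Diagram) (t : ℕ) (s : Slice) :
    (a ++ b)[t]? = some s ↔ a[t]? = some s ∨ ∃ t', t = t' + a.length ∧ b[t']? = some s := by
  rcases lt_or_ge t a.length with ht | ht
  · rw [List.getElem?_append_left ht]
    exact ⟨Or.inl, fun h => h.resolve_right (by rintro ⟨t', e, -⟩; omega)⟩
  · rw [List.getElem?_append_right ht]
    constructor
    · exact fun h => Or.inr ⟨t - a.length, by omega, h⟩
    · rintro (h | ⟨t', rfl, h⟩)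
      · rw [List.getElem?_eq_none ht] at h
        cases h
      · simpa using h

theorem isFlow_append {a b : Diagram} {φ : ℕ → ℕ → ℤ} :
    IsFlow (a ++ b) φ ↔ IsFlow a φ ∧ IsFlow b (dropFirst a.length φ) := by
  constructor
  · refine fun h => ⟨fun t s hs => h t s ((getElem?_append_cases _ _ _ _).2 (.inl hs)),
      fun t s hs => ?_⟩
    have := h (t + a.length) s ((getElem?_append_cases _ _ _ _).2 (.inr ⟨t, rfl, hs⟩))
    rwa [Nat.add_right_comm] at this
  · rintro ⟨ha, hb⟩ t s hs
    rcases (getElem?_append_cases _ _ _ _).1 hs with hs' | ⟨t, rfl, hs'⟩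
    · exact ha t s hs'
    · have := hb t s hs'
      rwa [dropFirst, dropFirst, Nat.add_right_comm] at this

theorem hasMarkStrength_append {a b : Diagram} {φ : ℕ → ℕ → ℤ} {c : Label} {z : ℤ} :
    HasMarkStrength (a ++ b) φ c z ↔
      HasMarkStrength a φ c z ∧ HasMarkStrength b (dropFirst a.length φ) c z := by
  constructor
  · exact fun h => ⟨fun t d i hs => h t d i ((getElem?_append_cases _ _ _ _).2 (.inl hs)),
      fun t d i hs => h (t + a.length) d i ((getElem?_append_cases _ _ _ _).2 (.inr ⟨t, rfl, hs⟩))⟩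
  · rintro ⟨ha, hb⟩ t d i hs
    rcases (getElem?_append_cases _ _ _ _).1 hs with hs' | ⟨t, rfl, hs'⟩
    · exact ha t d i hs'
    · exact hb t d i hs'

theorem FlowBetween.append_iff {a b : Diagram} {φ : ℕ → ℕ → ℤ} {v u : ℕ → ℤ} :
    FlowBetween (a ++ b) φ v u ↔
      ∃ z, FlowBetween a φ v z ∧ FlowBetween b (dropFirst a.length φ) z u := by
  constructor
  · rintro ⟨h, rfl, rfl⟩
    rw [isFlow_append] at h
    refine ⟨φ a.length, ⟨h.1, rfl, rfl⟩, h.2, ?_, ?_⟩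
    · rw [dropFirst, Nat.zero_add]
    · rw [dropFirst, List.length_append, Nat.add_comm]
  · rintro ⟨z, h₁, h₂⟩
    refine ⟨isFlow_append.2 ⟨h₁.isFlow, h₂.isFlow⟩, h₁.top, ?_⟩
    rw [← h₂.bottom, dropFirst, List.length_append, Nat.add_comm]

theorem FlowBetween.exists_append {a b : Diagram} {φ ψ : ℕ → ℕ → ℤ} {v z u : ℕ → ℤ}
    (h₁ : FlowBetween a φ v z) (h₂ : FlowBetween b ψ z u) :
    ∃ χ, FlowBetween (a ++ b) χ v u ∧ χ a.length = z := by
  -- The level `a.length` belongs to both pieces; there both flows have the strengths `z`.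
  let χ : ℕ → ℕ → ℤ := fun t => if t ≤ a.length then φ t else ψ (t - a.length)
  have h₃ : dropFirst a.length χ = ψ := by
    funext t
    by_cases ht : t = 0
    · subst ht
      simp [χ, dropFirst, h₁.bottom, h₂.top]
    · simp [χ, dropFirst, ht]
  have h₄ : FlowBetween a χ v z := by
    refine ⟨fun t s hs => ?_, by simp [χ, h₁.top], by simp [χ, h₁.bottom]⟩
    have ht := (List.getElem?_eq_some_iff.1 hs).1
    simpa [χ, ht.le, Nat.succ_le_of_lt ht] using h₁.isFlow t s hs
  exact ⟨χ, append_iff.2 ⟨z, h₄, h₃.symm ▸ h₂⟩, h₄.bottom⟩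

theorem flowBetween_nil {φ : ℕ → ℕ → ℤ} {v u : ℕ → ℤ} (h : FlowBetween [] φ v u) : v = u :=
  h.top.symm.trans h.bottom

theorem exists_flowBetween_nil (v : ℕ → ℤ) : ∃ φ, FlowBetween [] φ v v :=
  ⟨fun _ => v, fun t s hs => by simp at hs, rfl, rfl⟩

theorem FlowBetween.slice {s : Slice} {φ : ℕ → ℕ → ℤ} {v u : ℕ → ℤ}
    (h : FlowBetween [s] φ v u) : SliceFlow s v u := by
  obtain ⟨h, rfl, rfl⟩ := h
  exact h 0 s rfl

theorem SliceFlow.exists_flowBetween {s : Slice} {v u : ℕ → ℤ} (h : SliceFlow s v u) :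
    ∃ φ, FlowBetween [s] φ v u := by
  refine ⟨fun t => if t = 0 then v else u, fun t s' hs => ?_, by simp, by simp⟩
  cases t with
  | zero =>
      simp only [List.getElem?_cons_zero, Option.some.injEq] at hs
      subst hs
      simpa using h
  | succ t => simp at hs

/-- The contribution of a slice to the intersection form of two flows. -/
def sliceForm : Slice → (ℕ → ℤ) → (ℕ → ℤ) → ℤ
  | cross b i, v, v' => (if b then 1 else -1) * (v i * v' (i + 1) + v' i * v (i + 1))
  | _, _, _ => 0

/-- The intersection form of two flows: the crossings are counted with the product of their signs
and the strengths of the flows. -/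
def flowForm (w : Diagram) (φ ψ : ℕ → ℕ → ℤ) : ℤ :=
  ∑ t ∈ Finset.range w.length, (w[t]?.elim 0 fun s => sliceForm s (φ t) (ψ t))

theorem linkingNumber_eq_flowForm (w : Diagram) (c c' : Label) :
    linkingNumber w c c' = (flowForm w (direction w c) (direction w c') : ℚ) / 2 := by
  rw [linkingNumber, flowForm]
  congr 2
  refine Finset.sum_congr rfl fun t _ => ?_
  rw [crossingSign]
  cases h : w[t]? with
  | none => rfl
  | some s => cases s <;> rfl

theorem flowForm_append (a b : Diagram) (φ ψ : ℕ → ℕ → ℤ) :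
    flowForm (a ++ b) φ ψ =
      flowForm a φ ψ + flowForm b (dropFirst a.length φ) (dropFirst a.length ψ) := by
  rw [flowForm, List.length_append, Finset.sum_range_add, flowForm, flowForm]
  congr 1
  · refine Finset.sum_congr rfl fun t ht => ?_
    rw [List.getElem?_append_left (Finset.mem_range.1 ht)]
  · refine Finset.sum_congr rfl fun t _ => ?_
    rw [List.getElem?_append_right (Nat.le_add_right _ _), Nat.add_sub_cancel_left, dropFirst,
      dropFirst, Nat.add_comm]

@[simp] theorem flowForm_nil (φ ψ : ℕ → ℕ → ℤ) : flowForm [] φ ψ = 0 := rfl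

theorem FlowBetween.flowForm_slice {s : Slice} {φ ψ : ℕ → ℕ → ℤ} {v u v' u' : ℕ → ℤ}
    (h : FlowBetween [s] φ v u) (h' : FlowBetween [s] ψ v' u') :
    flowForm [s] φ ψ = sliceForm s v v' := by
  simp [flowForm, h.top, h'.top]

/-! ### Flows on the diagrams of trees -/

/-- The sum of the strengths at the leaves. -/
def leafSum : TernaryTree → (ℕ → ℤ) → ℤ
  | leaf, x => x 0
  | node l m r, x => leafSum l x + leafSum m (dropFirst l.numLeaves x) +
      leafSum r (dropFirst (l.numLeaves + m.numLeaves) x)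

/-- The strengths at the leaves come from a flow: at every vertex the strengths of the left and the
right branch are opposite. -/
def Balanced : TernaryTree → (ℕ → ℤ) → Prop
  | leaf, _ => True
  | node l m r, x => Balanced l x ∧ Balanced m (dropFirst l.numLeaves x) ∧
      Balanced r (dropFirst (l.numLeaves + m.numLeaves) x) ∧
      leafSum l x + leafSum r (dropFirst (l.numLeaves + m.numLeaves) x) = 0

/-- The intersection form of the diagram of a tree, in terms of the strengths at the leaves. -/
def treeForm : TernaryTree → (ℕ → ℤ) → (ℕ → ℤ) → ℤ
  | leaf, _, _ => 0
  | node l m r, x, x' =>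
      leafSum m (dropFirst l.numLeaves x) * leafSum l x' +
        leafSum m (dropFirst l.numLeaves x') * leafSum l x +
      treeForm l x x' + treeForm m (dropFirst l.numLeaves x) (dropFirst l.numLeaves x') +
      treeForm r (dropFirst (l.numLeaves + m.numLeaves) x)
        (dropFirst (l.numLeaves + m.numLeaves) x')

/-- The edges with the mark `c` have the strength `z`. -/
def MarkedStrength : TernaryTree → (Address → Option Label) → Label → ℤ → (ℕ → ℤ) → Prop
  | leaf, μ, c, z, x => μ [] = some c → x 0 = z
  | node l m r, μ, c, z, x => (μ [] = some c → leafSum (node l m r) x = z) ∧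
      MarkedStrength l (fun α => μ (0 :: α)) c z x ∧
      MarkedStrength m (fun α => μ (1 :: α)) c z (dropFirst l.numLeaves x) ∧
      MarkedStrength r (fun α => μ (2 :: α)) c z (dropFirst (l.numLeaves + m.numLeaves) x)

/-- The strengths `v` at the root and `u` at the leaves of a tree with root in the strand `i`. -/
structure RootLeaves (T : TernaryTree) (i : ℕ) (v u : ℕ → ℤ) : Prop where
  left : ∀ j < i, v j = u j
  root : v i = leafSum T (dropFirst i u)
  right : dropFirst (i + 1) v = dropFirst (i + T.numLeaves) u

/-- The strengths at the three children of a vertex in the strand `i`. -/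
structure Children (l m r : TernaryTree) (i : ℕ) (y u : ℕ → ℤ) : Prop where
  left : ∀ j < i, y j = u j
  child₀ : y i = leafSum l (dropFirst i u)
  child₁ : y (i + 1) = leafSum m (dropFirst (i + l.numLeaves) u)
  child₂ : y (i + 2) = leafSum r (dropFirst (i + (l.numLeaves + m.numLeaves)) u)
  right : dropFirst (i + 3) y = dropFirst (i + (node l m r).numLeaves) u

theorem RootLeaves.dropFirst_right {T : TernaryTree} {i : ℕ} {v u : ℕ → ℤ} (h : RootLeaves T i v u)
    (a : ℕ) : dropFirst (i + 1 + a) v = dropFirst (i + T.numLeaves + a) u := by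
  rw [← dropFirst_dropFirst, h.right, dropFirst_dropFirst]

/-- The strengths `y`, `y₁`, `y₂`, `u` occur before and between the expansions of the right, middle
and left subtrees. An expansion leaves everything to its left alone and only shifts everything to
its right. -/
theorem Children.of_rootLeaves {l m r : TernaryTree} {i : ℕ} {y y₁ y₂ u : ℕ → ℤ}
    (hr : RootLeaves r (i + 2) y y₁) (hm : RootLeaves m (i + 1) y₁ y₂) (hl : RootLeaves l i y₂ u) :
    dropFirst (i + 1) y₂ = dropFirst (i + l.numLeaves) u ∧
      dropFirst (i + 2) y₁ = dropFirst (i + (l.numLeaves + m.numLeaves)) u ∧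
      Children l m r i y u := by
  have e₂ := hl.right
  have e₁ : dropFirst (i + 2) y₁ = dropFirst (i + (l.numLeaves + m.numLeaves)) u := by
    have := hm.right
    rw [show i + 1 + 1 = i + 2 from rfl] at this
    rw [this, hl.dropFirst_right, Nat.add_assoc]
  refine ⟨e₂, e₁, fun j hj => ?_, ?_, ?_, ?_, ?_⟩
  · rw [hr.left j (by omega), hm.left j (by omega), hl.left j hj]
  · rw [hr.left i (by omega), hm.left i (by omega), hl.root]
  · rw [hr.left (i + 1) (by omega), hm.root, e₂]
  · rw [hr.root, e₁]
  · have := hr.right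
    rw [show i + 2 + 1 = i + 3 from rfl] at this
    rw [this, ← dropFirst_dropFirst, e₁, dropFirst_dropFirst]
    simp only [numLeaves, Nat.add_assoc]

/-- The strengths near a vertex: `v` above, `z` between the local maximum and the crossing, and `y`
below, in the diagram of an upper tree. -/
structure VertexFlow (i : ℕ) (v z y : ℕ → ℤ) : Prop where
  left : ∀ j < i, v j = y j
  root : v i = y (i + 1)
  sides : y i + y (i + 2) = 0
  right : dropFirst (i + 1) v = dropFirst (i + 3) y
  mid₀ : z i = y (i + 1)
  mid₁ : z (i + 1) = y i

theorem vertexFlow_upper {i : ℕ} {b : Bool} {v z y : ℕ → ℤ} (h₁ : SliceFlow (cap (i + 1)) v z)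
    (h₂ : SliceFlow (cross b i) z y) : VertexFlow i v z y := by
  obtain ⟨a₁, a₂, a₃⟩ := h₁
  obtain ⟨b₁, b₂, b₃⟩ := h₂
  refine ⟨fun j hj => ?_, ?_, ?_, ?_, ?_, ?_⟩
  · rw [b₃ j (by omega) (by omega), a₁ j (by omega)]
  · rw [b₂, a₁ i (by omega)]
  · rw [b₁, b₃ (i + 2) (by omega) (by omega)]
    exact a₂
  · funext j
    rw [dropFirst, dropFirst, b₃ _ (by omega) (by omega), ← a₃ _ (by omega)]
    congr 1
  · exact b₂.symm
  · exact b₁.symm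

/-- Flow conditions are symmetric under turning a slice upside down, so this is the upper case read
backwards. -/
theorem vertexFlow_lower {i : ℕ} {b : Bool} {v z y : ℕ → ℤ} (h₁ : SliceFlow (cup (i + 1)) z v)
    (h₂ : SliceFlow (cross b i) y z) : VertexFlow i v z y := by
  obtain ⟨a₁, a₂, a₃⟩ := h₁
  obtain ⟨b₁, b₂, b₃⟩ := h₂
  refine vertexFlow_upper (b := b) ⟨fun j hj => (a₁ j hj).symm, a₂, fun j hj => (a₃ j hj).symm⟩
    ⟨b₂.symm, b₁.symm, fun j hj hj' => (b₃ j hj hj').symm⟩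

theorem exists_vertexFlow (i : ℕ) (b : Bool) {y : ℕ → ℤ} (h : y i + y (i + 2) = 0) :
    ∃ v z, (SliceFlow (cap (i + 1)) v z ∧ SliceFlow (cross b i) z y) ∧
      SliceFlow (cross b i) y z ∧ SliceFlow (cup (i + 1)) z v := by
  let z : ℕ → ℤ := fun j => if j = i then y (i + 1) else if j = i + 1 then y i else y j
  let v : ℕ → ℤ := fun j => if j < i + 1 then z j else z (j + 2)
  have e₁ : z i = y (i + 1) := by simp [z]
  have e₂ : z (i + 1) = y i := by simp [z]
  have e₃ : ∀ j, j ≠ i → j ≠ i + 1 → z j = y j := fun j h₁ h₂ => by simp [z, h₁, h₂]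
  have e₄ : z (i + 1) + z (i + 1 + 1) = 0 := by
    rw [e₂, e₃ (i + 1 + 1) (by omega) (by omega)]
    exact h
  have e₅ : ∀ j < i + 1, z j = v j := fun j hj => by simp only [v, if_pos hj]
  have e₆ : ∀ j, i + 1 ≤ j → z (j + 2) = v j := fun j hj => by
    simp only [v, if_neg (Nat.not_lt.2 hj)]
  exact ⟨v, z, ⟨⟨e₅, e₄, e₆⟩, e₂.symm, e₁.symm, fun j h₁ h₂ => (e₃ j h₁ h₂).symm⟩,
    ⟨e₁, e₂, e₃⟩, fun j hj => (e₅ j hj).symm, e₄, fun j hj => (e₆ j hj).symm⟩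

/-- The root strand continues to the middle child, and the left and right children cancel, so the
root carries the total over all leaves. -/
theorem RootLeaves.of_children {l m r : TernaryTree} {i : ℕ} {v z y u : ℕ → ℤ}
    (h : VertexFlow i v z y) (h' : Children l m r i y u) : RootLeaves (node l m r) i v u where
  left j hj := (h.left j hj).trans (h'.left j hj)
  root := by
    have := h.sides
    rw [h'.child₀, h'.child₂] at this
    rw [h.root, h'.child₁]
    simp only [leafSum, dropFirst_dropFirst]
    linarith
  right := h.right.trans h'.right

theorem RootLeaves.leaf (i : ℕ) (v : ℕ → ℤ) : RootLeaves leaf i v v where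
  left _ _ := rfl
  root := by simp [leafSum, dropFirst]
  right := rfl

theorem flowBetween_marks {o : Option Label} {i : ℕ} {φ : ℕ → ℕ → ℤ} {v u : ℕ → ℤ}
    (h : FlowBetween (o.toList.map fun c => mark c true i) φ v u) : v = u ∧
      ∀ c z, HasMarkStrength (o.toList.map fun c => mark c true i) φ c z ↔ (o = some c → v i = z) := by
  cases o with
  | none => exact ⟨flowBetween_nil h, fun c z => by simp [HasMarkStrength]⟩
  | some c =>
      refine ⟨(FlowBetween.slice h).symm, fun c' z => ?_⟩
      rw [← h.top]
      constructor
      · intro h' e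
        cases e
        simpa [strength] using h' 0 true i rfl
      · intro h' t d j hs
        cases t with
        | zero =>
            simp only [Option.toList_some, List.map_cons, List.map_nil, List.getElem?_cons_zero,
              Option.some.injEq, mark.injEq] at hs
            obtain ⟨rfl, rfl, rfl⟩ := hs
            simpa [strength] using h' rfl
        | succ t => simp at hs

theorem flowForm_marks (o : Option Label) (i : ℕ) (φ ψ : ℕ → ℕ → ℤ) :
    flowForm (o.toList.map fun c => mark c true i) φ ψ = 0 := by
  cases o <;> simp [flowForm, sliceForm]

theorem exists_flowBetween_marks (o : Option Label) (i : ℕ) (v : ℕ → ℤ) :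
    ∃ φ, FlowBetween (o.toList.map fun c => mark c true i) φ v v := by
  cases o with
  | none => exact exists_flowBetween_nil v
  | some c => exact SliceFlow.exists_flowBetween (s := mark c true i) rfl

theorem hasMarkStrength_of_forall {w : Diagram} (h : ∀ c d i, mark c d i ∉ w) (φ : ℕ → ℕ → ℤ)
    (c : Label) (z : ℤ) : HasMarkStrength w φ c z :=
  fun _ d i hs => (h c d i (List.mem_of_getElem? hs)).elim

/-- The leaf strengths determine the flow on the tree, including the conditions at its marks; the
cancelling arcs at the vertices are the only constraints on them. -/
theorem flowBetween_upperDiagram {T : TernaryTree} {μ : Address → Option Label} {i : ℕ}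
    {φ : ℕ → ℕ → ℤ} {v u : ℕ → ℤ} (h : FlowBetween (upperDiagram T μ i) φ v u) :
    RootLeaves T i v u ∧ Balanced T (dropFirst i u) ∧
      ∀ c z, HasMarkStrength (upperDiagram T μ i) φ c z ↔ MarkedStrength T μ c z (dropFirst i u) := by
  induction T generalizing μ i φ v u with
  | leaf =>
      obtain ⟨rfl, hmark⟩ := flowBetween_marks h
      refine ⟨.leaf i v, trivial, fun c z => ?_⟩
      rw [upperDiagram, hmark, MarkedStrength, dropFirst, Nat.zero_add]
  | node l m r ihl ihm ihr =>
      simp only [upperDiagram] at h ⊢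
      obtain ⟨y₂, h, hl⟩ := FlowBetween.append_iff.1 h
      obtain ⟨y₁, h, hm⟩ := FlowBetween.append_iff.1 h
      obtain ⟨y, h, hr⟩ := FlowBetween.append_iff.1 h
      obtain ⟨v₁, h, hv⟩ := FlowBetween.append_iff.1 h
      rw [← List.singleton_append] at hv
      obtain ⟨z, hc, hx⟩ := FlowBetween.append_iff.1 hv
      obtain ⟨rfl, hmark⟩ := flowBetween_marks h
      obtain ⟨rl, bl, ml⟩ := ihl hl
      obtain ⟨rm, bm, mm⟩ := ihm hm
      obtain ⟨rr, br, mr⟩ := ihr hr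
      obtain ⟨e₂, e₁, hch⟩ := Children.of_rootLeaves rr rm rl
      have hv := vertexFlow_upper hc.slice hx.slice
      have hroot := RootLeaves.of_children hv hch
      refine ⟨hroot, ?_, fun c w => ?_⟩
      · rw [e₂] at bm
        rw [e₁] at br
        refine ⟨bl, by rwa [dropFirst_dropFirst], by rwa [dropFirst_dropFirst], ?_⟩
        have := hv.sides
        rwa [hch.child₀, hch.child₂, ← dropFirst_dropFirst] at this
      · have hno : HasMarkStrength [cap (i + 1), cross true i] (dropFirst
          ((μ []).toList.map fun c => mark c true i).length φ) c w :=
          hasMarkStrength_of_forall (by simp) _ _ _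
        simp only [hasMarkStrength_append, hmark, hno, ml, mm, mr, MarkedStrength, e₁, e₂,
          dropFirst_dropFirst, hroot.root]
        tauto

/-- Each vertex has one crossing, between the arc from the left child and the strand to the middle
child, which gives the products of left and middle leaf sums in `treeForm`. Its sign is positive
here and negative in lower trees. -/
theorem flowForm_upperDiagram {T : TernaryTree} {μ : Address → Option Label} {i : ℕ}
    {φ ψ : ℕ → ℕ → ℤ} {v u v' u' : ℕ → ℤ} (h : FlowBetween (upperDiagram T μ i) φ v u)
    (h' : FlowBetween (upperDiagram T μ i) ψ v' u') :
    flowForm (upperDiagram T μ i) φ ψ = treeForm T (dropFirst i u) (dropFirst i u') := by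
  induction T generalizing μ i φ ψ v u v' u' with
  | leaf => rw [upperDiagram, flowForm_marks, treeForm]
  | node l m r ihl ihm ihr =>
      simp only [upperDiagram] at h h' ⊢
      obtain ⟨y₂, h, hl⟩ := FlowBetween.append_iff.1 h
      obtain ⟨y₁, h, hm⟩ := FlowBetween.append_iff.1 h
      obtain ⟨y, h, hr⟩ := FlowBetween.append_iff.1 h
      obtain ⟨v₁, h, hv⟩ := FlowBetween.append_iff.1 h
      rw [← List.singleton_append] at hv
      obtain ⟨z, hc, hx⟩ := FlowBetween.append_iff.1 hv
      obtain ⟨y₂', h', hl'⟩ := FlowBetween.append_iff.1 h'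
      obtain ⟨y₁', h', hm'⟩ := FlowBetween.append_iff.1 h'
      obtain ⟨y', h', hr'⟩ := FlowBetween.append_iff.1 h'
      obtain ⟨v₁', h', hv'⟩ := FlowBetween.append_iff.1 h'
      rw [← List.singleton_append] at hv'
      obtain ⟨z', hc', hx'⟩ := FlowBetween.append_iff.1 hv'
      obtain ⟨e₂, e₁, hch⟩ := Children.of_rootLeaves (flowBetween_upperDiagram hr).1
        (flowBetween_upperDiagram hm).1 (flowBetween_upperDiagram hl).1
      obtain ⟨e₂', e₁', hch'⟩ := Children.of_rootLeaves (flowBetween_upperDiagram hr').1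
        (flowBetween_upperDiagram hm').1 (flowBetween_upperDiagram hl').1
      have hv := vertexFlow_upper hc.slice hx.slice
      have hv' := vertexFlow_upper hc'.slice hx'.slice
      rw [show [cap (i + 1), cross true i] = [cap (i + 1)] ++ [cross true i] from rfl] at *
      simp only [flowForm_append, flowForm_marks, ihl hl hl', ihm hm hm', ihr hr hr',
        hc.flowForm_slice hc', hx.flowForm_slice hx', sliceForm, hv.mid₀, hv.mid₁, hv'.mid₀,
        hv'.mid₁, hch.child₀, hch.child₁, hch'.child₀, hch'.child₁, e₁, e₂, e₁', e₂', if_true]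
      simp only [treeForm, dropFirst_dropFirst]
      ring

theorem exists_flowBetween_upperDiagram (T : TernaryTree) (μ : Address → Option Label) (i : ℕ)
    {u : ℕ → ℤ} (h : Balanced T (dropFirst i u)) :
    ∃ φ v, FlowBetween (upperDiagram T μ i) φ v u := by
  induction T generalizing μ i u with
  | leaf =>
      obtain ⟨φ, hφ⟩ := exists_flowBetween_marks (μ []) i u
      exact ⟨φ, u, hφ⟩
  | node l m r ihl ihm ihr =>
      obtain ⟨bl, bm, br, hs⟩ := h
      simp only [dropFirst_dropFirst] at bm br hs
      obtain ⟨φl, y₂, hl⟩ := ihl (fun α => μ (0 :: α)) i bl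
      have rl := (flowBetween_upperDiagram hl).1
      obtain ⟨φm, y₁, hm⟩ := ihm (fun α => μ (1 :: α)) (i + 1) (u := y₂) (by rwa [rl.right])
      have rm := (flowBetween_upperDiagram hm).1
      have e₁ : dropFirst (i + 2) y₁ = dropFirst (i + (l.numLeaves + m.numLeaves)) u := by
        have := rm.right
        rw [show i + 1 + 1 = i + 2 from rfl] at this
        rw [this, rl.dropFirst_right, Nat.add_assoc]
      obtain ⟨φr, y, hr⟩ := ihr (fun α => μ (2 :: α)) (i + 2) (u := y₁) (by rwa [e₁])
      obtain ⟨-, -, hch⟩ := Children.of_rootLeaves (flowBetween_upperDiagram hr).1 rm rl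
      obtain ⟨v, z, ⟨hc, hx⟩, -⟩ := exists_vertexFlow i true (y := y) (by
        rw [hch.child₀, hch.child₂, hs])
      obtain ⟨φ₀, h₀⟩ := exists_flowBetween_marks (μ []) i v
      obtain ⟨φ₁, h₁⟩ := hc.exists_flowBetween
      obtain ⟨φ₂, h₂⟩ := hx.exists_flowBetween
      obtain ⟨φ₃, h₃, -⟩ := h₁.exists_append h₂
      obtain ⟨φ₄, h₄, -⟩ := h₀.exists_append h₃
      obtain ⟨φ₅, h₅, -⟩ := h₄.exists_append hr
      obtain ⟨φ₆, h₆, -⟩ := h₅.exists_append hm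
      obtain ⟨φ₇, h₇, -⟩ := h₆.exists_append hl
      exact ⟨φ₇, v, h₇⟩

theorem mark_notMem_lowerDiagram (T : TernaryTree) (i : ℕ) (c : Label) (d : Bool) (j : ℕ) :
    mark c d j ∉ lowerDiagram T i := by
  induction T generalizing i with
  | leaf => simp [lowerDiagram]
  | node l m r ihl ihm ihr => simp [lowerDiagram, ihl, ihm, ihr]

theorem flowBetween_lowerDiagram {T : TernaryTree} {i : ℕ} {φ : ℕ → ℕ → ℤ} {v u : ℕ → ℤ}
    (h : FlowBetween (lowerDiagram T i) φ u v) :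
    RootLeaves T i v u ∧ Balanced T (dropFirst i u) := by
  induction T generalizing i φ v u with
  | leaf =>
      obtain rfl := flowBetween_nil h
      exact ⟨.leaf i u, trivial⟩
  | node l m r ihl ihm ihr =>
      simp only [lowerDiagram] at h
      obtain ⟨y, h, hv⟩ := FlowBetween.append_iff.1 h
      obtain ⟨y₁, h, hr⟩ := FlowBetween.append_iff.1 h
      obtain ⟨y₂, hl, hm⟩ := FlowBetween.append_iff.1 h
      rw [← List.singleton_append] at hv
      obtain ⟨z, hx, hc⟩ := FlowBetween.append_iff.1 hv
      obtain ⟨rl, bl⟩ := ihl hl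
      obtain ⟨rm, bm⟩ := ihm hm
      obtain ⟨rr, br⟩ := ihr hr
      obtain ⟨e₂, e₁, hch⟩ := Children.of_rootLeaves rr rm rl
      have hv := vertexFlow_lower hc.slice hx.slice
      refine ⟨RootLeaves.of_children hv hch, ?_⟩
      rw [e₂] at bm
      rw [e₁] at br
      refine ⟨bl, by rwa [dropFirst_dropFirst], by rwa [dropFirst_dropFirst], ?_⟩
      have := hv.sides
      rwa [hch.child₀, hch.child₂, ← dropFirst_dropFirst] at this

theorem flowForm_lowerDiagram {T : TernaryTree} {i : ℕ} {φ ψ : ℕ → ℕ → ℤ} {v u v' u' : ℕ → ℤ}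
    (h : FlowBetween (lowerDiagram T i) φ u v) (h' : FlowBetween (lowerDiagram T i) ψ u' v') :
    flowForm (lowerDiagram T i) φ ψ = -treeForm T (dropFirst i u) (dropFirst i u') := by
  induction T generalizing i φ ψ v u v' u' with
  | leaf => simp [lowerDiagram, treeForm]
  | node l m r ihl ihm ihr =>
      simp only [lowerDiagram] at h h' ⊢
      obtain ⟨y, h, hv⟩ := FlowBetween.append_iff.1 h
      obtain ⟨y₁, h, hr⟩ := FlowBetween.append_iff.1 h
      obtain ⟨y₂, hl, hm⟩ := FlowBetween.append_iff.1 h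
      rw [← List.singleton_append] at hv
      obtain ⟨z, hx, hc⟩ := FlowBetween.append_iff.1 hv
      obtain ⟨y', h', hv'⟩ := FlowBetween.append_iff.1 h'
      obtain ⟨y₁', h', hr'⟩ := FlowBetween.append_iff.1 h'
      obtain ⟨y₂', hl', hm'⟩ := FlowBetween.append_iff.1 h'
      rw [← List.singleton_append] at hv'
      obtain ⟨z', hx', hc'⟩ := FlowBetween.append_iff.1 hv'
      obtain ⟨e₂, e₁, hch⟩ := Children.of_rootLeaves (flowBetween_lowerDiagram hr).1
        (flowBetween_lowerDiagram hm).1 (flowBetween_lowerDiagram hl).1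
      obtain ⟨e₂', e₁', hch'⟩ := Children.of_rootLeaves (flowBetween_lowerDiagram hr').1
        (flowBetween_lowerDiagram hm').1 (flowBetween_lowerDiagram hl').1
      rw [show [cross false i, cup (i + 1)] = [cross false i] ++ [cup (i + 1)] from rfl] at *
      simp only [flowForm_append, ihl hl hl', ihm hm hm', ihr hr hr',
        hc.flowForm_slice hc', hx.flowForm_slice hx', sliceForm,
        hch.child₀, hch.child₁, hch'.child₀, hch'.child₁, e₁, e₂, e₁', e₂',
        Bool.false_eq_true, if_false]
      simp only [treeForm, dropFirst_dropFirst]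
      ring

theorem exists_flowBetween_lowerDiagram (T : TernaryTree) (i : ℕ) {u : ℕ → ℤ}
    (h : Balanced T (dropFirst i u)) : ∃ φ v, FlowBetween (lowerDiagram T i) φ u v := by
  induction T generalizing i u with
  | leaf =>
      obtain ⟨φ, hφ⟩ := exists_flowBetween_nil u
      exact ⟨φ, u, hφ⟩
  | node l m r ihl ihm ihr =>
      obtain ⟨bl, bm, br, hs⟩ := h
      simp only [dropFirst_dropFirst] at bm br hs
      obtain ⟨φl, y₂, hl⟩ := ihl i bl
      have rl := (flowBetween_lowerDiagram hl).1
      obtain ⟨φm, y₁, hm⟩ := ihm (i + 1) (u := y₂) (by rwa [rl.right])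
      have rm := (flowBetween_lowerDiagram hm).1
      have e₁ : dropFirst (i + 2) y₁ = dropFirst (i + (l.numLeaves + m.numLeaves)) u := by
        have := rm.right
        rw [show i + 1 + 1 = i + 2 from rfl] at this
        rw [this, rl.dropFirst_right, Nat.add_assoc]
      obtain ⟨φr, y, hr⟩ := ihr (i + 2) (u := y₁) (by rwa [e₁])
      obtain ⟨-, -, hch⟩ := Children.of_rootLeaves (flowBetween_lowerDiagram hr).1 rm rl
      obtain ⟨v, z, -, hx, hc⟩ := exists_vertexFlow i false (y := y) (by
        rw [hch.child₀, hch.child₂, hs])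
      obtain ⟨φ₁, h₁⟩ := hx.exists_flowBetween
      obtain ⟨φ₂, h₂⟩ := hc.exists_flowBetween
      obtain ⟨φ₃, h₃, -⟩ := h₁.exists_append h₂
      obtain ⟨φ₄, h₄, -⟩ := hl.exists_append hm
      obtain ⟨φ₅, h₅, -⟩ := h₄.exists_append hr
      obtain ⟨φ₆, h₆, -⟩ := h₅.exists_append h₃
      exact ⟨φ₆, v, h₆⟩

/-! ### Strengths at the leaves -/

/-- The sum does not see the shape of the tree, so both trees of an element have the same strength
at their roots. -/
theorem leafSum_eq_sum (T : TernaryTree) (x : ℕ → ℤ) :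
    leafSum T x = ∑ j ∈ Finset.range T.numLeaves, x j := by
  induction T generalizing x with
  | leaf => simp [leafSum, numLeaves]
  | node l m r hl hm hr =>
      simp only [leafSum, numLeaves, hl, hm, hr, Finset.sum_range_add, dropFirst, Nat.add_comm]

theorem leafSum_congr {T : TernaryTree} {x y : ℕ → ℤ} (h : ∀ j < T.numLeaves, x j = y j) :
    leafSum T x = leafSum T y := by
  rw [leafSum_eq_sum, leafSum_eq_sum]
  exact Finset.sum_congr rfl fun j hj => h j (Finset.mem_range.1 hj)

theorem leafSum_eq_zero {T : TernaryTree} {x : ℕ → ℤ} (h : ∀ j < T.numLeaves, x j = 0) :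
    leafSum T x = 0 := by
  rw [leafSum_eq_sum]
  exact Finset.sum_eq_zero fun j hj => h j (Finset.mem_range.1 hj)

theorem Balanced.congr {T : TernaryTree} {x y : ℕ → ℤ} (h : ∀ j < T.numLeaves, x j = y j)
    (hx : Balanced T x) : Balanced T y := by
  induction T generalizing x y with
  | leaf => trivial
  | node l m r hl hm hr =>
      simp only [numLeaves] at h
      have h₀ : ∀ j < l.numLeaves, x j = y j := fun j hj => h j (by omega)
      have h₁ : ∀ j < m.numLeaves, dropFirst l.numLeaves x j = dropFirst l.numLeaves y j :=
        fun j hj => h _ (by omega)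
      have h₂ : ∀ j < r.numLeaves, dropFirst (l.numLeaves + m.numLeaves) x j =
          dropFirst (l.numLeaves + m.numLeaves) y j := fun j hj => h _ (by omega)
      obtain ⟨b₀, b₁, b₂, e⟩ := hx
      exact ⟨hl h₀ b₀, hm h₁ b₁, hr h₂ b₂, by rwa [← leafSum_congr h₀, ← leafSum_congr h₂]⟩

theorem balanced_of_eq_zero {T : TernaryTree} {x : ℕ → ℤ} (h : ∀ j, x j = 0) : Balanced T x := by
  induction T generalizing x with
  | leaf => trivial
  | node l m r hl hm hr =>
      have h' : ∀ a j, dropFirst a x j = 0 := fun a j => h _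
      refine ⟨hl h, hm (h' _), hr (h' _), ?_⟩
      rw [leafSum_eq_zero fun j _ => h j, leafSum_eq_zero fun j _ => h' _ j, add_zero]

theorem treeForm_comm (T : TernaryTree) (x y : ℕ → ℤ) : treeForm T x y = treeForm T y x := by
  induction T generalizing x y with
  | leaf => rfl
  | node l m r hl hm hr => simp only [treeForm, hl x, hm (dropFirst _ x), hr (dropFirst _ x)]; ring

theorem treeForm_eq_zero {T : TernaryTree} {x y : ℕ → ℤ} (h : ∀ j < T.numLeaves, x j = 0) :
    treeForm T x y = 0 := by
  induction T generalizing x y with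
  | leaf => rfl
  | node l m r hl hm hr =>
      simp only [numLeaves] at h
      have h₀ : ∀ j < l.numLeaves, x j = 0 := fun j hj => h j (by omega)
      have h₁ : ∀ j < m.numLeaves, dropFirst l.numLeaves x j = 0 := fun j hj => h _ (by omega)
      have h₂ : ∀ j < r.numLeaves, dropFirst (l.numLeaves + m.numLeaves) x j = 0 :=
        fun j hj => h _ (by omega)
      simp only [treeForm, hl h₀, hm h₁, hr h₂, leafSum_eq_zero h₀, leafSum_eq_zero h₁]
      ring

theorem markedStrength_none (T : TernaryTree) (c : Label) (z : ℤ) (x : ℕ → ℤ) :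
    MarkedStrength T (fun _ => none) c z x := by
  induction T generalizing x with
  | leaf => simp [MarkedStrength]
  | node l m r hl hm hr => simp [MarkedStrength, hl, hm, hr]

theorem markedStrength_markRoot (T : TernaryTree) (c₀ c : Label) (z : ℤ) (x : ℕ → ℤ) :
    MarkedStrength T (markRoot c₀) c z x ↔ (c₀ = c → leafSum T x = z) := by
  cases T with
  | leaf => simp [MarkedStrength, markRoot, leafSum]
  | node l m r => simp [MarkedStrength, markRoot, markedStrength_none]

/-! ### Flows on the link of an element -/

/-- The strengths at the leaves of `f` come from a flow on the diagram of `𝓛(f)`. -/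
structure Admissible (f : F3) (x : ℕ → ℤ) : Prop where
  upper : Balanced f.upper x
  lower : Balanced f.lower x

theorem leafSum_lower (f : F3) (x : ℕ → ℤ) : leafSum f.lower x = leafSum f.upper x := by
  rw [leafSum_eq_sum, leafSum_eq_sum, f.numLeaves_eq]

/-- The strengths of a flow on the link of `f` at the leaves. -/
def leafStrengths (f : F3) (μ : Address → Option Label) (φ : ℕ → ℕ → ℤ) : ℕ → ℤ :=
  dropFirst 1 (φ ([cap 0] ++ upperDiagram f.upper μ 1).length)

theorem linkDiagram_eq (f : F3) (μ : Address → Option Label) :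
    linkDiagram f μ =
      ([cap 0] ++ upperDiagram f.upper μ 1) ++ (lowerDiagram f.lower 1 ++ [cup 0]) := by
  simp [linkDiagram, openDiagram]

theorem IsFlow.leafStrengths {f : F3} {μ : Address → Option Label} {φ : ℕ → ℕ → ℤ}
    (hφ : IsFlow (linkDiagram f μ) φ) : Admissible f (leafStrengths f μ φ) ∧
      φ 1 1 = leafSum f.upper (leafStrengths f μ φ) ∧
      ∀ c z, HasMarkStrength (linkDiagram f μ) φ c z ↔
        MarkedStrength f.upper μ c z (leafStrengths f μ φ) := by
  have h := hφ.flowBetween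
  rw [linkDiagram_eq] at h ⊢
  obtain ⟨u, h₁, h₂⟩ := FlowBetween.append_iff.1 h
  have hu : ThompsonLink.leafStrengths f μ φ = dropFirst 1 u := by
    rw [ThompsonLink.leafStrengths, h₁.bottom]
  obtain ⟨v, h₃, h₄⟩ := FlowBetween.append_iff.1 h₁
  obtain ⟨v', h₅, h₆⟩ := FlowBetween.append_iff.1 h₂
  obtain ⟨r, b, hm⟩ := flowBetween_upperDiagram h₄
  obtain ⟨-, b'⟩ := flowBetween_lowerDiagram h₅
  rw [hu]
  refine ⟨⟨b, b'⟩, ?_, fun c z => ?_⟩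
  · rw [← r.root, ← h₃.bottom]
    rfl
  · have n₁ : HasMarkStrength [cap 0] φ c z := hasMarkStrength_of_forall (by simp) _ _ _
    have n₂ := hasMarkStrength_of_forall (w := lowerDiagram f.lower 1 ++ [cup 0])
      (by simp [mark_notMem_lowerDiagram])
      (dropFirst ([cap 0] ++ upperDiagram f.upper μ 1).length φ) c z
    rw [hasMarkStrength_append, hasMarkStrength_append, hm]
    tauto

theorem flowForm_linkDiagram {f : F3} {μ : Address → Option Label} {φ ψ : ℕ → ℕ → ℤ}
    (hφ : IsFlow (linkDiagram f μ) φ) (hψ : IsFlow (linkDiagram f μ) ψ) :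
    flowForm (linkDiagram f μ) φ ψ =
      treeForm f.upper (leafStrengths f μ φ) (leafStrengths f μ ψ) -
        treeForm f.lower (leafStrengths f μ φ) (leafStrengths f μ ψ) := by
  have h := hφ.flowBetween
  have h' := hψ.flowBetween
  rw [linkDiagram_eq] at h h' ⊢
  obtain ⟨u, h₁, h₂⟩ := FlowBetween.append_iff.1 h
  obtain ⟨v, h₃, h₄⟩ := FlowBetween.append_iff.1 h₁
  obtain ⟨w, h₅, h₆⟩ := FlowBetween.append_iff.1 h₂
  obtain ⟨u', h₁', h₂'⟩ := FlowBetween.append_iff.1 h'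
  obtain ⟨v', h₃', h₄'⟩ := FlowBetween.append_iff.1 h₁'
  obtain ⟨w', h₅', h₆'⟩ := FlowBetween.append_iff.1 h₂'
  rw [leafStrengths, leafStrengths, h₁.bottom, h₁'.bottom, flowForm_append, flowForm_append,
    flowForm_append, h₃.flowForm_slice h₃', h₆.flowForm_slice h₆', flowForm_upperDiagram h₄ h₄',
    flowForm_lowerDiagram h₅ h₅']
  simp only [sliceForm]
  ring

theorem Admissible.exists_isFlow {f : F3} {x : ℕ → ℤ} (h : Admissible f x)
    (μ : Address → Option Label) :
    ∃ φ, IsFlow (linkDiagram f μ) φ ∧ leafStrengths f μ φ = x := by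
  -- Strand 0 is the arc joining the roots on the left; it carries the opposite of the strength at
  -- the roots. The leaves start at strand 1.
  let u : ℕ → ℤ
    | 0 => -leafSum f.upper x
    | j + 1 => x j
  have hu : dropFirst 1 u = x := rfl
  obtain ⟨φ, v, hφ⟩ := exists_flowBetween_upperDiagram f.upper μ 1 (u := u) h.upper
  obtain ⟨ψ, v', hψ⟩ := exists_flowBetween_lowerDiagram f.lower 1 (u := u) h.lower
  have r := (flowBetween_upperDiagram hφ).1
  have r' := (flowBetween_lowerDiagram hψ).1
  have hcap : SliceFlow (cap 0) (dropFirst 2 v) v := by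
    refine ⟨fun i hi => by omega, ?_, fun i _ => rfl⟩
    rw [r.left 0 Nat.one_pos, Nat.zero_add, r.root, hu]
    exact neg_add_cancel _
  have hcup : SliceFlow (cup 0) v' (dropFirst 2 v') := by
    refine ⟨fun i hi => by omega, ?_, fun i _ => rfl⟩
    rw [r'.left 0 Nat.one_pos, Nat.zero_add, r'.root, hu, leafSum_lower]
    exact neg_add_cancel _
  obtain ⟨φ₁, h₁⟩ := hcap.exists_flowBetween
  obtain ⟨φ₂, h₂⟩ := hcup.exists_flowBetween
  obtain ⟨φ₃, h₃, -⟩ := h₁.exists_append hφ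
  obtain ⟨φ₄, h₄, -⟩ := hψ.exists_append h₂
  obtain ⟨φ₅, h₅, e⟩ := h₃.exists_append h₄
  refine ⟨φ₅, ?_, ?_⟩
  · rw [linkDiagram_eq]
    exact h₅.isFlow
  · rw [leafStrengths, e, hu]

/-- The central component, as a flow. -/
theorem exists_admissible_central (f : F3) : ∃ x, Admissible f x ∧ leafSum f.upper x = 1 := by
  have h := isTangle_linkDiagram f fun _ => none
  have hp : Inside (linkDiagram f fun _ => none) ⟨1, 1, true⟩ := by
    have := (strands_of_getElem? h (t := 0) (s := cap 0) rfl).2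
    rw [strands_zero] at this
    show 1 < _
    rw [this]
    decide
  obtain ⟨ha, hs, -⟩ := (isFlow_unitFlow h (isClosedUnion_orbit h hp)).leafStrengths
  refine ⟨_, ha, hs.symm.trans ?_⟩
  have h₁ : ∃ k, (next (linkDiagram f fun _ => none))^[k] ⟨1, 1, true⟩ = ⟨1, 1, true⟩ := ⟨0, rfl⟩
  -- The component does not return upwards through the root, so the two terms of `unitFlow` do not
  -- cancel there.
  have h₂ : ¬ ∃ k, (next (linkDiagram f fun _ => none))^[k] ⟨1, 1, true⟩ = ⟨1, 1, false⟩ :=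
    fun ⟨k, hk⟩ => iterate_ne_rev h hp k hk
  rw [unitFlow, if_pos h₁, if_neg h₂, sub_zero]

/-- Strengths at the leaves with the value `1` at the mark `c` and `0` at the mark `c'`. -/
structure Separates (f : F3) (μ : Address → Option Label) (c c' : Label) (x : ℕ → ℤ) : Prop where
  admissible : Admissible f x
  one : MarkedStrength f.upper μ c 1 x
  zero : MarkedStrength f.upper μ c' 0 x

theorem Separates.exists_isFlow {f : F3} {μ : Address → Option Label} {c c' : Label} {x : ℕ → ℤ}
    (hx : Separates f μ c c' x) : ∃ φ, IsFlow (linkDiagram f μ) φ ∧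
      HasMarkStrength (linkDiagram f μ) φ c 1 ∧ HasMarkStrength (linkDiagram f μ) φ c' 0 ∧
      leafStrengths f μ φ = x := by
  obtain ⟨φ, hφ, rfl⟩ := hx.admissible.exists_isFlow μ
  exact ⟨φ, hφ, (hφ.leafStrengths.2.2 c 1).2 hx.one, (hφ.leafStrengths.2.2 c' 0).2 hx.zero, rfl⟩

/-! ### From flows to components and linking numbers -/

theorem isFlow_direction {w : Diagram} (h : IsTangle w 0 0) (c : Label) :
    IsFlow w (direction w c) := by
  rw [direction_eq_unitFlow]
  exact isFlow_unitFlow h (isClosedUnion_onComponent h c)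

/-- Transfers a separating assignment to the direction of the actual component, including its zeros
at leaves; the latter kill the contributions of `f` and `g` to the linking number. -/
theorem Separates.direction {f : F3} {μ : Address → Option Label} {c c' : Label} {x : ℕ → ℤ}
    (hx : Separates f μ c c' x) :
    Separates f μ c c' (leafStrengths f μ (direction (linkDiagram f μ) c)) ∧
      ∀ j, x j = 0 → leafStrengths f μ (ThompsonLink.direction (linkDiagram f μ) c) j = 0 := by
  have h := isTangle_linkDiagram f μ
  obtain ⟨φ, hφ, h₁, h₀, rfl⟩ := hx.exists_isFlow
  obtain ⟨ha, -, hm⟩ := (isFlow_direction h c).leafStrengths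
  exact ⟨⟨ha, (hm c 1).1 (hφ.hasMarkStrength_direction h h₁),
    (hm c' 0).1 (hφ.hasMarkStrength_direction_zero h h₁ h₀)⟩,
    fun j hj => hφ.direction_eq_zero h h₁ hj⟩

theorem Separates.distinctComponents {f : F3} {μ : Address → Option Label} {c c' : Label}
    {x : ℕ → ℤ} (hx : Separates f μ c c' x) {d d' : Bool} {i i' : ℕ}
    (hm : mark c d i ∈ linkDiagram f μ) (hm' : mark c' d' i' ∈ linkDiagram f μ) :
    DistinctComponents (linkDiagram f μ) c c' := by
  obtain ⟨t, ht⟩ := List.getElem?_of_mem hm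
  obtain ⟨t', ht'⟩ := List.getElem?_of_mem hm'
  obtain ⟨φ, hφ, h₁, h₀, -⟩ := hx.exists_isFlow
  exact ⟨⟨_, t, i, d, ht, 0, rfl⟩, ⟨_, t', i', d', ht', 0, rfl⟩,
    hφ.distinct (isTangle_linkDiagram f μ) h₁ h₀⟩

theorem linkingNumber_linkDiagram (f : F3) (μ : Address → Option Label) (c c' : Label) :
    linkingNumber (linkDiagram f μ) c c' =
      ((treeForm f.upper (leafStrengths f μ (direction (linkDiagram f μ) c))
          (leafStrengths f μ (direction (linkDiagram f μ) c')) -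
        treeForm f.lower (leafStrengths f μ (direction (linkDiagram f μ) c))
          (leafStrengths f μ (direction (linkDiagram f μ) c')) : ℤ) : ℚ) / 2 := by
  have h := isTangle_linkDiagram f μ
  rw [linkingNumber_eq_flowForm, flowForm_linkDiagram (isFlow_direction h c) (isFlow_direction h c')]

/-! ### Joining sequences -/

/-- The first `a` entries of `x`, followed by `y`. -/
def joinAt (a : ℕ) (x y : ℕ → ℤ) (j : ℕ) : ℤ := if j < a then x j else y (j - a)

theorem joinAt_of_lt {a j : ℕ} (x y : ℕ → ℤ) (h : j < a) : joinAt a x y j = x j := if_pos h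

theorem dropFirst_joinAt (a b : ℕ) (x y : ℕ → ℤ) :
    dropFirst (a + b) (joinAt a x y) = dropFirst b y := by
  funext j
  simp only [dropFirst, joinAt, if_neg (show ¬ j + (a + b) < a by omega)]
  congr 1
  omega

/-! ### The strengths at the leaves of the linking moves, positive case -/

theorem dropFirst_apply (a : ℕ) (x : ℕ → ℤ) (j : ℕ) : dropFirst a x j = x (j + a) := rfl

/-- The subtree at the address `2` of `posLow k`. -/
def posRest : ℕ → TernaryTree
  | 0 => leaf
  | k + 1 => posLow k

theorem posLow_eq (k : ℕ) : posLow k = node leaf caret (posRest k) := by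
  cases k <;> rfl

theorem posRest_succ (k : ℕ) : posRest (k + 1) = node leaf caret (posRest k) := posLow_eq k

theorem lower_linkPos_succ (k : ℕ) (f g : F3) :
    (linkPos (k + 1) f g).lower = node (node g.lower caret (posRest k)) f.lower leaf := by
  rw [lower_linkPos, Nat.add_sub_cancel, posLow_eq, graft_zero_node]
  rfl

theorem numLeaves_posRest (k : ℕ) : (posRest k).numLeaves = 4 * k + 1 := by
  cases k with
  | zero => rfl
  | succ k => rw [posRest, numLeaves_posLow]; omega

/-- The strengths at the leaves of `posUp k` that are forced by the strengths `F` and `G` at the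
roots of `f` and `g`. -/
structure PosSystem (k : ℕ) (F G : ℤ) (p : ℕ → ℤ) : Prop where
  upper : Balanced (posUp k) p
  lower : Balanced (posRest k) (dropFirst 2 p)
  zero : p 0 = G
  one : p 1 = F
  sum_upper : leafSum (posUp k) p = F
  sum_lower : leafSum (posRest k) (dropFirst 2 p) = -G

theorem posSystem_zero {F G : ℤ} {p : ℕ → ℤ} :
    PosSystem 0 F G p ↔ p 0 = G ∧ p 1 = F ∧ p 2 = -G := by
  constructor
  · rintro ⟨-, -, h₀, h₁, -, h₂⟩
    exact ⟨h₀, h₁, h₂⟩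
  · rintro ⟨h₀, h₁, h₂⟩
    refine ⟨⟨trivial, trivial, trivial, ?_⟩, trivial, h₀, h₁, ?_, h₂⟩ <;>
      simp [leafSum, numLeaves, dropFirst_apply, posUp, caret, h₀, h₁, h₂]

/-- The balance conditions of both trees determine the first four strengths and leave the same
system for the inner trees with both parameters negated. As the form is bilinear, this change of
sign will not affect it. -/
theorem posSystem_succ {k : ℕ} {F G : ℤ} {p : ℕ → ℤ} :
    PosSystem (k + 1) F G p ↔ p 0 = G ∧ p 1 = F ∧ p 2 = -G ∧ p 3 = F ∧
      PosSystem k (-F) (-G) (dropFirst 4 p) := by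
  constructor
  · rintro ⟨a, b, h₀, h₁, c, d⟩
    simp only [posUp, posRest_succ, caret, Balanced, leafSum, numLeaves, dropFirst_dropFirst,
      dropFirst_apply, Nat.reduceAdd, Nat.zero_add, true_and] at a b c d
    refine ⟨h₀, h₁, by linarith, by linarith, a.2.1, b.2.1, ?_, ?_, by linarith, ?_⟩
    · simp only [dropFirst_apply, Nat.zero_add]; linarith
    · simp only [dropFirst_apply, Nat.reduceAdd]; linarith
    · rw [dropFirst_dropFirst]; linarith
  · rintro ⟨h₀, h₁, h₂, h₃, a, b, h₄, h₅, c, d⟩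
    simp only [dropFirst_dropFirst, dropFirst_apply, Nat.reduceAdd, Nat.zero_add] at *
    refine ⟨?_, ?_, h₀, h₁, ?_, ?_⟩ <;>
      simp only [posUp, posRest_succ, caret, Balanced, leafSum, numLeaves,
        dropFirst_dropFirst, dropFirst_apply, Nat.reduceAdd, Nat.zero_add, true_and]
    · exact ⟨by linarith, a, by linarith⟩
    · exact ⟨by linarith, b, by linarith⟩
    · linarith
    · linarith

theorem exists_posSystem (k : ℕ) (F G : ℤ) : ∃ p, PosSystem k F G p := by
  induction k generalizing F G with
  | zero =>
      exact ⟨fun j => if j = 0 then G else if j = 1 then F else -G, posSystem_zero.2 (by simp)⟩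
  | succ k ih =>
      obtain ⟨p, hp⟩ := ih (-F) (-G)
      refine ⟨fun j => match j with
        | 0 => G
        | 1 => F
        | 2 => -G
        | 3 => F
        | j + 4 => p j, posSystem_succ.2 ⟨rfl, rfl, rfl, rfl, hp⟩⟩

theorem PosSystem.congr {k : ℕ} {F G : ℤ} {p q : ℕ → ℤ} (hp : PosSystem k F G p)
    (h : ∀ j < 4 * k + 3, p j = q j) : PosSystem k F G q := by
  have h₁ : ∀ j < (posUp k).numLeaves, p j = q j := by rwa [numLeaves_posUp]
  have h₂ : ∀ j < (posRest k).numLeaves, dropFirst 2 p j = dropFirst 2 q j := by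
    rw [numLeaves_posRest]
    exact fun j hj => h _ (by omega)
  exact ⟨hp.upper.congr h₁, hp.lower.congr h₂, by rw [← h 0 (by omega), hp.zero],
    by rw [← h 1 (by omega), hp.one], by rw [← leafSum_congr h₁, hp.sum_upper],
    by rw [← leafSum_congr h₂, hp.sum_lower]⟩

/-- Every stage adds `2 * (F * G' + F' * G) + 2 * (F * F' - G * G')`; the first summand is the
algebraic trace of one full twist. -/
theorem PosSystem.treeForm_sub {k : ℕ} {F G F' G' : ℤ} {p p' : ℕ → ℤ} (h : PosSystem k F G p)
    (h' : PosSystem k F' G' p') :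
    treeForm (posUp k) p p' - treeForm (posRest k) (dropFirst 2 p) (dropFirst 2 p') =
      (2 * k + 1) * (F * G' + F' * G) + 2 * k * (F * F' - G * G') := by
  induction k generalizing F G F' G' p p' with
  | zero =>
      obtain ⟨h₀, h₁, -⟩ := posSystem_zero.1 h
      obtain ⟨h₀', h₁', -⟩ := posSystem_zero.1 h'
      simp [posUp, posRest, caret, treeForm, leafSum, numLeaves, dropFirst_apply, h₀, h₁, h₀', h₁']
  | succ k ih =>
      obtain ⟨h₀, h₁, h₂, h₃, h⟩ := posSystem_succ.1 h
      obtain ⟨h₀', h₁', h₂', h₃', h'⟩ := posSystem_succ.1 h'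
      have e := ih h h'
      have e₄ := h.zero
      have e₅ := h.one
      have e₄' := h'.zero
      have e₅' := h'.one
      simp only [dropFirst_dropFirst, dropFirst_apply, Nat.reduceAdd, Nat.zero_add] at e e₄ e₅ e₄' e₅'
      simp only [posUp, posRest_succ, caret, treeForm, leafSum, numLeaves,
        dropFirst_dropFirst, dropFirst_apply, Nat.reduceAdd, Nat.zero_add, h₀, h₁, h₂, h₃,
        h₀', h₁', h₂', h₃', e₄, e₅, e₄', e₅']
      push_cast
      linear_combination e

/-- The leaves are, from left to right, those of `g`, one single leaf, the `4 * k + 3` of `posUp k`,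
those of `f` and one last leaf; this explains the offsets. The balance conditions outside `f` and
`g` are exactly the remaining conditions. -/
theorem admissible_linkPos {k : ℕ} {f g : F3} {x : ℕ → ℤ} :
    Admissible (linkPos (k + 1) f g) x ↔ Admissible g x ∧
      Admissible f (dropFirst (g.upper.numLeaves + (4 * k + 4)) x) ∧
      x g.upper.numLeaves =
        -leafSum f.upper (dropFirst (g.upper.numLeaves + (4 * k + 4)) x) ∧
      x (g.upper.numLeaves + (4 * k + 4) + f.upper.numLeaves) = -leafSum g.upper x ∧
      PosSystem k (leafSum f.upper (dropFirst (g.upper.numLeaves + (4 * k + 4)) x))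
        (leafSum g.upper x) (dropFirst (g.upper.numLeaves + 1) x) := by
  -- The totals at the two roots agree. Above, the total reduces to that of `posUp k`, below to that
  -- of `f`; this is the field `sum_upper`.
  have hs := leafSum_lower (linkPos (k + 1) f g) x
  have a₁ : g.upper.numLeaves + (1 + (4 * k + 3)) = g.upper.numLeaves + (4 * k + 4) := by omega
  have a₂ : g.upper.numLeaves + (1 + (4 * k + 3) + f.upper.numLeaves) =
    g.upper.numLeaves + (4 * k + 4) + f.upper.numLeaves := by omega
  have a₃ : g.upper.numLeaves + 3 + (4 * k + 1) = g.upper.numLeaves + (4 * k + 4) := by omega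
  have a₄ : 0 + (g.upper.numLeaves + 1) = 1 + g.upper.numLeaves := by omega
  have a₅ : 1 + (g.upper.numLeaves + 1) = 2 + g.upper.numLeaves := by omega
  constructor
  · rintro ⟨a, b⟩
    simp only [upper_linkPos, lower_linkPos_succ, caret,
      Balanced, leafSum, numLeaves, numLeaves_posUp, numLeaves_posRest, Nat.add_sub_cancel,
      dropFirst_dropFirst, dropFirst_apply, Nat.reduceAdd, Nat.zero_add, true_and,
      ← f.numLeaves_eq, ← g.numLeaves_eq, leafSum_lower, a₁, a₂, a₃] at a b hs
    obtain ⟨ag, ⟨ap, af, e₁⟩, e₂⟩ := a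
    obtain ⟨⟨bg, e₃, bp, e₄⟩, bf, e₅⟩ := b
    refine ⟨⟨ag, bg⟩, ⟨af, bf⟩, by linarith, by linarith, ap, ?_, ?_, ?_, by linarith, ?_⟩
    · rwa [dropFirst_dropFirst]
    · rw [dropFirst_apply, a₄]; linarith
    · rw [dropFirst_apply, a₅]; linarith
    · rw [dropFirst_dropFirst]; linarith
  · rintro ⟨⟨ag, bg⟩, ⟨af, bf⟩, e₁, e₂, ap, bp, h₀, h₁, e₃, e₄⟩
    rw [dropFirst_dropFirst] at bp e₄
    rw [dropFirst_apply, a₄] at h₀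
    rw [dropFirst_apply, a₅] at h₁
    constructor <;>
      simp only [upper_linkPos, lower_linkPos_succ, caret,
        Balanced, leafSum, numLeaves, numLeaves_posUp, numLeaves_posRest, Nat.add_sub_cancel,
        dropFirst_dropFirst, dropFirst_apply, Nat.reduceAdd, Nat.zero_add, true_and,
        ← f.numLeaves_eq, ← g.numLeaves_eq, leafSum_lower, a₁, a₂, a₃]
    · exact ⟨ag, ⟨ap, af, by linarith⟩, by linarith⟩
    · exact ⟨⟨bg, by linarith, bp, by linarith⟩, bf, by linarith⟩

theorem treeForm_linkPos {k : ℕ} {f g : F3} {x x' : ℕ → ℤ}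
    (h : Admissible (linkPos (k + 1) f g) x) (h' : Admissible (linkPos (k + 1) f g) x')
    {F G F' G' : ℤ} (hF : leafSum f.upper (dropFirst (g.upper.numLeaves + (4 * k + 4)) x) = F)
    (hF' : leafSum f.upper (dropFirst (g.upper.numLeaves + (4 * k + 4)) x') = F')
    (hG : leafSum g.upper x = G) (hG' : leafSum g.upper x' = G') :
    treeForm (linkPos (k + 1) f g).upper x x' - treeForm (linkPos (k + 1) f g).lower x x' =
      (treeForm g.upper x x' - treeForm g.lower x x') +
      (treeForm f.upper (dropFirst (g.upper.numLeaves + (4 * k + 4)) x)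
          (dropFirst (g.upper.numLeaves + (4 * k + 4)) x') -
        treeForm f.lower (dropFirst (g.upper.numLeaves + (4 * k + 4)) x)
          (dropFirst (g.upper.numLeaves + (4 * k + 4)) x')) +
      (2 * k + 2) * (F * G' + F' * G) + (2 * k - 2) * (F * F') - (2 * k + 2) * (G * G') := by
  obtain ⟨-, -, e₁, -, s⟩ := admissible_linkPos.1 h
  obtain ⟨-, -, e₁', -, s'⟩ := admissible_linkPos.1 h'
  rw [hF] at e₁ s
  rw [hF'] at e₁' s'
  rw [hG] at s
  rw [hG'] at s'
  have e := s.treeForm_sub s'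
  have a₁ : g.upper.numLeaves + (1 + (4 * k + 3)) = g.upper.numLeaves + (4 * k + 4) := by omega
  have a₃ : g.upper.numLeaves + 3 + (4 * k + 1) = g.upper.numLeaves + (4 * k + 4) := by omega
  have a₄ : 0 + (g.upper.numLeaves + 1) = 1 + g.upper.numLeaves := by omega
  have a₅ : 1 + (g.upper.numLeaves + 1) = 2 + g.upper.numLeaves := by omega
  obtain ⟨-, -, h₀, h₁, e₃, e₄⟩ := s
  obtain ⟨-, -, h₀', h₁', e₃', e₄'⟩ := s'
  rw [dropFirst_dropFirst] at e₄ e₄'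
  rw [dropFirst_dropFirst, dropFirst_dropFirst] at e
  rw [dropFirst_apply, a₄] at h₀ h₀'
  rw [dropFirst_apply, a₅] at h₁ h₁'
  simp only [upper_linkPos, lower_linkPos_succ, caret, treeForm, leafSum, numLeaves,
    numLeaves_posUp, numLeaves_posRest, Nat.add_sub_cancel, dropFirst_dropFirst, dropFirst_apply,
    Nat.reduceAdd, Nat.zero_add, ← g.numLeaves_eq, leafSum_lower, a₁, a₃,
    hF, hF', hG, hG', e₁, e₁', e₃, e₃', e₄, e₄', h₀, h₀', h₁, h₁']
  linear_combination e

theorem exists_admissible_linkPos (k : ℕ) {f g : F3} {xf xg : ℕ → ℤ} (hf : Admissible f xf)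
    (hg : Admissible g xg) : ∃ x, Admissible (linkPos (k + 1) f g) x ∧
      (∀ j < g.upper.numLeaves, x j = xg j) ∧
      ∀ j < f.upper.numLeaves, dropFirst (g.upper.numLeaves + (4 * k + 4)) x j = xf j := by
  obtain ⟨p, hp⟩ := exists_posSystem k (leafSum f.upper xf) (leafSum g.upper xg)
  -- The assignment is assembled from right to left in the order of the leaves: `f` and the last
  -- leaf, preceded by the forced part, the single leaf and `g`.
  let y := joinAt f.upper.numLeaves xf fun _ => -leafSum g.upper xg
  let q := joinAt (4 * k + 3) p y
  let x := joinAt g.upper.numLeaves xg (joinAt 1 (fun _ => -leafSum f.upper xf) q)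
  have d₁ : dropFirst (g.upper.numLeaves + 1) x = q := by
    rw [dropFirst_joinAt, show 1 = 1 + 0 from rfl, dropFirst_joinAt, dropFirst_zero]
  have d₂ : dropFirst (g.upper.numLeaves + (4 * k + 4)) x = y := by
    rw [show g.upper.numLeaves + (4 * k + 4) = g.upper.numLeaves + 1 + (4 * k + 3 + 0) by omega,
      ← dropFirst_dropFirst, d₁, dropFirst_joinAt, dropFirst_zero]
  have hx : ∀ j < g.upper.numLeaves, x j = xg j := fun j hj => joinAt_of_lt _ _ hj
  have hy : ∀ j < f.upper.numLeaves, y j = xf j := fun j hj => joinAt_of_lt _ _ hj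
  refine ⟨x, ?_, hx, by rwa [d₂]⟩
  rw [admissible_linkPos, d₁, d₂, leafSum_congr hx, leafSum_congr hy]
  refine ⟨⟨hg.upper.congr fun j hj => (hx j hj).symm,
    hg.lower.congr fun j hj => (hx j (by rwa [g.numLeaves_eq])).symm⟩,
    ⟨hf.upper.congr fun j hj => (hy j hj).symm,
    hf.lower.congr fun j hj => (hy j (by rwa [f.numLeaves_eq])).symm⟩, ?_, ?_,
    hp.congr fun j hj => (joinAt_of_lt _ _ hj).symm⟩
  · simp [x, joinAt]
  · have := congrFun d₂ f.upper.numLeaves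
    rw [dropFirst_apply, Nat.add_comm] at this
    rw [this]
    simp [y, joinAt]

theorem markedStrength_linkPos {k : ℕ} {f g : F3} {c : Label} {z : ℤ} {x : ℕ → ℤ} :
    MarkedStrength (linkPos (k + 1) f g).upper (markAt [1, 2] [0]) c z x ↔
      (Label.Kg = c → leafSum g.upper x = z) ∧
      (Label.Kf = c → leafSum f.upper (dropFirst (g.upper.numLeaves + (4 * k + 4)) x) = z) := by
  have h : (fun α => markAt [1, 2] [0] (1 :: 1 :: α)) = fun _ => none := by
    funext α; simp [markAt]
  have a : g.upper.numLeaves + (1 + (4 * k + 3)) = g.upper.numLeaves + (4 * k + 4) := by omega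
  simp only [upper_linkPos, MarkedStrength, numLeaves, markAt_g, markAt_pos_f, h,
    markedStrength_none, markedStrength_markRoot, numLeaves_posUp, Nat.add_sub_cancel,
    dropFirst_dropFirst, a]
  simp [markAt]

/-! ### Components and linking number of the positive move -/

theorem admissible_zero (f : F3) : Admissible f fun _ => 0 :=
  ⟨balanced_of_eq_zero fun _ => rfl, balanced_of_eq_zero fun _ => rfl⟩

/-- The central component of one inserted element is extended by zero on the other one. -/
theorem separates_linkPos (k : ℕ) (f g : F3) :
    (∃ x, Separates (linkPos (k + 1) f g) (markAt [1, 2] [0]) Label.Kf Label.Kg x ∧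
      ∀ j < g.upper.numLeaves, x j = 0) ∧
    ∃ x, Separates (linkPos (k + 1) f g) (markAt [1, 2] [0]) Label.Kg Label.Kf x ∧
      ∀ j < f.upper.numLeaves, dropFirst (g.upper.numLeaves + (4 * k + 4)) x j = 0 := by
  obtain ⟨xf, af, sf⟩ := exists_admissible_central f
  obtain ⟨xg, ag, sg⟩ := exists_admissible_central g
  obtain ⟨x, ha, h₀, h₁⟩ := exists_admissible_linkPos k af (admissible_zero g)
  obtain ⟨x', ha', h₀', h₁'⟩ := exists_admissible_linkPos k (admissible_zero f) ag
  refine ⟨⟨x, ⟨ha, markedStrength_linkPos.2 ⟨by simp, fun _ => ?_⟩,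
    markedStrength_linkPos.2 ⟨fun _ => ?_, by simp⟩⟩, h₀⟩,
    ⟨x', ⟨ha', markedStrength_linkPos.2 ⟨fun _ => ?_, by simp⟩,
    markedStrength_linkPos.2 ⟨by simp, fun _ => ?_⟩⟩, h₁'⟩⟩
  · rw [leafSum_congr h₁, sf]
  · exact leafSum_eq_zero h₀
  · rw [leafSum_congr h₀', sg]
  · exact leafSum_eq_zero h₁'

theorem mark_mem_upperDiagram (T : TernaryTree) (c : Label) (i : ℕ) :
    mark c true i ∈ upperDiagram T (markRoot c) i := by
  cases T <;> simp [upperDiagram, markRoot]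

theorem distinctComponents_linkPos (k : ℕ) (f g : F3) :
    DistinctComponents (linkPosDiagram (k + 1) f g) Label.Kf Label.Kg := by
  obtain ⟨⟨x, hx, -⟩, -⟩ := separates_linkPos k f g
  have h := linkPosDiagram_eq (k + 1) f g
  refine hx.distinctComponents (i := 4) (i' := 1) (d := true) (d' := true) ?_ ?_ <;>
    change _ ∈ linkPosDiagram (k + 1) f g <;> rw [h] <;>
    simp [openDiagram, mark_mem_upperDiagram]

/-- For the two directions, `F = 1`, `G = 0` and `F' = 0`, `G' = 1`, so `treeForm_linkPos` reduces
to `2 * k + 2` once the forms of `f` and `g` are gone. These vanish since the first direction is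
zero on the leaves of `g` and the second one on those of `f`. -/
theorem linkingNumber_linkPos (k : ℕ) (f g : F3) :
    linkingNumber (linkPosDiagram (k + 1) f g) Label.Kf Label.Kg = (k + 1 : ℕ) := by
  obtain ⟨⟨x, hx, hxg⟩, x', hx', hxf⟩ := separates_linkPos k f g
  obtain ⟨s, h₀⟩ := hx.direction
  obtain ⟨s', h₀'⟩ := hx'.direction
  have z₀ := fun j hj => h₀ j (hxg j hj)
  have z₁ : ∀ j < f.upper.numLeaves, dropFirst (g.upper.numLeaves + (4 * k + 4)) (leafStrengths _ _
      (direction (linkDiagram (linkPos (k + 1) f g) (markAt [1, 2] [0])) Label.Kg)) j = 0 :=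
    fun j hj => h₀' _ (hxf j hj)
  rw [linkPosDiagram, linkingNumber_linkDiagram, treeForm_linkPos s.admissible s'.admissible
    ((markedStrength_linkPos.1 s.one).2 rfl) ((markedStrength_linkPos.1 s'.zero).2 rfl)
    ((markedStrength_linkPos.1 s.zero).1 rfl) ((markedStrength_linkPos.1 s'.one).1 rfl),
    treeForm_eq_zero z₀, treeForm_eq_zero (by rwa [← g.numLeaves_eq]),
    treeForm_comm f.upper, treeForm_comm f.lower, treeForm_eq_zero z₁,
    treeForm_eq_zero (by rwa [← f.numLeaves_eq])]
  push_cast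
  ring

/-! ### The strengths at the leaves of the linking moves, negative case -/

/-- The strengths at the leaves of `negLow k` that are forced by the strengths `F` and `G` at the
roots of `f` and `g`. -/
structure NegSystem (k : ℕ) (F G : ℤ) (p : ℕ → ℤ) : Prop where
  upper : Balanced (negUp k) p
  lower : Balanced (negLow k) p
  sum_upper : leafSum (negUp k) p = F
  sum_lower : leafSum (negLow k) p = G
  next_to_last : p (4 * k + 1) = G
  last : p (4 * k + 2) = -F

theorem negSystem_zero {F G : ℤ} {p : ℕ → ℤ} :
    NegSystem 0 F G p ↔ p 0 = F ∧ p 1 = G ∧ p 2 = -F := by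
  constructor
  · rintro ⟨-, -, h₀, -, h₁, h₂⟩
    exact ⟨h₀, h₁, h₂⟩
  · rintro ⟨h₀, h₁, h₂⟩
    refine ⟨trivial, ⟨trivial, trivial, trivial, ?_⟩, h₀, ?_, h₁, h₂⟩ <;>
      simp [leafSum, numLeaves, dropFirst_apply, negLow, caret, h₀, h₁, h₂]

/-- As in the positive case each stage negates both parameters, but the new leaves are now added on
the right, so the inner system is an initial segment. -/
theorem negSystem_succ {k : ℕ} {F G : ℤ} {p : ℕ → ℤ} :
    NegSystem (k + 1) F G p ↔ NegSystem k (-F) (-G) p ∧ p (4 * k + 3) = G ∧ p (4 * k + 4) = F ∧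
      p (4 * k + 5) = G ∧ p (4 * k + 6) = -F := by
  have a₁ : 1 + (4 * k + 1) = 4 * k + 2 := by omega
  have a₂ : 2 + (4 * k + 1) = 4 * k + 3 := by omega
  have a₃ : 1 + (4 * k + 4) = 4 * k + 5 := by omega
  have a₄ : 2 + (4 * k + 4) = 4 * k + 6 := by omega
  constructor
  · rintro ⟨a, b, c, d, e₅, e₆⟩
    rw [show 4 * (k + 1) + 1 = 4 * k + 5 by omega] at e₅
    rw [show 4 * (k + 1) + 2 = 4 * k + 6 by omega] at e₆
    simp only [negUp, negLow, caret, Balanced, leafSum, numLeaves, numLeaves_negUp,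
      numLeaves_negLow, dropFirst_apply, Nat.reduceAdd, Nat.zero_add,
      Nat.add_assoc, true_and, a₁, a₂, a₃, a₄] at a b c d
    refine ⟨⟨a.1, b.1, by linarith, by linarith, by linarith, by linarith⟩, by linarith,
      by linarith, e₅, e₆⟩
  · rintro ⟨⟨a, b, c, d, e₁, e₂⟩, e₃, e₄, e₅, e₆⟩
    refine ⟨?_, ?_, ?_, ?_, e₅, e₆⟩ <;>
      simp only [negUp, negLow, caret, Balanced, leafSum, numLeaves, numLeaves_negUp,
        numLeaves_negLow, dropFirst_apply, Nat.reduceAdd, Nat.zero_add,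
        Nat.add_assoc, true_and, a₁, a₂, a₃, a₄]
    · exact ⟨a, by linarith, by linarith⟩
    · exact ⟨b, by linarith, by linarith⟩
    · linarith
    · linarith

theorem NegSystem.congr {k : ℕ} {F G : ℤ} {p q : ℕ → ℤ} (hp : NegSystem k F G p)
    (h : ∀ j < 4 * k + 3, p j = q j) : NegSystem k F G q := by
  have h₁ : ∀ j < (negUp k).numLeaves, p j = q j := by
    rw [numLeaves_negUp]
    exact fun j hj => h _ (by omega)
  have h₂ : ∀ j < (negLow k).numLeaves, p j = q j := by rwa [numLeaves_negLow]
  exact ⟨hp.upper.congr h₁, hp.lower.congr h₂, by rw [← leafSum_congr h₁, hp.sum_upper],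
    by rw [← leafSum_congr h₂, hp.sum_lower], by rw [← h _ (by omega), hp.next_to_last],
    by rw [← h _ (by omega), hp.last]⟩

theorem exists_negSystem (k : ℕ) (F G : ℤ) : ∃ p, NegSystem k F G p := by
  induction k generalizing F G with
  | zero =>
      exact ⟨fun j => if j = 0 then F else if j = 1 then G else -F, negSystem_zero.2 (by simp)⟩
  | succ k ih =>
      obtain ⟨p, hp⟩ := ih (-F) (-G)
      refine ⟨joinAt (4 * k + 3) p fun j => if j = 1 then F else if j = 3 then -F else G,
        negSystem_succ.2 ⟨hp.congr fun j hj => (joinAt_of_lt _ _ hj).symm, ?_⟩⟩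
      simp [joinAt, show 4 * k + 4 - (4 * k + 3) = 1 by omega,
        show 4 * k + 5 - (4 * k + 3) = 2 by omega, show 4 * k + 6 - (4 * k + 3) = 3 by omega]

theorem NegSystem.treeForm_sub {k : ℕ} {F G F' G' : ℤ} {p p' : ℕ → ℤ} (h : NegSystem k F G p)
    (h' : NegSystem k F' G' p') :
    treeForm (negUp k) p p' - treeForm (negLow k) p p' =
      -(2 * k + 1) * (F * G' + F' * G) - 2 * k * (F * F' - G * G') := by
  induction k generalizing F G F' G' with
  | zero =>
      obtain ⟨h₀, h₁, -⟩ := negSystem_zero.1 h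
      obtain ⟨h₀', h₁', -⟩ := negSystem_zero.1 h'
      simp [negUp, negLow, caret, treeForm, leafSum, numLeaves, dropFirst_apply, h₀, h₁, h₀', h₁']
      ring
  | succ k ih =>
      obtain ⟨s, e₃, e₄, e₅, -⟩ := negSystem_succ.1 h
      obtain ⟨s', e₃', e₄', e₅', -⟩ := negSystem_succ.1 h'
      have e := ih s s'
      obtain ⟨-, -, c, d, e₁, e₂⟩ := s
      obtain ⟨-, -, c', d', e₁', e₂'⟩ := s'
      have a₁ : 1 + (4 * k + 1) = 4 * k + 2 := by omega
      have a₂ : 2 + (4 * k + 1) = 4 * k + 3 := by omega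
      have a₃ : 1 + (4 * k + 4) = 4 * k + 5 := by omega
      simp only [negUp, negLow, caret, treeForm, leafSum, numLeaves, numLeaves_negUp,
        numLeaves_negLow, dropFirst_apply, Nat.reduceAdd, Nat.zero_add,
        Nat.add_assoc, a₁, a₂, a₃, e₁, e₂, e₃, e₄, e₅, e₁', e₂', e₃', e₄', e₅',
        c, d, c', d']
      push_cast
      linear_combination e

/-- Here the leaves are those of `g`, those of `f`, the `4 * k + 1` of `negUp k`, three of a caret
and a last one. `negLow k` also covers the first two leaves of that caret; the other two leaves have
the opposite of the strength of `g`. -/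
theorem admissible_linkNeg {k : ℕ} {f g : F3} {x : ℕ → ℤ} :
    Admissible (linkNeg (k + 1) f g) x ↔ Admissible g x ∧
      Admissible f (dropFirst g.upper.numLeaves x) ∧
      x (4 * k + 3 + (g.upper.numLeaves + f.upper.numLeaves)) = -leafSum g.upper x ∧
      x (4 * k + 4 + (g.upper.numLeaves + f.upper.numLeaves)) = -leafSum g.upper x ∧
      NegSystem k (leafSum f.upper (dropFirst g.upper.numLeaves x)) (leafSum g.upper x)
        (dropFirst (g.upper.numLeaves + f.upper.numLeaves) x) := by
  have hs := leafSum_lower (linkNeg (k + 1) f g) x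
  have a₁ : f.upper.numLeaves + (4 * k + 1) + g.upper.numLeaves =
    4 * k + 1 + (g.upper.numLeaves + f.upper.numLeaves) := by omega
  have a₂ : 1 + (g.upper.numLeaves + (f.upper.numLeaves + (4 * k + 1))) =
    4 * k + 2 + (g.upper.numLeaves + f.upper.numLeaves) := by omega
  have a₃ : 2 + (g.upper.numLeaves + (f.upper.numLeaves + (4 * k + 1))) =
    4 * k + 3 + (g.upper.numLeaves + f.upper.numLeaves) := by omega
  have a₄ : g.upper.numLeaves + (f.upper.numLeaves + (4 * k + 1) + 3) =
    4 * k + 4 + (g.upper.numLeaves + f.upper.numLeaves) := by omega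
  have a₅ : 4 * k + 3 + 1 = 4 * k + 4 := rfl
  constructor
  · rintro ⟨a, b⟩
    simp only [upper_linkNeg, lower_linkNeg, caret,
      Balanced, leafSum, numLeaves, numLeaves_negUp, numLeaves_negLow, Nat.add_sub_cancel,
      dropFirst_dropFirst, dropFirst_apply, Nat.reduceAdd, Nat.zero_add, true_and,
      ← f.numLeaves_eq, ← g.numLeaves_eq, leafSum_lower, a₁, a₂, a₃, a₄, a₅] at a b hs
    obtain ⟨ag, ⟨af, ap, e₁, e₂⟩, e₃⟩ := a
    obtain ⟨bg, bf, ⟨bp, e₄⟩, e₅⟩ := b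
    refine ⟨⟨ag, bg⟩, ⟨af, bf⟩, by linarith, by linarith, ap, bp, by linarith, by linarith, ?_, ?_⟩
    · rw [dropFirst_apply]; linarith
    · rw [dropFirst_apply]; linarith
  · rintro ⟨⟨ag, bg⟩, ⟨af, bf⟩, e₁, e₂, ap, bp, e₃, e₄, e₅, e₆⟩
    rw [dropFirst_apply] at e₅ e₆
    constructor <;>
      simp only [upper_linkNeg, lower_linkNeg, caret,
        Balanced, leafSum, numLeaves, numLeaves_negUp, numLeaves_negLow, Nat.add_sub_cancel,
        dropFirst_dropFirst, dropFirst_apply, Nat.reduceAdd, Nat.zero_add, true_and,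
        ← f.numLeaves_eq, ← g.numLeaves_eq, leafSum_lower, a₁, a₂, a₃, a₄, a₅]
    · exact ⟨ag, ⟨af, ap, by linarith, by linarith⟩, by linarith⟩
    · exact ⟨bg, bf, ⟨bp, by linarith⟩, by linarith⟩

theorem treeForm_linkNeg {k : ℕ} {f g : F3} {x x' : ℕ → ℤ}
    (h : Admissible (linkNeg (k + 1) f g) x) (h' : Admissible (linkNeg (k + 1) f g) x')
    {F G F' G' : ℤ} (hF : leafSum f.upper (dropFirst g.upper.numLeaves x) = F)
    (hF' : leafSum f.upper (dropFirst g.upper.numLeaves x') = F')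
    (hG : leafSum g.upper x = G) (hG' : leafSum g.upper x' = G') :
    treeForm (linkNeg (k + 1) f g).upper x x' - treeForm (linkNeg (k + 1) f g).lower x x' =
      (treeForm g.upper x x' - treeForm g.lower x x') +
      (treeForm f.upper (dropFirst g.upper.numLeaves x) (dropFirst g.upper.numLeaves x') -
        treeForm f.lower (dropFirst g.upper.numLeaves x) (dropFirst g.upper.numLeaves x')) -
      (2 * k + 2) * (F * G' + F' * G) - (2 * k - 2) * (F * F') + (2 * k + 2) * (G * G') := by
  obtain ⟨-, -, e₁, -, s⟩ := admissible_linkNeg.1 h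
  obtain ⟨-, -, e₁', -, s'⟩ := admissible_linkNeg.1 h'
  rw [hF] at s
  rw [hF'] at s'
  rw [hG] at e₁ s
  rw [hG'] at e₁' s'
  have e := s.treeForm_sub s'
  have a₁ : f.upper.numLeaves + (4 * k + 1) + g.upper.numLeaves =
    4 * k + 1 + (g.upper.numLeaves + f.upper.numLeaves) := by omega
  have a₂ : 1 + (g.upper.numLeaves + (f.upper.numLeaves + (4 * k + 1))) =
    4 * k + 2 + (g.upper.numLeaves + f.upper.numLeaves) := by omega
  have a₃ : 2 + (g.upper.numLeaves + (f.upper.numLeaves + (4 * k + 1))) =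
    4 * k + 3 + (g.upper.numLeaves + f.upper.numLeaves) := by omega
  obtain ⟨-, -, e₃, e₄, e₅, e₆⟩ := s
  obtain ⟨-, -, e₃', e₄', e₅', e₆'⟩ := s'
  rw [dropFirst_apply] at e₅ e₆ e₅' e₆'
  simp only [upper_linkNeg, lower_linkNeg, caret, treeForm, leafSum, numLeaves,
    numLeaves_negUp, numLeaves_negLow, Nat.add_sub_cancel, dropFirst_dropFirst, dropFirst_apply,
    Nat.reduceAdd, Nat.zero_add, ← f.numLeaves_eq, ← g.numLeaves_eq, leafSum_lower,
    a₁, a₂, a₃, hF, hF', hG, hG', e₁, e₁', e₃, e₃', e₄, e₄', e₅, e₅', e₆, e₆']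
  linear_combination e

theorem exists_admissible_linkNeg (k : ℕ) {f g : F3} {xf xg : ℕ → ℤ} (hf : Admissible f xf)
    (hg : Admissible g xg) : ∃ x, Admissible (linkNeg (k + 1) f g) x ∧
      (∀ j < g.upper.numLeaves, x j = xg j) ∧
      ∀ j < f.upper.numLeaves, dropFirst g.upper.numLeaves x j = xf j := by
  obtain ⟨p, hp⟩ := exists_negSystem k (leafSum f.upper xf) (leafSum g.upper xg)
  let q := joinAt (4 * k + 3) p fun _ => -leafSum g.upper xg
  let y := joinAt f.upper.numLeaves xf q
  let x := joinAt g.upper.numLeaves xg y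
  have d₁ : dropFirst g.upper.numLeaves x = y := dropFirst_joinAt _ 0 _ _
  have d₂ : dropFirst (g.upper.numLeaves + f.upper.numLeaves) x = q := by
    rw [← dropFirst_dropFirst, d₁]
    exact dropFirst_joinAt _ 0 _ _
  have hq : ∀ j, x (j + (g.upper.numLeaves + f.upper.numLeaves)) = q j := congrFun d₂
  have hx : ∀ j < g.upper.numLeaves, x j = xg j := fun j hj => joinAt_of_lt _ _ hj
  have hy : ∀ j < f.upper.numLeaves, y j = xf j := fun j hj => joinAt_of_lt _ _ hj
  refine ⟨x, ?_, hx, by rwa [d₁]⟩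
  rw [admissible_linkNeg, d₁, d₂, leafSum_congr hx, leafSum_congr hy, hq, hq]
  exact ⟨⟨hg.upper.congr fun j hj => (hx j hj).symm,
    hg.lower.congr fun j hj => (hx j (by rwa [g.numLeaves_eq])).symm⟩,
    ⟨hf.upper.congr fun j hj => (hy j hj).symm,
    hf.lower.congr fun j hj => (hy j (by rwa [f.numLeaves_eq])).symm⟩,
    by simp [q, joinAt], by simp [q, joinAt],
    hp.congr fun j hj => (joinAt_of_lt _ _ hj).symm⟩

theorem markedStrength_linkNeg {k : ℕ} {f g : F3} {c : Label} {z : ℤ} {x : ℕ → ℤ} :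
    MarkedStrength (linkNeg (k + 1) f g).upper (markAt [1, 0] [0]) c z x ↔
      (Label.Kg = c → leafSum g.upper x = z) ∧
      (Label.Kf = c → leafSum f.upper (dropFirst g.upper.numLeaves x) = z) := by
  have h : (fun α => markAt [1, 0] [0] (1 :: 1 :: α)) = fun _ => none := by
    funext α; simp [markAt]
  simp only [upper_linkNeg, MarkedStrength, markAt_g, markAt_neg_f, h, markedStrength_none,
    markedStrength_markRoot, caret]
  simp [markAt]

/-! ### Components and linking number of the negative move -/

theorem separates_linkNeg (k : ℕ) (f g : F3) :
    (∃ x, Separates (linkNeg (k + 1) f g) (markAt [1, 0] [0]) Label.Kf Label.Kg x ∧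
      ∀ j < g.upper.numLeaves, x j = 0) ∧
    ∃ x, Separates (linkNeg (k + 1) f g) (markAt [1, 0] [0]) Label.Kg Label.Kf x ∧
      ∀ j < f.upper.numLeaves, dropFirst g.upper.numLeaves x j = 0 := by
  obtain ⟨xf, af, sf⟩ := exists_admissible_central f
  obtain ⟨xg, ag, sg⟩ := exists_admissible_central g
  obtain ⟨x, ha, h₀, h₁⟩ := exists_admissible_linkNeg k af (admissible_zero g)
  obtain ⟨x', ha', h₀', h₁'⟩ := exists_admissible_linkNeg k (admissible_zero f) ag
  refine ⟨⟨x, ⟨ha, markedStrength_linkNeg.2 ⟨by simp, fun _ => ?_⟩,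
    markedStrength_linkNeg.2 ⟨fun _ => ?_, by simp⟩⟩, h₀⟩,
    ⟨x', ⟨ha', markedStrength_linkNeg.2 ⟨fun _ => ?_, by simp⟩,
    markedStrength_linkNeg.2 ⟨by simp, fun _ => ?_⟩⟩, h₁'⟩⟩
  · rw [leafSum_congr h₁, sf]
  · exact leafSum_eq_zero h₀
  · rw [leafSum_congr h₀', sg]
  · exact leafSum_eq_zero h₁'

theorem distinctComponents_linkNeg (k : ℕ) (f g : F3) :
    DistinctComponents (linkNegDiagram (k + 1) f g) Label.Kf Label.Kg := by
  obtain ⟨⟨x, hx, -⟩, -⟩ := separates_linkNeg k f g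
  have h := linkNegDiagram_eq (k + 1) f g
  refine hx.distinctComponents (i := 2) (i' := 1) (d := true) (d' := true) ?_ ?_ <;>
    change _ ∈ linkNegDiagram (k + 1) f g <;> rw [h] <;>
    simp [openDiagram, mark_mem_upperDiagram]

/-- The same evaluation as in the positive case, now with the coefficient `-(2 * k + 2)` of `F * G'
+ F' * G`. -/
theorem linkingNumber_linkNeg (k : ℕ) (f g : F3) :
    linkingNumber (linkNegDiagram (k + 1) f g) Label.Kf Label.Kg = -(k + 1 : ℕ) := by
  obtain ⟨⟨x, hx, hxg⟩, x', hx', hxf⟩ := separates_linkNeg k f g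
  obtain ⟨s, h₀⟩ := hx.direction
  obtain ⟨s', h₀'⟩ := hx'.direction
  have z₀ := fun j hj => h₀ j (hxg j hj)
  have z₁ : ∀ j < f.upper.numLeaves, dropFirst g.upper.numLeaves (leafStrengths _ _
      (direction (linkDiagram (linkNeg (k + 1) f g) (markAt [1, 0] [0])) Label.Kg)) j = 0 :=
    fun j hj => h₀' _ (hxf j hj)
  rw [linkNegDiagram, linkingNumber_linkDiagram, treeForm_linkNeg s.admissible s'.admissible
    ((markedStrength_linkNeg.1 s.one).2 rfl) ((markedStrength_linkNeg.1 s'.zero).2 rfl)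
    ((markedStrength_linkNeg.1 s.zero).1 rfl) ((markedStrength_linkNeg.1 s'.one).1 rfl),
    treeForm_eq_zero z₀, treeForm_eq_zero (by rwa [← g.numLeaves_eq]),
    treeForm_comm f.upper, treeForm_comm f.lower, treeForm_eq_zero z₁,
    treeForm_eq_zero (by rwa [← f.numLeaves_eq])]
  push_cast
  ring

end ThompsonLink

open ThompsonLink
theorem mainTheorem6 (f g : F3) (n : ℕ) (hn : 1 ≤ n) :
    (DistinctComponents (linkPosDiagram n f g) Label.Kf Label.Kg ∧
      linkingNumber (linkPosDiagram n f g) Label.Kf Label.Kg = n ∧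
      LinkIsotopic (linkPosDiagram n f g) (twistedDiagram 2 n f g)) ∧
    (DistinctComponents (linkNegDiagram n f g) Label.Kf Label.Kg ∧
      linkingNumber (linkNegDiagram n f g) Label.Kf Label.Kg = -n ∧
      LinkIsotopic (linkNegDiagram n f g) (twistedDiagram 3 n f g)) := by
  obtain ⟨k, rfl⟩ := Nat.exists_eq_add_of_le' hn
  exact ⟨⟨distinctComponents_linkPos k f g, linkingNumber_linkPos k f g, linkIsotopic_pos _ hn f g⟩,
    distinctComponents_linkNeg k f g, linkingNumber_linkNeg k f g, linkIsotopic_neg _ hn f g⟩
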